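/- Let $(M,g)$ be a complete smooth Riemannian manifold of dimension $m$, let $(N,h)$ be a smooth Riemannian manifold whose sectional curvatures are all equal to a constant $c\le 0$, and let $\varphi:(M,g)\to (N,h)$ be a smooth isometric immersion. Let $\overline\nabla$ be the connection on $\varphi^{-1}TN$ induced by the Levi-Civita connection $\nabla^N$ of $N$, let $\nabla$ be the Levi-Civita connection of $M$, and let $v_g$ be the Riemannian volume measure. With a local orthonormal frame $(e_i)$ of $M$, write $$\tau(\varphi)=\sum_{i=1}^m\big\{\overline\nabla_{e_i}(d\varphi(e_i))-d\varphi(\nabla_{e_i}e_i)\big\},\qquad \overline\Delta V=-\sum_{i=1}^m\big\{\overline\nabla_{e_i}\overline\nabla_{e_i}V-\overline\nabla_{\nabla_{e_i}e_i}V\big\},\qquad |\overline\nabla V|^2=\sum_{i=1}^m|\overline\nabla_{e_i}V|^2$$ for the tension field of $\varphi$ and, for a section $V$ of $\varphi^{-1}TN$, its rough Laplacian and the squared norm of its covariant derivative (and likewise for any smooth map $\psi:M\to N$ in place of $\varphi$). Assume that $\varphi$ is triharmonic, i.e. a critical point of the $3$-energy $E_3(\psi)=\frac12\int_M|\overline\nabla\tau(\psi)|^2\,v_g$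 with respect to compactly supported variations: for every smooth variation $(\varphi_t)_{t\in\mathbb R}$ of $\varphi=\varphi_0$ with $\varphi_t=\varphi$ outside a compact set $K$ for all $t$, one has $\frac{d}{dt}\big|_{t=0}\frac12\int_K|\overline\nabla\tau(\varphi_t)|^2\,v_g=0$. Assume moreover that $$\widetilde E_4(\varphi)=\frac12\int_M|\overline\Delta\tau(\varphi)|^2\,v_g<\infty\qquad\text{and}\qquad\int_M|\tau(\varphi)|^4\,v_g<\infty .$$ 1. If $c<0$, then $\varphi$ is harmonic, i.e. minimal: $\tau(\varphi)=0$ on $M$. 2. If $c=0$, $\mathrm{Vol}(M,g)=\infty$ and $E_2(\varphi)=\frac12\int_M|\tau(\varphi)|^2\,v_g<\infty$, then $\tau(\varphi)=0$ on $M$. 3. If $c=0$, $\mathrm{Vol}(M,g)<\infty$ and $E_3(\varphi)=\frac12\int_M|\overline\nabla\tau(\varphi)|^2\,v_g<\infty$, then $\tau(\varphi)=0$ on $M$. -/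

import Mathlib

open Bundle MeasureTheory
open scoped Manifold ContDiff ENNReal Topology

noncomputable section

namespace Triharmonic

/-! ### A Riemannian manifold in the preferred charts -/

section Metric

variable {n : ℕ} {N : Type*} [TopologicalSpace N] [ChartedSpace (EuclideanSpace ℝ (Fin n)) N]
  [IsManifold (𝓡 n) ∞ N]

/-- The coordinates, in the preferred chart at `p`, of a tangent vector at a point `q` of the
domain of that chart: this is the differential of the chart at `q`. -/
def coords (p q : N) : TangentSpace (𝓡 n) q →L[ℝ] EuclideanSpace ℝ (Fin n) :=
  (trivializationAt (EuclideanSpace ℝ (Fin n)) (TangentSpace (𝓡 n)) p).continuousLinearMapAt ℝ q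

/-- The vector field near `p` with constant coordinates `v` in the preferred chart at `p`, that is
`∑ i, v i • ∂/∂xⁱ`: its value at `q` is the image of `v` under the differential of the inverse of
the chart. -/
def constField (p : N) (v : EuclideanSpace ℝ (Fin n)) (q : N) : TangentSpace (𝓡 n) q :=
  (trivializationAt (EuclideanSpace ℝ (Fin n)) (TangentSpace (𝓡 n)) p).symmL ℝ q v

/-- The extension of a tangent vector `v` at `p` to a vector field near `p`, by constant
coordinates in the preferred chart at `p`. -/
def extendVec (p : N) (v : TangentSpace (𝓡 n) p) (q : N) : TangentSpace (𝓡 n) q :=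
  constField p (coords p p v) q

variable [RiemannianBundle (fun p : N => TangentSpace (𝓡 n) p)]

/-- The metric in the preferred chart at `p`: its value, at the point with coordinates `y`, on the
vectors with coordinates `u` and `v`. -/
def chartMetric (p : N) (y u v : EuclideanSpace ℝ (Fin n)) : ℝ :=
  inner ℝ (constField p u ((extChartAt (𝓡 n) p).symm y))
    (constField p v ((extChartAt (𝓡 n) p).symm y))

variable (n) in
/-- An orthonormal basis of the tangent space at `p`. -/
def frame (p : N) :
    OrthonormalBasis (Fin (Module.finrank ℝ (TangentSpace (𝓡 n) p))) ℝ (TangentSpace (𝓡 n) p) :=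
  haveI : FiniteDimensional ℝ (TangentSpace (𝓡 n) p) :=
    inferInstanceAs (FiniteDimensional ℝ (EuclideanSpace ℝ (Fin n)))
  stdOrthonormalBasis ℝ (TangentSpace (𝓡 n) p)

/-- The Christoffel symbols of the Levi-Civita connection at `p` in the preferred chart at `p`:
`Γ(u, v)` is the vector determined by
`⟨Γ(u, v), w⟩ = ½ (∂_u ⟨v, w⟩ + ∂_v ⟨u, w⟩ - ∂_w ⟨u, v⟩)` for all `w`. -/
def christoffel (p : N) (u v : TangentSpace (𝓡 n) p) : TangentSpace (𝓡 n) p :=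
  ∑ k, ((1 / 2 : ℝ) *
    (fderiv ℝ (fun y => chartMetric p y (coords p p v) (coords p p (frame n p k)))
        (extChartAt (𝓡 n) p p) (coords p p u)
      + fderiv ℝ (fun y => chartMetric p y (coords p p u) (coords p p (frame n p k)))
        (extChartAt (𝓡 n) p p) (coords p p v)
      - fderiv ℝ (fun y => chartMetric p y (coords p p u) (coords p p v))
        (extChartAt (𝓡 n) p p) (coords p p (frame n p k))))
    • frame n p k

/-- The Riemannian volume of the domain of the preferred chart at `p`, that is
`√(det (g_ij)) dy¹ ⋯ dyⁿ` carried over to the manifold. -/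
def chartVolume [MeasurableSpace N] (p : N) : Measure N :=
  (((volume : Measure (EuclideanSpace ℝ (Fin n))).restrict (extChartAt (𝓡 n) p).target).withDensity
    (fun y => ENNReal.ofReal (√(Matrix.det (Matrix.of fun i j : Fin n =>
      chartMetric p y (EuclideanSpace.single i 1) (EuclideanSpace.single j 1)))))).map
    (extChartAt (𝓡 n) p).symm

variable (n N) in
/-- The Riemannian volume measure `v_g`. The measures `chartVolume p` agree on the overlaps of the
chart domains, and their least upper bound is the measure that restricts to each of them. -/
def riemannianVolume [MeasurableSpace N] : Measure N :=
  ⨆ p : N, chartVolume (n := n) p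

end Metric

section Maps

variable (m n : ℕ)
  {M : Type*} [TopologicalSpace M] [ChartedSpace (EuclideanSpace ℝ (Fin m)) M]
  [IsManifold (𝓡 m) ∞ M]
  {N : Type*} [TopologicalSpace N] [ChartedSpace (EuclideanSpace ℝ (Fin n)) N]
  [IsManifold (𝓡 n) ∞ N]

section Connection

variable [RiemannianBundle (fun p : N => TangentSpace (𝓡 n) p)]

/-- The covariant derivative `∇̄_u V` at `x`, in the direction `u`, of a section `V` of the
pullback bundle `φ⁻¹TN`, for the connection induced by the Levi-Civita connection of `N`: in
coordinates `∂_u V^α + Γ^α_βγ (dφ u)^β V^γ`. -/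
def covDeriv (φ : M → N) (V : ∀ x : M, TangentSpace (𝓡 n) (φ x)) (x : M)
    (u : TangentSpace (𝓡 m) x) : TangentSpace (𝓡 n) (φ x) :=
  constField (φ x)
    (fderiv ℝ (fun y : EuclideanSpace ℝ (Fin m) =>
      coords (φ x) (φ ((extChartAt (𝓡 m) x).symm y)) (V ((extChartAt (𝓡 m) x).symm y)))
      (extChartAt (𝓡 m) x x) (coords x x u)) (φ x)
  + christoffel (φ x) (mfderiv (𝓡 m) (𝓡 n) φ x u) (V x)

/-- The Levi-Civita connection of `N`: the covariant derivative `∇_u Y` at `p` of a vector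
field `Y`. -/
def leviCivita (Y : ∀ p : N, TangentSpace (𝓡 n) p) (p : N) (u : TangentSpace (𝓡 n) p) :
    TangentSpace (𝓡 n) p :=
  covDeriv n n (fun q : N => q) Y p u

/-- The curvature tensor `R(u, v)w = ∇_u ∇_v w - ∇_v ∇_u w - ∇_[u, v] w` at `p`, where the vectors
are extended to fields with constant coordinates in the chart at `p`, so that `[u, v] = 0`. -/
def curvature (p : N) (u v w : TangentSpace (𝓡 n) p) : TangentSpace (𝓡 n) p :=
  leviCivita n (fun q => leviCivita n (extendVec p w) q (extendVec p v q)) p u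
    - leviCivita n (fun q => leviCivita n (extendVec p w) q (extendVec p u q)) p v

variable (N) in
/-- All sectional curvatures of `N` are equal to `c`. -/
def HasConstantCurvature (c : ℝ) : Prop :=
  ∀ (p : N) (u v : TangentSpace (𝓡 n) p),
    inner ℝ (curvature n p u v v) u = c * (inner ℝ u u * inner ℝ v v - inner ℝ u v ^ 2)

end Connection

variable [RiemannianBundle (fun x : M => TangentSpace (𝓡 m) x)]
  [RiemannianBundle (fun p : N => TangentSpace (𝓡 n) p)]

/-- A smooth map whose differential preserves the inner products. -/
def IsIsometricImmersion (φ : M → N) : Prop :=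
  ContMDiff (𝓡 m) (𝓡 n) ∞ φ ∧
    ∀ (x : M) (u v : TangentSpace (𝓡 m) x),
      inner ℝ (mfderiv (𝓡 m) (𝓡 n) φ x u) (mfderiv (𝓡 m) (𝓡 n) φ x v) = inner ℝ u v

/-- The second fundamental form `B(φ)(u, v) = ∇̄_u (dφ v) - dφ (∇_u v)` of `φ` at `x`, where `v`
is extended to the field with constant coordinates in the chart at `x`. -/
def secondFundamentalForm (φ : M → N) (x : M) (u v : TangentSpace (𝓡 m) x) :
    TangentSpace (𝓡 n) (φ x) :=
  covDeriv m n φ (fun q => mfderiv (𝓡 m) (𝓡 n) φ q (extendVec x v q)) x u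
    - mfderiv (𝓡 m) (𝓡 n) φ x (leviCivita m (extendVec x v) x u)

/-- The tension field `τ(φ) = ∑ i, B(φ)(eᵢ, eᵢ)`. -/
def tension (φ : M → N) (x : M) : TangentSpace (𝓡 n) (φ x) :=
  ∑ i, secondFundamentalForm m n φ x (frame m x i) (frame m x i)

/-- The rough Laplacian `Δ̄V = -∑ i, (∇̄_eᵢ ∇̄_eᵢ V - ∇̄_(∇_eᵢ eᵢ) V)` on sections of `φ⁻¹TN`;
at the point `x`, the vector `eᵢ` is extended to the field with constant coordinates in the chart
at `x`. -/
def roughLaplacian (φ : M → N) (V : ∀ x : M, TangentSpace (𝓡 n) (φ x)) (x : M) :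
    TangentSpace (𝓡 n) (φ x) :=
  -∑ i, (covDeriv m n φ (fun q => covDeriv m n φ V q (extendVec x (frame m x i) q)) x (frame m x i)
    - covDeriv m n φ V x (leviCivita m (extendVec x (frame m x i)) x (frame m x i)))

/-- `|∇̄V|² = ∑ i, |∇̄_eᵢ V|²`. -/
def normSqCovDeriv (φ : M → N) (V : ∀ x : M, TangentSpace (𝓡 n) (φ x)) (x : M) : ℝ :=
  ∑ i, ‖covDeriv m n φ V x (frame m x i)‖ ^ 2

variable [MeasurableSpace M]

/-- The bienergy `E₂(φ) = ½ ∫ |τ(φ)|²`. -/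
def bienergy (φ : M → N) : ℝ≥0∞ :=
  (1 / 2) * ∫⁻ x, ENNReal.ofReal (‖tension m n φ x‖ ^ 2) ∂(riemannianVolume m M)

/-- The integral `∫ |τ(φ)|⁴`. -/
def tensionL4 (φ : M → N) : ℝ≥0∞ :=
  ∫⁻ x, ENNReal.ofReal (‖tension m n φ x‖ ^ 4) ∂(riemannianVolume m M)

/-- The 3-energy over a set `K`, that is `½ ∫_K |∇̄τ(φ)|²`. -/
def trienergyOn (K : Set M) (φ : M → N) : ℝ≥0∞ :=
  (1 / 2) * ∫⁻ x in K, ENNReal.ofReal (normSqCovDeriv m n φ (tension m n φ) x) ∂(riemannianVolume m M)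

/-- The 3-energy `E₃(φ) = ½ ∫ |∇̄τ(φ)|²`. -/
def trienergy (φ : M → N) : ℝ≥0∞ := trienergyOn m n Set.univ φ

/-- The extended 4-energy `Ẽ₄(φ) = ½ ∫ |Δ̄τ(φ)|²`. -/
def extendedFourEnergy (φ : M → N) : ℝ≥0∞ :=
  (1 / 2) * ∫⁻ x, ENNReal.ofReal (‖roughLaplacian m n φ (tension m n φ) x‖ ^ 2) ∂(riemannianVolume m M)

/-- A smooth map is triharmonic if it is a critical point of the 3-energy: for every smooth
variation `F t` of `φ = F 0` that is constant in `t` outside a compact set `K`, the derivative at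
`t = 0` of the 3-energy over `K` vanishes. -/
def IsTriharmonic (φ : M → N) : Prop :=
  ContMDiff (𝓡 m) (𝓡 n) ∞ φ ∧
    ∀ (F : ℝ → M → N) (K : Set M),
      ContMDiff (𝓘(ℝ, ℝ).prod (𝓡 m)) (𝓡 n) ∞ (fun z : ℝ × M => F z.1 z.2) →
      F 0 = φ → IsCompact K → (∀ t : ℝ, ∀ x ∉ K, F t x = φ x) →
      HasDerivAt (fun t : ℝ => (trienergyOn m n K (F t)).toReal) 0 0

/-- A map is harmonic if its tension field vanishes; an isometric immersion with this property is
called minimal. -/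
def IsHarmonic (φ : M → N) : Prop :=
  ∀ x : M, tension m n φ x = 0

end Maps

end Triharmonic

end

noncomputable section

namespace Triharmonic

set_option maxSynthPendingDepth 3
set_option linter.unusedSectionVars false

/-! Write `τ` for the tension field and `W = Δ̄τ`. For an isometric immersion into a space of
constant curvature `c` the Euler–Lagrange equation of the 3-energy is explicit. Paired with `W` it
reads `⟨Δ̄W, W⟩ = c ∑ᵢ (|W|² - ⟨W, dφ eᵢ⟩²) + c |τ|² ⟨τ, W⟩`
(`inner_roughLaplacian_roughLaplacian_tension`). For `c ≤ 0` the sum has a good sign, and the last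
term is compensated by a second divergence: `T = div ⟨∇̄W, W⟩ + |c| div ⟨∇̄τ, |τ|²τ⟩` satisfies `T ≥
P`, where `P = |∇̄W|² + |c| |τ|² |∇̄τ|²`.

Testing `T` against `η²`, with `η` a cutoff of Lipschitz constant `1/R`, and absorbing half of the
left side gives `∫ η² P ≤ 4 R⁻² ∫ S` with `S = |W|² + |c| |τ|⁴`. The hypotheses make `S` integrable,
so `R → ∞` yields `P = 0` (`normSqCovDeriv_roughLaplacian_add_eq_zero`).

If `c < 0`, then at each point `τ = 0` or `∇̄τ = 0`. The second alternative implies the first: `τ`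
is normal, so `∑ᵢ ⟨∇̄_eᵢ τ, dφ eᵢ⟩ = -|τ|²` (`IsIsometricImmersion.sum_covDeriv_tension`). If `c =
0`, then `W` is parallel. Once `τ` and `∇̄τ` are square integrable, the same cutoff argument applied
to `div ⟨∇̄τ, W⟩ = -|W|²` gives `W = 0`, and applied to `div ⟨∇̄τ, τ⟩ = |∇̄τ|²` it gives `∇̄τ = 0`
(`normSqCovDeriv_eq_zero_of_parallel`). Square integrability of `∇̄τ` is assumed in the finite
volume case and follows from that of `τ` and `W` in the other.

Two bridges connect this to the definitions. The Euler–Lagrange equation is derived in charts: the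
variation of `|∇̄τ|²` is computed with Christoffel symbols, integrated by parts, and tested on
variations supported in one chart (`IsTriharmonic.eulerForm_eq_zero`). Integration by parts against
Lipschitz functions is proved in charts with Rademacher's theorem and globalized by a partition of
unity (`abs_integral_sq_mul_divPair_le`). Completeness enters through the compactness of closed
balls (`isCompact_edist_le`). -/

/-! ### Metrics and connections on open subsets of a vector space -/

section Coordinates

variable {F : Type*} [NormedAddCommGroup F] [NormedSpace ℝ F]
  {X : Type*} [NormedAddCommGroup X] [NormedSpace ℝ X]

/-- The map sending the derivative of a metric to the lowered Christoffel symbols. -/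
def koszulL : (F →L[ℝ] F →L[ℝ] F →L[ℝ] ℝ) →L[ℝ] (F →L[ℝ] F →L[ℝ] F →L[ℝ] ℝ) :=
  (1 / 2 : ℝ) • (ContinuousLinearMap.id ℝ _
    + (ContinuousLinearMap.flipₗᵢ ℝ F F (F →L[ℝ] ℝ)).toContinuousLinearEquiv.toContinuousLinearMap
    - ((ContinuousLinearMap.compL ℝ F (F →L[ℝ] F →L[ℝ] ℝ) (F →L[ℝ] F →L[ℝ] ℝ))
        (ContinuousLinearMap.flipₗᵢ ℝ F F ℝ).toContinuousLinearEquiv.toContinuousLinearMap).comp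
      (ContinuousLinearMap.flipₗᵢ ℝ F F (F →L[ℝ] ℝ)).toContinuousLinearEquiv.toContinuousLinearMap)

lemma koszulL_apply (D : F →L[ℝ] F →L[ℝ] F →L[ℝ] ℝ) (a b c : F) :
    koszulL D a b c = 1 / 2 * (D a b c + D b a c - D c a b) := by
  simp [koszulL]

/-- The inverse of a metric, as a map from covectors to vectors. -/
def sharp (h : F → F →L[ℝ] F →L[ℝ] ℝ) (y : F) : (F →L[ℝ] ℝ) →L[ℝ] F := (h y).inverse

/-- The Christoffel symbols of a metric. -/
def chris (h : F → F →L[ℝ] F →L[ℝ] ℝ) (y : F) : F →L[ℝ] F →L[ℝ] F :=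
  ((ContinuousLinearMap.compL ℝ F (F →L[ℝ] ℝ) F) (sharp h y)).comp (koszulL (fderiv ℝ h y))

lemma chris_apply (h : F → F →L[ℝ] F →L[ℝ] ℝ) (y a b : F) :
    chris h y a b = sharp h y (koszulL (fderiv ℝ h y) a b) := rfl

/-- A smooth Riemannian metric on the open set `Ω`. -/
structure IsMetricOn (h : F → F →L[ℝ] F →L[ℝ] ℝ) (Ω : Set F) : Prop where
  isOpen : IsOpen Ω
  smooth : ContDiffOn ℝ ∞ h Ω
  symm : ∀ y ∈ Ω, ∀ a b, h y a b = h y b a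
  pos : ∀ y ∈ Ω, ∀ a, a ≠ 0 → 0 < h y a a

/-- The covariant derivative of a vector field `V` along `f`. -/
def cov (Γ : F → F →L[ℝ] F →L[ℝ] F) (f V : X → F) (x : X) : X →L[ℝ] F :=
  fderiv ℝ V x + ((Γ (f x)).flip (V x)).comp (fderiv ℝ f x)

lemma cov_apply (Γ : F → F →L[ℝ] F →L[ℝ] F) (f V : X → F) (x a : X) :
    cov Γ f V x a = fderiv ℝ V x a + Γ (f x) (fderiv ℝ f x a) (V x) := rfl

/-- The curvature tensor of a connection with symbols `Γ`. -/
def riem (Γ : F → F →L[ℝ] F →L[ℝ] F) (y a b w : F) : F :=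
  fderiv ℝ Γ y a b w - fderiv ℝ Γ y b a w + Γ y a (Γ y b w) - Γ y b (Γ y a w)

/-- The covariant derivative of a one-form `ϖ` along `f` with values in the pullback bundle. -/
def covForm (Γg : X → X →L[ℝ] X →L[ℝ] X) (Γ : F → F →L[ℝ] F →L[ℝ] F) (f : X → F)
    (ϖ : X → X →L[ℝ] F) (x : X) : X →L[ℝ] X →L[ℝ] F :=
  fderiv ℝ ϖ x + ((ContinuousLinearMap.compL ℝ X F F).flip (ϖ x)).comp ((Γ (f x)).comp (fderiv ℝ f x))
    - ((ContinuousLinearMap.compL ℝ X X F) (ϖ x)).comp (Γg x)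

lemma covForm_apply (Γg : X → X →L[ℝ] X →L[ℝ] X) (Γ : F → F →L[ℝ] F →L[ℝ] F) (f : X → F)
    (ϖ : X → X →L[ℝ] F) (x a b : X) :
    covForm Γg Γ f ϖ x a b
      = fderiv ℝ ϖ x a b + Γ (f x) (fderiv ℝ f x a) (ϖ x b) - ϖ x (Γg x a b) := rfl

/-- The covariant derivative of a scalar one-form. -/
def covOne (Γg : X → X →L[ℝ] X →L[ℝ] X) (θ : X → X →L[ℝ] ℝ) (x : X) : X →L[ℝ] X →L[ℝ] ℝ :=
  fderiv ℝ θ x - ((ContinuousLinearMap.compL ℝ X X ℝ) (θ x)).comp (Γg x)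

lemma covOne_apply (Γg : X → X →L[ℝ] X →L[ℝ] X) (θ : X → X →L[ℝ] ℝ) (x a b : X) :
    covOne Γg θ x a b = fderiv ℝ θ x a b - θ x (Γg x a b) := rfl

section Metric

variable {h : F → F →L[ℝ] F →L[ℝ] ℝ} {Ω : Set F}

lemma IsMetricOn.diffAt (hm : IsMetricOn h Ω) {y : F} (hy : y ∈ Ω) : DifferentiableAt ℝ h y :=
  (hm.smooth.contDiffAt (hm.isOpen.mem_nhds hy)).differentiableAt (by simp)

lemma IsMetricOn.fderiv_symm (hm : IsMetricOn h Ω) {y : F} (hy : y ∈ Ω) (a b c : F) :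
    fderiv ℝ h y a b c = fderiv ℝ h y a c b := by
  have hd := hm.diffAt hy
  have h1 : HasFDerivAt (fun z => h z b c)
      (((ContinuousLinearMap.apply ℝ ℝ c).comp
        ((ContinuousLinearMap.apply ℝ (F →L[ℝ] ℝ) b))).comp (fderiv ℝ h y)) y :=
    ((ContinuousLinearMap.apply ℝ ℝ c).comp
        ((ContinuousLinearMap.apply ℝ (F →L[ℝ] ℝ) b))).hasFDerivAt.comp y hd.hasFDerivAt
  have h2 : HasFDerivAt (fun z => h z c b)
      (((ContinuousLinearMap.apply ℝ ℝ b).comp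
        ((ContinuousLinearMap.apply ℝ (F →L[ℝ] ℝ) c))).comp (fderiv ℝ h y)) y :=
    ((ContinuousLinearMap.apply ℝ ℝ b).comp
        ((ContinuousLinearMap.apply ℝ (F →L[ℝ] ℝ) c))).hasFDerivAt.comp y hd.hasFDerivAt
  have h3 : (fun z => h z b c) =ᶠ[𝓝 y] (fun z => h z c b) := by
    filter_upwards [hm.isOpen.mem_nhds hy] with z hz using hm.symm z hz b c
  have := (h1.congr_of_eventuallyEq h3.symm).unique h2
  exact congrArg (fun L => L a) this

variable [FiniteDimensional ℝ F]

/-- Positive definiteness gives injectivity, and a space and its dual have equal dimension. Hence on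
`Ω` the `ContinuousLinearMap.inverse` in `sharp` is a genuine inverse and not its default value. -/
lemma IsMetricOn.exists_equiv (hm : IsMetricOn h Ω) {y : F} (hy : y ∈ Ω) :
    ∃ e : F ≃L[ℝ] (F →L[ℝ] ℝ), (e : F →L[ℝ] F →L[ℝ] ℝ) = h y := by
  have hinj : Function.Injective (h y).toLinearMap := by
    rw [← LinearMap.ker_eq_bot, LinearMap.ker_eq_bot']
    intro a ha
    by_contra hne
    have := hm.pos y hy a hne
    have h0 : h y a = 0 := ha
    simp [h0] at this
  have hfr : Module.finrank ℝ F = Module.finrank ℝ (F →L[ℝ] ℝ) := by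
    rw [← (LinearMap.toContinuousLinearMap (𝕜 := ℝ) (E := F) (F' := ℝ)).finrank_eq]
    exact (Subspace.dual_finrank_eq (K := ℝ) (V := F)).symm
  refine ⟨(LinearEquiv.ofInjectiveOfFinrankEq (h y).toLinearMap hinj hfr).toContinuousLinearEquiv, ?_⟩
  ext a b
  rfl

lemma IsMetricOn.apply_sharp (hm : IsMetricOn h Ω) {y : F} (hy : y ∈ Ω) (θ : F →L[ℝ] ℝ) :
    h y (sharp h y θ) = θ := by
  obtain ⟨e, he⟩ := hm.exists_equiv hy
  rw [sharp, ← he, ContinuousLinearMap.inverse_equiv]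
  exact e.apply_symm_apply θ

lemma IsMetricOn.sharp_apply (hm : IsMetricOn h Ω) {y : F} (hy : y ∈ Ω) (a : F) :
    sharp h y (h y a) = a := by
  obtain ⟨e, he⟩ := hm.exists_equiv hy
  rw [sharp, ← he, ContinuousLinearMap.inverse_equiv]
  exact e.symm_apply_apply a

lemma IsMetricOn.sharp_symm (hm : IsMetricOn h Ω) {y : F} (hy : y ∈ Ω) (θ ϖ : F →L[ℝ] ℝ) :
    θ (sharp h y ϖ) = ϖ (sharp h y θ) := by
  conv_lhs => rw [← hm.apply_sharp hy θ]
  conv_rhs => rw [← hm.apply_sharp hy ϖ]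
  exact hm.symm y hy _ _

lemma IsMetricOn.eq_of_forall (hm : IsMetricOn h Ω) {y : F} (hy : y ∈ Ω) {a b : F}
    (hab : ∀ c, h y a c = h y b c) : a = b := by
  rw [← hm.sharp_apply hy a, ← hm.sharp_apply hy b, ContinuousLinearMap.ext hab]

lemma IsMetricOn.smooth_sharp (hm : IsMetricOn h Ω) : ContDiffOn ℝ ∞ (sharp h) Ω := by
  intro y hy
  obtain ⟨e, he⟩ := hm.exists_equiv hy
  have h1 : ContDiffAt ℝ ∞ (ContinuousLinearMap.inverse : (F →L[ℝ] F →L[ℝ] ℝ) → _) (h y) := by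
    rw [← he]; exact contDiffAt_map_inverse e
  exact ContDiffAt.comp_contDiffWithinAt y h1 (hm.smooth y hy)

lemma IsMetricOn.smooth_chris (hm : IsMetricOn h Ω) : ContDiffOn ℝ ∞ (chris h) Ω := by
  have h1 : ContDiffOn ℝ ∞ (fderiv ℝ h) Ω :=
    hm.smooth.fderiv_of_isOpen hm.isOpen (by simp)
  have h2 : ContDiffOn ℝ ∞ (fun y => koszulL (fderiv ℝ h y)) Ω := koszulL.contDiff.comp_contDiffOn h1
  have h3 : ContDiffOn ℝ ∞ (fun y => (ContinuousLinearMap.compL ℝ F (F →L[ℝ] ℝ) F) (sharp h y)) Ω :=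
    (ContinuousLinearMap.compL ℝ F (F →L[ℝ] ℝ) F).contDiff.comp_contDiffOn hm.smooth_sharp
  exact h3.clm_comp h2

lemma IsMetricOn.apply_chris (hm : IsMetricOn h Ω) {y : F} (hy : y ∈ Ω) (a b c : F) :
    h y (chris h y a b) c
      = 1 / 2 * (fderiv ℝ h y a b c + fderiv ℝ h y b a c - fderiv ℝ h y c a b) := by
  rw [chris_apply, hm.apply_sharp hy, koszulL_apply]

lemma IsMetricOn.chris_symm (hm : IsMetricOn h Ω) {y : F} (hy : y ∈ Ω) (a b : F) :
    chris h y a b = chris h y b a := by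
  apply hm.eq_of_forall hy
  intro c
  rw [hm.apply_chris hy, hm.apply_chris hy, hm.fderiv_symm hy c a b]
  ring

/-- In the sum of the two Koszul expressions the terms differentiated along `b` and `c` cancel. -/
lemma IsMetricOn.compat (hm : IsMetricOn h Ω) {y : F} (hy : y ∈ Ω) (a b c : F) :
    fderiv ℝ h y a b c = h y (chris h y a b) c + h y b (chris h y a c) := by
  rw [hm.symm y hy b, hm.apply_chris hy, hm.apply_chris hy, hm.fderiv_symm hy a c b,
    hm.fderiv_symm hy b a c, hm.fderiv_symm hy c a b]
  ring

/-- The covariant derivative is compatible with the metric. -/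
lemma IsMetricOn.hasFDerivAt_inner (hm : IsMetricOn h Ω) {f V W : X → F} {x : X} (hx : f x ∈ Ω)
    (hf : DifferentiableAt ℝ f x) (hV : DifferentiableAt ℝ V x) (hW : DifferentiableAt ℝ W x) :
    HasFDerivAt (fun z => h (f z) (V z) (W z))
      ((h (f x)).flip (W x) ∘L cov (chris h) f V x + h (f x) (V x) ∘L cov (chris h) f W x) x := by
  have h1 : HasFDerivAt (fun z => h (f z)) ((fderiv ℝ h (f x)).comp (fderiv ℝ f x)) x :=
    (hm.diffAt hx).hasFDerivAt.comp x hf.hasFDerivAt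
  have h2 := (h1.clm_apply hV.hasFDerivAt).clm_apply hW.hasFDerivAt
  refine h2.congr_fderiv ?_
  ext a
  simp only [add_apply, ContinuousLinearMap.comp_apply,
    ContinuousLinearMap.flip_apply, cov_apply, map_add, hm.compat hx]
  ring

lemma IsMetricOn.fderiv_inner (hm : IsMetricOn h Ω) {f V W : X → F} {x : X} (hx : f x ∈ Ω)
    (hf : DifferentiableAt ℝ f x) (hV : DifferentiableAt ℝ V x) (hW : DifferentiableAt ℝ W x)
    (a : X) :
    fderiv ℝ (fun z => h (f z) (V z) (W z)) x a
      = h (f x) (cov (chris h) f V x a) (W x) + h (f x) (V x) (cov (chris h) f W x a) := by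
  rw [(hm.hasFDerivAt_inner hx hf hV hW).fderiv]
  simp

end Metric

section Smoothness

variable {Γ : F → F →L[ℝ] F →L[ℝ] F} {Ω : Set F} {f V : X → F} {U : Set X}

lemma smooth_cov (hΓ : ContDiffOn ℝ ∞ Γ Ω) (hU : IsOpen U) (hf : ContDiffOn ℝ ∞ f U)
    (hfU : Set.MapsTo f U Ω) (hV : ContDiffOn ℝ ∞ V U) : ContDiffOn ℝ ∞ (cov Γ f V) U := by
  have h1 : ContDiffOn ℝ ∞ (fun x => Γ (f x)) U := hΓ.comp hf hfU
  have h2 : ContDiffOn ℝ ∞ (fun x => (Γ (f x)).flip) U :=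
    (ContinuousLinearMap.flipₗᵢ ℝ F F F).toContinuousLinearEquiv.contDiff.comp_contDiffOn h1
  exact (hV.fderiv_of_isOpen hU (by simp)).add
    ((h2.clm_apply hV).clm_comp (hf.fderiv_of_isOpen hU (by simp)))

lemma smooth_covForm {Γg : X → X →L[ℝ] X →L[ℝ] X} {ϖ : X → X →L[ℝ] F}
    (hΓg : ContDiffOn ℝ ∞ Γg U) (hΓ : ContDiffOn ℝ ∞ Γ Ω) (hU : IsOpen U)
    (hf : ContDiffOn ℝ ∞ f U) (hfU : Set.MapsTo f U Ω) (hϖ : ContDiffOn ℝ ∞ ϖ U) :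
    ContDiffOn ℝ ∞ (covForm Γg Γ f ϖ) U := by
  have h1 : ContDiffOn ℝ ∞ (fun x => Γ (f x)) U := hΓ.comp hf hfU
  have h2 : ContDiffOn ℝ ∞ (fun x => (ContinuousLinearMap.compL ℝ X F F).flip (ϖ x)) U :=
    (ContinuousLinearMap.contDiff _).comp_contDiffOn hϖ
  have h3 : ContDiffOn ℝ ∞ (fun x => (ContinuousLinearMap.compL ℝ X X F) (ϖ x)) U :=
    (ContinuousLinearMap.contDiff _).comp_contDiffOn hϖ
  exact ((hϖ.fderiv_of_isOpen hU (by simp)).add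
    (h2.clm_comp (h1.clm_comp (hf.fderiv_of_isOpen hU (by simp))))).sub (h3.clm_comp hΓg)

end Smoothness

end Coordinates

/-! ### Commutation, change of coordinates, traces -/

section Commutation

variable {F : Type*} [NormedAddCommGroup F] [NormedSpace ℝ F]
  {X : Type*} [NormedAddCommGroup X] [NormedSpace ℝ X]

lemma fderiv_clm_apply_const {G H : Type*} [NormedAddCommGroup G] [NormedSpace ℝ G]
    [NormedAddCommGroup H] [NormedSpace ℝ H] {L : X → G →L[ℝ] H} {x : X}
    (hL : DifferentiableAt ℝ L x) (b : G) (a : X) :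
    fderiv ℝ (fun z => L z b) x a = fderiv ℝ L x a b := by
  have := hL.hasFDerivAt.clm_apply (hasFDerivAt_const b x)
  rw [this.fderiv]
  simp

/-- Preparation for `cov_comm`: the two Hessian terms are symmetric in `a` and `c`, so they
disappear from the commutator. -/
lemma hasFDerivAt_cov_apply {Γ : F → F →L[ℝ] F →L[ℝ] F} {f V : X → F} {x : X}
    (hΓ : DifferentiableAt ℝ Γ (f x)) (hf : ContDiffAt ℝ 2 f x) (hV : ContDiffAt ℝ 2 V x)
    (c a : X) :
    fderiv ℝ (fun z => cov Γ f V z c) x a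
      = fderiv ℝ (fderiv ℝ V) x a c + fderiv ℝ Γ (f x) (fderiv ℝ f x a) (fderiv ℝ f x c) (V x)
        + Γ (f x) (fderiv ℝ (fderiv ℝ f) x a c) (V x)
        + Γ (f x) (fderiv ℝ f x c) (fderiv ℝ V x a) := by
  have hf1 := hf.differentiableAt (by simp)
  have hV1 := hV.differentiableAt (by simp)
  have hf2 : DifferentiableAt ℝ (fderiv ℝ f) x :=
    (hf.fderiv_right (m := 1) (by norm_num)).differentiableAt (by simp)
  have hV2 : DifferentiableAt ℝ (fderiv ℝ V) x :=
    (hV.fderiv_right (m := 1) (by norm_num)).differentiableAt (by simp)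
  have h1 : HasFDerivAt (fun z => Γ (f z)) ((fderiv ℝ Γ (f x)).comp (fderiv ℝ f x)) x :=
    hΓ.hasFDerivAt.comp x hf1.hasFDerivAt
  have h2 := (hV2.hasFDerivAt.clm_apply (hasFDerivAt_const c x)).add
    ((h1.clm_apply (hf2.hasFDerivAt.clm_apply (hasFDerivAt_const c x))).clm_apply hV1.hasFDerivAt)
  have h3 : (fun z => cov Γ f V z c) = ((fun z => fderiv ℝ V z c)
    + fun z => Γ (f z) (fderiv ℝ f z c) (V z)) := rfl
  rw [h3, h2.fderiv]
  simp
  abel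

/-- The curvature measures the failure of covariant derivatives to commute. -/
lemma cov_comm {Γ : F → F →L[ℝ] F →L[ℝ] F} {f V : X → F} {x : X}
    (hΓ : DifferentiableAt ℝ Γ (f x)) (hf : ContDiffAt ℝ 2 f x) (hV : ContDiffAt ℝ 2 V x)
    (a b : X) :
    cov Γ f (fun z => cov Γ f V z b) x a
      = cov Γ f (fun z => cov Γ f V z a) x b
        + riem Γ (f x) (fderiv ℝ f x a) (fderiv ℝ f x b) (V x) := by
  rw [cov_apply Γ f (fun z => cov Γ f V z b), cov_apply Γ f (fun z => cov Γ f V z a),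
    hasFDerivAt_cov_apply hΓ hf hV, hasFDerivAt_cov_apply hΓ hf hV, cov_apply, cov_apply, riem, (hf.isSymmSndFDerivAt (by simp)).eq a b,
    (hV.isSymmSndFDerivAt (by simp)).eq a b]
  simp only [map_add]
  abel

/-- This is torsion-freeness: the Hessian of `f` and the symbols `Γ` are both symmetric. On `ℝ ×
Eucl m` it exchanges a time derivative with a space derivative. -/
lemma cov_fderiv_comm {Γ : F → F →L[ℝ] F →L[ℝ] F} {f : X → F} {x : X}
    (hΓ : ∀ a b, Γ (f x) a b = Γ (f x) b a) (hf : ContDiffAt ℝ 2 f x) (a b : X) :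
    cov Γ f (fun z => fderiv ℝ f z b) x a = cov Γ f (fun z => fderiv ℝ f z a) x b := by
  have hf2 : DifferentiableAt ℝ (fderiv ℝ f) x :=
    (hf.fderiv_right (m := 1) (by norm_num)).differentiableAt (by simp)
  rw [cov_apply, cov_apply, fderiv_clm_apply_const hf2, fderiv_clm_apply_const hf2,
    (hf.isSymmSndFDerivAt (by simp)).eq a b, hΓ]

lemma covForm_eq {Γg : X → X →L[ℝ] X →L[ℝ] X} {Γ : F → F →L[ℝ] F →L[ℝ] F} {f : X → F}
    {ϖ : X → X →L[ℝ] F} {x : X} (hϖ : DifferentiableAt ℝ ϖ x) (a b : X) :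
    covForm Γg Γ f ϖ x a b = cov Γ f (fun z => ϖ z b) x a - ϖ x (Γg x a b) := by
  rw [covForm_apply, cov_apply, fderiv_clm_apply_const hϖ]

/-- The scalar one-form obtained by pairing a one-form with values in the pullback bundle with a
section. -/
def pairForm (h : F → F →L[ℝ] F →L[ℝ] ℝ) (f : X → F) (ϖ : X → X →L[ℝ] F) (Z : X → F) (x : X) :
    X →L[ℝ] ℝ := ((h (f x)).flip (Z x)).comp (ϖ x)

lemma pairForm_apply (h : F → F →L[ℝ] F →L[ℝ] ℝ) (f : X → F) (ϖ : X → X →L[ℝ] F) (Z : X → F)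
    (x a : X) : pairForm h f ϖ Z x a = h (f x) (ϖ x a) (Z x) := rfl

lemma smooth_pairForm {h : F → F →L[ℝ] F →L[ℝ] ℝ} {Ω : Set F} {U : Set X} {f Z : X → F}
    {ϖ : X → X →L[ℝ] F} (hm : IsMetricOn h Ω) (hf : ContDiffOn ℝ ∞ f U)
    (hfU : Set.MapsTo f U Ω) (hϖ : ContDiffOn ℝ ∞ ϖ U) (hZ : ContDiffOn ℝ ∞ Z U) :
    ContDiffOn ℝ ∞ (pairForm h f ϖ Z) U := by
  have h1 : ContDiffOn ℝ ∞ (fun x => (h (f x)).flip) U :=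
    (ContinuousLinearMap.flipₗᵢ ℝ F F ℝ).toContinuousLinearEquiv.contDiff.comp_contDiffOn
      (hm.smooth.comp hf hfU)
  exact (h1.clm_apply hZ).clm_comp hϖ

/-- Metric compatibility distributes the derivative over the two factors, and the correction by `Γg`
is the same on both sides. -/
lemma IsMetricOn.covOne_pairForm [FiniteDimensional ℝ F] {h : F → F →L[ℝ] F →L[ℝ] ℝ} {Ω : Set F}
    (hm : IsMetricOn h Ω)
    {Γg : X → X →L[ℝ] X →L[ℝ] X} {f Z : X → F} {ϖ : X → X →L[ℝ] F} {x : X} (hx : f x ∈ Ω)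
    (hf : DifferentiableAt ℝ f x) (hϖ : DifferentiableAt ℝ ϖ x) (hZ : DifferentiableAt ℝ Z x)
    (a b : X) :
    covOne Γg (pairForm h f ϖ Z) x a b
      = h (f x) (covForm Γg (chris h) f ϖ x a b) (Z x)
        + h (f x) (ϖ x b) (cov (chris h) f Z x a) := by
  have hd : DifferentiableAt ℝ (pairForm h f ϖ Z) x := by
    have h1 : DifferentiableAt ℝ (fun x => (h (f x)).flip) x :=
      (ContinuousLinearMap.flipₗᵢ ℝ F F ℝ).toContinuousLinearEquiv.differentiableAt.comp x
        ((hm.diffAt hx).comp x hf)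
    exact (h1.clm_apply hZ).clm_comp hϖ
  rw [covOne_apply, ← fderiv_clm_apply_const hd]
  simp only [pairForm_apply]
  rw [hm.fderiv_inner hx hf (hϖ.clm_apply (differentiableAt_const b)) hZ, covForm_eq hϖ, map_sub]
  simp only [sub_apply]
  ring

end Commutation

section ChangeOfCoordinates

variable {F G : Type*} [NormedAddCommGroup F] [NormedSpace ℝ F] [FiniteDimensional ℝ F]
  [NormedAddCommGroup G] [NormedSpace ℝ G] [FiniteDimensional ℝ G]

/-- The transformation law of the Christoffel symbols. -/
lemma IsMetricOn.chris_transform {h₀ : F → F →L[ℝ] F →L[ℝ] ℝ} {h₁ : G → G →L[ℝ] G →L[ℝ] ℝ}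
    {Ω₀ : Set F} {Ω₁ : Set G} (hm₀ : IsMetricOn h₀ Ω₀) (hm₁ : IsMetricOn h₁ Ω₁) {ψ : F → G} {y : F}
    (hy : y ∈ Ω₀) (hψy : ψ y ∈ Ω₁) (hψ : ContDiffAt ℝ 2 ψ y)
    (hsurj : Function.Surjective (fderiv ℝ ψ y))
    (heq : ∀ᶠ z in 𝓝 y, ∀ a b, h₀ z a b = h₁ (ψ z) (fderiv ℝ ψ z a) (fderiv ℝ ψ z b)) (a b : F) :
    fderiv ℝ ψ y (chris h₀ y a b)
      = chris h₁ (ψ y) (fderiv ℝ ψ y a) (fderiv ℝ ψ y b) + fderiv ℝ (fderiv ℝ ψ) y a b := by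
  have hψ1 := hψ.differentiableAt (by simp)
  have hψ2 : DifferentiableAt ℝ (fderiv ℝ ψ) y :=
    (hψ.fderiv_right (m := 1) (by norm_num)).differentiableAt (by simp)
  -- The pullback identity for the metrics is differentiated. In the Koszul combination of three
  -- such identities only one Hessian term survives.
  have key : ∀ a b c, fderiv ℝ h₀ y a b c
      = fderiv ℝ h₁ (ψ y) (fderiv ℝ ψ y a) (fderiv ℝ ψ y b) (fderiv ℝ ψ y c)
        + h₁ (ψ y) (fderiv ℝ (fderiv ℝ ψ) y a b) (fderiv ℝ ψ y c)
        + h₁ (ψ y) (fderiv ℝ ψ y b) (fderiv ℝ (fderiv ℝ ψ) y a c) := by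
    intro a b c
    have hd₀ := hm₀.diffAt hy
    have e1 : fderiv ℝ (fun z => h₀ z b c) y a = fderiv ℝ h₀ y a b c := by
      rw [fderiv_clm_apply_const (hd₀.clm_apply (differentiableAt_const b)),
        fderiv_clm_apply_const hd₀]
    have e2 : (fun z => h₀ z b c) =ᶠ[𝓝 y]
        fun z => h₁ (ψ z) (fderiv ℝ ψ z b) (fderiv ℝ ψ z c) := by
      filter_upwards [heq] with z hz using hz b c
    rw [← e1, e2.fderiv_eq]
    have h1 : HasFDerivAt (fun z => h₁ (ψ z)) ((fderiv ℝ h₁ (ψ y)).comp (fderiv ℝ ψ y)) y :=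
      (hm₁.diffAt hψy).hasFDerivAt.comp y hψ1.hasFDerivAt
    have h2 := (h1.clm_apply (hψ2.hasFDerivAt.clm_apply (hasFDerivAt_const b y))).clm_apply
      (hψ2.hasFDerivAt.clm_apply (hasFDerivAt_const c y))
    rw [h2.fderiv]
    simp
    ring
  apply hm₁.eq_of_forall hψy
  intro c'
  obtain ⟨c, rfl⟩ := hsurj c'
  rw [← heq.self_of_nhds, hm₀.apply_chris hy, map_add, add_apply, hm₁.apply_chris hψy,
    key, key, key, (hψ.isSymmSndFDerivAt (by simp)).eq b a,
    (hψ.isSymmSndFDerivAt (by simp)).eq c a, (hψ.isSymmSndFDerivAt (by simp)).eq c b,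
    hm₁.symm _ hψy (fderiv ℝ ψ y b), hm₁.symm _ hψy (fderiv ℝ ψ y a)]
  ring

end ChangeOfCoordinates

section Trace

variable {m : ℕ} {F : Type*} [NormedAddCommGroup F] [NormedSpace ℝ F]
  {g : EuclideanSpace ℝ (Fin m) → EuclideanSpace ℝ (Fin m) →L[ℝ] EuclideanSpace ℝ (Fin m) →L[ℝ] ℝ}
  {Ω : Set (EuclideanSpace ℝ (Fin m))}

/-- The vectors dual to the standard basis with respect to the metric `g`. -/
def dualVec (g : EuclideanSpace ℝ (Fin m) → EuclideanSpace ℝ (Fin m) →L[ℝ]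
      EuclideanSpace ℝ (Fin m) →L[ℝ] ℝ) (y : EuclideanSpace ℝ (Fin m)) (j : Fin m) :
    EuclideanSpace ℝ (Fin m) :=
  sharp g y (EuclideanSpace.proj j)

/-- The trace of a bilinear map with respect to the metric `g`. -/
def mtrace (g : EuclideanSpace ℝ (Fin m) → EuclideanSpace ℝ (Fin m) →L[ℝ]
      EuclideanSpace ℝ (Fin m) →L[ℝ] ℝ) (y : EuclideanSpace ℝ (Fin m))
    (B : EuclideanSpace ℝ (Fin m) →L[ℝ] EuclideanSpace ℝ (Fin m) →L[ℝ] F) : F :=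
  ∑ j, B (EuclideanSpace.single j 1) (dualVec g y j)

lemma sum_proj_smul_single (v : EuclideanSpace ℝ (Fin m)) :
    ∑ j, v j • EuclideanSpace.single j (1 : ℝ) = v := by
  simpa using (EuclideanSpace.basisFun (Fin m) ℝ).sum_repr v

/-- The trace can be computed in any orthonormal basis. -/
lemma IsMetricOn.mtrace_eq_sum (hg : IsMetricOn g Ω) {y : EuclideanSpace ℝ (Fin m)} (hy : y ∈ Ω)
    {ι : Type*} [Fintype ι] (b : Module.Basis ι ℝ (EuclideanSpace ℝ (Fin m)))
    (hb : ∀ i, g y (b i) (b i) = 1) (hb' : ∀ i k, i ≠ k → g y (b i) (b k) = 0)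
    (B : EuclideanSpace ℝ (Fin m) →L[ℝ] EuclideanSpace ℝ (Fin m) →L[ℝ] F) :
    mtrace g y B = ∑ i, B (b i) (b i) := by
  classical
  -- Lowered by `g`, both sides become the covector `proj j`; by orthonormality this is checked on
  -- the vectors `b k`.
  have h1 : ∀ j, dualVec g y j = ∑ i, (b i) j • b i := by
    intro j
    rw [dualVec, ← hg.sharp_apply hy (∑ i, (b i) j • b i)]
    congr 1
    ext1 v
    have : ((EuclideanSpace.proj j : EuclideanSpace ℝ (Fin m) →L[ℝ] ℝ)).toLinearMap
        = (g y (∑ i, (b i) j • b i)).toLinearMap := by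
      refine b.ext fun k => ?_
      simp only [ContinuousLinearMap.coe_coe, map_sum, map_smul, sum_apply,
        FunLike.coe_smul, Pi.smul_apply, smul_eq_mul]
      rw [Finset.sum_eq_single k]
      · simp [hb]
      · intro i _ hik; simp [hb' i k hik]
      · simp
    exact congrArg (fun L => L v) this
  simp only [mtrace, h1, map_sum, map_smul]
  rw [Finset.sum_comm]
  refine Finset.sum_congr rfl fun i _ => ?_
  have h2 : B (b i) = ∑ j, (b i) j • B (EuclideanSpace.single j 1) := by
    conv_lhs => rw [← sum_proj_smul_single (b i)]
    simp [map_sum, map_smul]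
  rw [h2]
  simp [sum_apply]

/-- The trace contracts with the inverse matrix `gⁱʲ`, which is symmetric by `sharp_symm`. -/
lemma IsMetricOn.mtrace_flip (hg : IsMetricOn g Ω) {y : EuclideanSpace ℝ (Fin m)} (hy : y ∈ Ω)
    (B : EuclideanSpace ℝ (Fin m) →L[ℝ] EuclideanSpace ℝ (Fin m) →L[ℝ] F) :
    mtrace g y B.flip = mtrace g y B := by
  have h1 : ∀ j, dualVec g y j = ∑ i, (dualVec g y j) i • EuclideanSpace.single i (1 : ℝ) :=
    fun j => (sum_proj_smul_single _).symm
  have h2 : ∀ i j, (dualVec g y j) i = (dualVec g y i) j := fun i j =>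
    hg.sharp_symm hy (EuclideanSpace.proj i) (EuclideanSpace.proj j)
  simp only [mtrace, ContinuousLinearMap.flip_apply]
  have h3 : ∀ j, B (dualVec g y j) (EuclideanSpace.single j 1)
      = ∑ i, (dualVec g y i) j • B (EuclideanSpace.single i 1) (EuclideanSpace.single j 1) := by
    intro j
    rw [h1 j]
    simp [map_sum, map_smul, sum_apply, h2]
  have h4 : ∀ j, B (EuclideanSpace.single j 1) (dualVec g y j)
      = ∑ i, (dualVec g y j) i • B (EuclideanSpace.single j 1) (EuclideanSpace.single i 1) := by
    intro j
    conv_lhs => rw [h1 j]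
    simp [map_sum, map_smul]
  simp only [h3, h4]
  rw [Finset.sum_comm]

lemma IsMetricOn.smooth_dualVec (hg : IsMetricOn g Ω) (j : Fin m) :
    ContDiffOn ℝ ∞ (fun y => dualVec g y j) Ω :=
  hg.smooth_sharp.clm_apply contDiffOn_const

lemma IsMetricOn.smooth_mtrace (hg : IsMetricOn g Ω)
    {U : Set (EuclideanSpace ℝ (Fin m))} (hU : U ⊆ Ω)
    {B : EuclideanSpace ℝ (Fin m) → EuclideanSpace ℝ (Fin m) →L[ℝ] EuclideanSpace ℝ (Fin m) →L[ℝ] F}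
    (hB : ContDiffOn ℝ ∞ B U) : ContDiffOn ℝ ∞ (fun y => mtrace g y (B y)) U := by
  unfold mtrace
  exact ContDiffOn.sum fun j _ =>
    (hB.clm_apply contDiffOn_const).clm_apply ((hg.smooth_dualVec j).mono hU)

end Trace

/-! ### Algebraic curvature tensors and constant sectional curvature. -/

section Curvature

/-- A tensor with the symmetries of a curvature tensor vanishes if its sectional curvatures do. -/
lemma curvatureLike_eq_zero {F : Type*} [Add F] {S : F → F → F → F → ℝ}
    (add₁ : ∀ a a' b c d, S (a + a') b c d = S a b c d + S a' b c d)
    (add₂ : ∀ a b b' c d, S a (b + b') c d = S a b c d + S a b' c d)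
    (add₃ : ∀ a b c c' d, S a b (c + c') d = S a b c d + S a b c' d)
    (add₄ : ∀ a b c d d', S a b c (d + d') = S a b c d + S a b c d')
    (anti₁ : ∀ a b c d, S a b c d = -S b a c d) (anti₂ : ∀ a b c d, S a b c d = -S a b d c)
    (bianchi : ∀ a b c d, S a b c d + S b c a d + S c a b d = 0)
    (sec : ∀ u v, S u v v u = 0) (a b c d : F) : S a b c d = 0 := by
  -- Pair symmetry: the four Bianchi identities with cyclically permuted arguments are combined and
  -- the skew symmetries applied.
  have pair : ∀ a b c d, S a b c d = S c d a b := by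
    intro a b c d
    linarith [bianchi a b c d, bianchi b c d a, bianchi c d a b, bianchi d a b c,
      anti₁ a b c d, anti₁ b c a d, anti₁ c a b d, anti₁ b c d a, anti₁ c d b a, anti₁ d b c a,
      anti₁ c d a b, anti₁ d a c b, anti₁ a c d b, anti₁ d a b c, anti₁ a b d c, anti₁ b d a c,
      anti₂ a b c d, anti₂ b c a d, anti₂ c a b d, anti₂ b c d a, anti₂ c d b a, anti₂ d b c a,
      anti₂ c d a b, anti₂ d a c b, anti₂ a c d b, anti₂ d a b c, anti₂ a b d c, anti₂ b d a c,
      anti₂ d b a c, anti₂ a c b d]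
  -- Polarization in `u`: the two mixed terms agree by pair symmetry, so each of them vanishes.
  have pol₁ : ∀ u v x, S u v v x = 0 := by
    intro u v x
    have h1 := sec (u + x) v
    rw [add₁, add₄, add₄, sec, sec] at h1
    have h2 := pair x v v u
    have h3 := anti₁ v u x v
    have h4 := anti₂ u v x v
    linarith
  -- Polarization in `v` makes the tensor skew in its two middle arguments.
  have pol₂ : ∀ u v w x, S u v w x = -S u w v x := by
    intro u v w x
    have h1 := pol₁ u (v + w) x
    rw [add₂, add₃, add₃, pol₁, pol₁] at h1
    linarith
  -- The tensor is now skew in its first three arguments, so the Bianchi sum is three times one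
  -- term.
  linarith [bianchi a b c d, pol₂ a b c d, pol₂ b c a d, anti₁ b a c d, anti₁ a c b d,
    anti₁ a b c d, anti₁ c a b d]

variable {F : Type*} [NormedAddCommGroup F] [NormedSpace ℝ F] [FiniteDimensional ℝ F]
  {h : F → F →L[ℝ] F →L[ℝ] ℝ} {Ω : Set F}

lemma IsMetricOn.diffAt_chris (hm : IsMetricOn h Ω) {y : F} (hy : y ∈ Ω) :
    DifferentiableAt ℝ (chris h) y :=
  (hm.smooth_chris.contDiffAt (hm.isOpen.mem_nhds hy)).differentiableAt (by simp)

lemma IsMetricOn.fderiv_chris_symm (hm : IsMetricOn h Ω) {y : F} (hy : y ∈ Ω) (a b c : F) :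
    fderiv ℝ (chris h) y a b c = fderiv ℝ (chris h) y a c b := by
  have hd := hm.diffAt_chris hy
  rw [← fderiv_clm_apply_const hd, ← fderiv_clm_apply_const hd,
    ← fderiv_clm_apply_const (hd.clm_apply (differentiableAt_const b)),
    ← fderiv_clm_apply_const (hd.clm_apply (differentiableAt_const c))]
  congr 1
  apply Filter.EventuallyEq.fderiv_eq
  filter_upwards [hm.isOpen.mem_nhds hy] with z hz using hm.chris_symm hz b c

/-- First Bianchi identity: with symmetric Christoffel symbols, the derivative terms and the
quadratic terms cancel in pairs. -/
lemma IsMetricOn.riem_bianchi (hm : IsMetricOn h Ω) {y : F} (hy : y ∈ Ω) (a b c : F) :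
    riem (chris h) y a b c + riem (chris h) y b c a + riem (chris h) y c a b = 0 := by
  simp only [riem]
  rw [hm.fderiv_chris_symm hy a b c, hm.fderiv_chris_symm hy b a c, hm.fderiv_chris_symm hy c a b,
    hm.chris_symm hy b c, hm.chris_symm hy a c, hm.chris_symm hy b a]
  abel

/-- The function `y ↦ h y w z` has a symmetric second derivative. Expanding it by metric
compatibility along the identity map with constant fields, the commutator consists of exactly the
two curvature terms. -/
lemma IsMetricOn.riem_skew (hm : IsMetricOn h Ω) {y : F} (hy : y ∈ Ω) (a b w z : F) :
    h y (riem (chris h) y a b w) z = -h y (riem (chris h) y a b z) w := by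
  have hid : ∀ x : F, fderiv ℝ (fun v : F => v) x = ContinuousLinearMap.id ℝ F := fun x => fderiv_fun_id
  have hc : ∀ (v u : F), ContDiffAt ℝ 2 (fun _ : F => v) u := fun _ _ => contDiffAt_const
  have hI : ContDiffAt ℝ 2 (fun v : F => v) y := contDiffAt_id
  have hdc : ∀ v b : F, DifferentiableAt ℝ (fun x => cov (chris h) (fun v : F => v) (fun _ => v) x b) y := by
    intro v b
    have : (fun x => cov (chris h) (fun v : F => v) (fun _ => v) x b) = fun x => chris h x b v := by
      funext x
      simp [cov_apply, hid]
    rw [this]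
    exact ((hm.diffAt_chris hy).clm_apply (differentiableAt_const b)).clm_apply
      (differentiableAt_const v)
  have h2 : ∀ a b, fderiv ℝ (fun x => fderiv ℝ (fun u => h u w z) x b) y a
      = h y (cov (chris h) (fun v => v) (fun x => cov (chris h) (fun v => v) (fun _ => w) x b) y a) z
      + h y (cov (chris h) (fun v => v) (fun _ => w) y b) (cov (chris h) (fun v => v) (fun _ => z) y a)
      + (h y (cov (chris h) (fun v => v) (fun _ => w) y a) (cov (chris h) (fun v => v) (fun _ => z) y b)
      + h y w (cov (chris h) (fun v => v) (fun x => cov (chris h) (fun v => v) (fun _ => z) x b) y a)) := by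
    intro a b
    have e : (fun x => fderiv ℝ (fun u => h u w z) x b) =ᶠ[𝓝 y]
      (fun x => h x (cov (chris h) (fun v => v) (fun _ => w) x b) z)
        + (fun x => h x w (cov (chris h) (fun v => v) (fun _ => z) x b)) := by
      filter_upwards [hm.isOpen.mem_nhds hy] with x hx
      exact hm.fderiv_inner (f := fun v => v) (V := fun _ => w) (W := fun _ => z) hx
        differentiableAt_fun_id (differentiableAt_const _) (differentiableAt_const _) b
    have dd : ∀ (p q : F → F), DifferentiableAt ℝ p y → DifferentiableAt ℝ q y →
        DifferentiableAt ℝ (fun x => h x (p x) (q x)) y := fun p q hp hq =>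
      ((hm.diffAt hy).clm_apply hp).clm_apply hq
    rw [e.fderiv_eq, fderiv_add (dd _ _ (hdc w b) (differentiableAt_const z))
      (dd _ _ (differentiableAt_const w) (hdc z b)), add_apply]
    rw [hm.fderiv_inner (f := fun v => v) (V := fun x => cov (chris h) (fun v => v) (fun _ => w) x b)
        (W := fun _ => z) hy differentiableAt_fun_id (hdc w b) (differentiableAt_const z),
      hm.fderiv_inner (f := fun v => v) (W := fun x => cov (chris h) (fun v => v) (fun _ => z) x b)
        (V := fun _ => w) hy differentiableAt_fun_id (differentiableAt_const w) (hdc z b)]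
  have hk : ContDiffAt ℝ 2 (fun u => h u w z) y :=
    (((hm.smooth.contDiffAt (hm.isOpen.mem_nhds hy)).of_le (by norm_cast)).clm_apply
      contDiffAt_const).clm_apply contDiffAt_const
  have hk2 : DifferentiableAt ℝ (fderiv ℝ (fun u => h u w z)) y :=
    (hk.fderiv_right (m := 1) (by norm_num)).differentiableAt (by simp)
  have h3 := (hk.isSymmSndFDerivAt (by simp)).eq a b
  rw [← fderiv_clm_apply_const hk2, ← fderiv_clm_apply_const hk2, h2, h2] at h3
  have c1 := cov_comm (Γ := chris h) (hm.diffAt_chris hy) hI (hc w y) a b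
  have c2 := cov_comm (Γ := chris h) (hm.diffAt_chris hy) hI (hc z y) a b
  simp only [hid, ContinuousLinearMap.coe_id', id] at c1 c2
  rw [c1, c2] at h3
  simp only [map_add, add_apply] at h3
  rw [hm.symm y hy _ w]
  linarith

/-- Constant sectional curvature determines the curvature tensor. -/
lemma IsMetricOn.riem_of_sectional (hm : IsMetricOn h Ω) {y : F} (hy : y ∈ Ω) {c : ℝ}
    (hc : ∀ u v, h y (riem (chris h) y u v v) u = c * (h y u u * h y v v - h y u v ^ 2))
    (a b w : F) : riem (chris h) y a b w = c • (h y b w • a - h y a w • b) := by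
  apply hm.eq_of_forall hy
  intro d
  -- The difference between the curvature and its constant curvature model has all the algebraic
  -- symmetries and zero sectional curvature.
  have := curvatureLike_eq_zero (S := fun a b w d => h y (riem (chris h) y a b w) d
    - c * (h y b w * h y a d - h y a w * h y b d)) ?_ ?_ ?_ ?_ ?_ ?_ ?_ ?_ a b w d
  · simp only [map_smul, map_sub, FunLike.coe_smul, Pi.smul_apply, smul_eq_mul, sub_apply]
    linarith
  · intro a a' b c d
    simp only [riem, map_add, add_apply, map_sub, sub_apply]; ring
  · intro a b b' c d
    simp only [riem, map_add, add_apply, map_sub, sub_apply]; ring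
  · intro a b c c' d
    simp only [riem, map_add, add_apply, map_sub, sub_apply]; ring
  · intro a b c d d'
    simp only [map_add]; ring
  · intro a b c d
    simp only [riem, map_add, add_apply, map_sub, sub_apply]; ring
  · intro a b c d
    rw [hm.riem_skew hy]; ring
  · intro a b c' d
    have h1 := congrArg (fun v => h y v d) (hm.riem_bianchi hy a b c')
    simp only [map_add, add_apply, map_zero, zero_apply] at h1
    rw [hm.symm y hy c' a, hm.symm y hy b a, hm.symm y hy c' b]
    linarith
  · intro u v
    rw [hc, hm.symm y hy v u]; ring

end Curvature

/-! ### The divergence theorem in coordinates -/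

section Divergence

variable {m : ℕ}

lemma contDiff_of_tsupport_subset {E G : Type*} [NormedAddCommGroup E] [NormedSpace ℝ E]
    [NormedAddCommGroup G] [NormedSpace ℝ G] {f : E → G} {U : Set E} {k : ℕ∞ω} (hU : IsOpen U)
    (hf : ContDiffOn ℝ k f U) (hs : tsupport f ⊆ U) : ContDiff ℝ k f := by
  rw [contDiff_iff_contDiffAt]
  intro x
  by_cases hx : x ∈ tsupport f
  · exact hf.contDiffAt (hU.mem_nhds (hs hx))
  · have : f =ᶠ[𝓝 x] fun _ => 0 := notMem_tsupport_iff_eventuallyEq.mp hx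
    exact contDiffAt_const.congr_of_eventuallyEq this

/-- Jacobi's formula: with `B` inverse to `A`, the determinant factors as `det A · det (1 + t B C)`,
whose linear coefficient is a trace. -/
lemma hasDerivAt_det_add_smul (A B C : Matrix (Fin m) (Fin m) ℝ) (hAB : A * B = 1) :
    HasDerivAt (fun t : ℝ => (A + t • C).det) (A.det * (B * C).trace) 0 := by
  have h1 : ∀ t : ℝ, (A + t • C).det = A.det * (1 + t • (B * C)).det := by
    intro t
    rw [← Matrix.det_mul, mul_add, mul_one, Matrix.mul_smul, ← mul_assoc, hAB, one_mul]
  have h1' : (fun t : ℝ => (A + t • C).det) = fun t : ℝ => A.det * (1 + (B * C).trace * t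
      + (Polynomial.eval t (Matrix.det (1 + (Polynomial.X : Polynomial ℝ) •
        (B * C).map Polynomial.C)).divX.divX) * t ^ 2) := by
    funext t
    rw [h1, Matrix.det_one_add_smul]
  rw [h1']
  have h2 : HasDerivAt (fun t : ℝ => 1 + (B * C).trace * t
      + (Polynomial.eval t (Matrix.det (1 + (Polynomial.X : Polynomial ℝ) •
        (B * C).map Polynomial.C)).divX.divX) * t ^ 2) ((B * C).trace) 0 := by
    have ha : HasDerivAt (fun t : ℝ => 1 + (B * C).trace * t) ((B * C).trace) 0 := by
      simpa using ((hasDerivAt_id (0 : ℝ)).const_mul (B * C).trace).const_add 1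
    have hb := ((Matrix.det (1 + (Polynomial.X : Polynomial ℝ) •
        (B * C).map Polynomial.C)).divX.divX.hasDerivAt 0).mul (hasDerivAt_pow 2 (0 : ℝ))
    exact (ha.add hb).congr_deriv (by simp)
  exact h2.const_mul _

variable {g : EuclideanSpace ℝ (Fin m) → EuclideanSpace ℝ (Fin m) →L[ℝ]
  EuclideanSpace ℝ (Fin m) →L[ℝ] ℝ} {Ω : Set (EuclideanSpace ℝ (Fin m))}

/-- The Gram matrix of the standard basis. -/
def gram (g : EuclideanSpace ℝ (Fin m) → EuclideanSpace ℝ (Fin m) →L[ℝ]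
      EuclideanSpace ℝ (Fin m) →L[ℝ] ℝ) (y : EuclideanSpace ℝ (Fin m)) : Matrix (Fin m) (Fin m) ℝ :=
  Matrix.of fun i j => g y (EuclideanSpace.single i 1) (EuclideanSpace.single j 1)

/-- The density of the Riemannian volume. -/
def density (g : EuclideanSpace ℝ (Fin m) → EuclideanSpace ℝ (Fin m) →L[ℝ]
      EuclideanSpace ℝ (Fin m) →L[ℝ] ℝ) (y : EuclideanSpace ℝ (Fin m)) : ℝ :=
  √(gram g y).det

lemma IsMetricOn.gram_det_pos (hg : IsMetricOn g Ω) {y : EuclideanSpace ℝ (Fin m)} (hy : y ∈ Ω) :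
    0 < (gram g y).det := by
  apply Matrix.PosDef.det_pos
  apply Matrix.PosDef.of_dotProduct_mulVec_pos
  · ext i j
    simp [gram, hg.symm y hy (EuclideanSpace.single j 1)]
  · intro x hx
    have h1 : star x ⬝ᵥ ((gram g y).mulVec x) = g y (WithLp.toLp 2 x) (WithLp.toLp 2 x) := by
      have e := sum_proj_smul_single (WithLp.toLp 2 x)
      conv_rhs => rw [← e]
      simp only [map_sum, map_smul, sum_apply, FunLike.coe_smul, Pi.smul_apply,
        smul_eq_mul, dotProduct, Matrix.mulVec, gram, Matrix.of_apply, Pi.star_apply,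
        star_trivial, Finset.mul_sum]
      rw [Finset.sum_comm]
      refine Finset.sum_congr rfl fun i _ => Finset.sum_congr rfl fun j _ => ?_
      ring
    rw [h1]
    apply hg.pos y hy
    intro h0
    apply hx
    simpa using congrArg WithLp.ofLp h0

lemma IsMetricOn.density_pos (hg : IsMetricOn g Ω) {y : EuclideanSpace ℝ (Fin m)} (hy : y ∈ Ω) :
    0 < density g y := Real.sqrt_pos.2 (hg.gram_det_pos hy)

lemma IsMetricOn.smooth_gram_det (hg : IsMetricOn g Ω) :
    ContDiffOn ℝ ∞ (fun y => (gram g y).det) Ω := by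
  simp only [Matrix.det_apply, gram, Matrix.of_apply]
  refine ContDiffOn.sum fun σ _ => ?_
  refine ContDiffOn.const_smul _ (contDiffOn_prod fun i _ => ?_)
  exact (hg.smooth.clm_apply contDiffOn_const).clm_apply contDiffOn_const

lemma IsMetricOn.smooth_density (hg : IsMetricOn g Ω) : ContDiffOn ℝ ∞ (density g) Ω :=
  hg.smooth_gram_det.sqrt fun _ hy => (hg.gram_det_pos hy).ne'

/-- The matrix inverse to the Gram matrix has the dual vectors as columns, so the trace in Jacobi's
formula becomes a metric trace. -/
lemma IsMetricOn.fderiv_gram_det (hg : IsMetricOn g Ω) {y : EuclideanSpace ℝ (Fin m)} (hy : y ∈ Ω)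
    (a : EuclideanSpace ℝ (Fin m)) :
    fderiv ℝ (fun y => (gram g y).det) y a = (gram g y).det * mtrace g y (fderiv ℝ g y a) := by
  have hsm : DifferentiableAt ℝ (fun A : Fin m → Fin m → ℝ => Matrix.det (Matrix.of A)) (gram g y) := by
    simp only [Matrix.det_apply, Matrix.of_apply]
    fun_prop
  let C : Matrix (Fin m) (Fin m) ℝ := Matrix.of fun i j =>
    fderiv ℝ g y a (EuclideanSpace.single i 1) (EuclideanSpace.single j 1)
  let B : Matrix (Fin m) (Fin m) ℝ := Matrix.of fun i j => dualVec g y j i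
  have hAB : gram g y * B = 1 := by
    ext i k
    have h1 : g y (EuclideanSpace.single i 1) (dualVec g y k) = (1 : Matrix (Fin m) (Fin m) ℝ) i k := by
      rw [hg.symm y hy, dualVec, hg.apply_sharp hy]
      simp [Matrix.one_apply, eq_comm]
    rw [← h1, ← sum_proj_smul_single (dualVec g y k)]
    simp only [Matrix.mul_apply, gram, B, Matrix.of_apply, map_sum, map_smul, smul_eq_mul]
    exact Finset.sum_congr rfl fun j _ => mul_comm _ _
  have htr : (B * C).trace = mtrace g y (fderiv ℝ g y a) := by
    simp only [Matrix.trace, Matrix.diag, Matrix.mul_apply, mtrace, B, C, Matrix.of_apply]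
    rw [Finset.sum_comm]
    refine Finset.sum_congr rfl fun j _ => ?_
    conv_rhs => rw [← sum_proj_smul_single (dualVec g y j)]
    simp only [map_sum, map_smul, smul_eq_mul]
  have hgram : HasFDerivAt (fun z => (fun i j => g z (EuclideanSpace.single i 1)
      (EuclideanSpace.single j 1) : Fin m → Fin m → ℝ))
      (ContinuousLinearMap.pi fun i => ContinuousLinearMap.pi fun j =>
        ((ContinuousLinearMap.apply ℝ ℝ (EuclideanSpace.single j 1)).comp
          (ContinuousLinearMap.apply ℝ _ (EuclideanSpace.single i 1))).comp (fderiv ℝ g y)) y := by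
    rw [hasFDerivAt_pi]
    intro i
    rw [hasFDerivAt_pi]
    intro j
    exact ((ContinuousLinearMap.apply ℝ ℝ (EuclideanSpace.single j 1)).comp
          (ContinuousLinearMap.apply ℝ _ (EuclideanSpace.single i 1))).hasFDerivAt.comp y
          (hg.diffAt hy).hasFDerivAt
  have h1 : HasFDerivAt (fun y => (gram g y).det) _ y :=
    HasFDerivAt.comp y (g := fun A : Fin m → Fin m → ℝ => Matrix.det (Matrix.of A))
      hsm.hasFDerivAt hgram
  rw [h1.fderiv, ← htr]
  -- The differential of `det` is needed only in the direction `C`, where it is read off from a line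
  -- through the Gram matrix.
  have h3 := hasDerivAt_det_add_smul (gram g y) B C hAB
  let A' : Fin m → Fin m → ℝ := fun i j => gram g y i j
  let C' : Fin m → Fin m → ℝ := fun i j => C i j
  have h4 : HasDerivAt (fun t : ℝ => A' + t • C') C' 0 :=
    (((hasDerivAt_id (0 : ℝ)).smul_const C').const_add A').congr_deriv (one_smul ℝ C')
  have h5 : HasDerivAt (fun t : ℝ => Matrix.det (Matrix.of (A' + t • C'))) _ 0 :=
    HasFDerivAt.comp_hasDerivAt (0 : ℝ)
      (l := fun A : Fin m → Fin m → ℝ => Matrix.det (Matrix.of A))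
      (l' := fderiv ℝ (fun A : Fin m → Fin m → ℝ => Matrix.det (Matrix.of A)) A')
      (by rw [zero_smul, add_zero]; exact hsm.hasFDerivAt) h4
  exact h5.unique h3

lemma IsMetricOn.fderiv_density (hg : IsMetricOn g Ω) {y : EuclideanSpace ℝ (Fin m)} (hy : y ∈ Ω)
    (a : EuclideanSpace ℝ (Fin m)) :
    fderiv ℝ (density g) y a = density g y * (1 / 2 * mtrace g y (fderiv ℝ g y a)) := by
  have hd : DifferentiableAt ℝ (fun y => (gram g y).det) y :=
    (hg.smooth_gram_det.contDiffAt (hg.isOpen.mem_nhds hy)).differentiableAt (by simp)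
  have hp := hg.gram_det_pos hy
  have h1 : HasFDerivAt (density g) _ y := hd.hasFDerivAt.sqrt hp.ne'
  rw [h1.fderiv]
  simp only [FunLike.coe_smul, Pi.smul_apply, smul_eq_mul, hg.fderiv_gram_det hy, density]
  have := Real.sq_sqrt hp.le
  have h0 : √(gram g y).det ≠ 0 := (Real.sqrt_pos.2 hp).ne'
  field_simp
  rw [this]

/-- Derivative of an inverse: the constant function `g z (sharp g z θ) = θ` is differentiated. -/
lemma IsMetricOn.fderiv_sharp (hg : IsMetricOn g Ω) {y : EuclideanSpace ℝ (Fin m)} (hy : y ∈ Ω)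
    (θ : EuclideanSpace ℝ (Fin m) →L[ℝ] ℝ) (a : EuclideanSpace ℝ (Fin m)) :
    fderiv ℝ (fun z => sharp g z θ) y a = -sharp g y (fderiv ℝ g y a (sharp g y θ)) := by
  have hd : DifferentiableAt ℝ (fun z => sharp g z θ) y :=
    ((hg.smooth_sharp.contDiffAt (hg.isOpen.mem_nhds hy)).differentiableAt (by simp)).clm_apply
      (differentiableAt_const θ)
  have h1 := (hg.diffAt hy).hasFDerivAt.clm_apply hd.hasFDerivAt
  have h2 : (fun z => g z (sharp g z θ)) =ᶠ[𝓝 y] fun _ => θ := by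
    filter_upwards [hg.isOpen.mem_nhds hy] with z hz using hg.apply_sharp hz θ
  have h3 := (h1.congr_of_eventuallyEq h2.symm).unique (hasFDerivAt_const θ y)
  have h4 := congrArg (fun L => L a) h3
  simp only [add_apply, ContinuousLinearMap.comp_apply, ContinuousLinearMap.flip_apply,
    zero_apply] at h4
  rw [← map_neg, ← eq_neg_of_add_eq_zero_left h4, hg.sharp_apply hy]

/-- The divergence of the vector field dual to a one-form. -/
lemma IsMetricOn.sum_fderiv_density (hg : IsMetricOn g Ω) {y : EuclideanSpace ℝ (Fin m)}
    (hy : y ∈ Ω) {θ : EuclideanSpace ℝ (Fin m) → EuclideanSpace ℝ (Fin m) →L[ℝ] ℝ}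
    (hθ : DifferentiableAt ℝ θ y) :
    ∑ j, fderiv ℝ (fun z => density g z * θ z (dualVec g z j)) y (EuclideanSpace.single j 1)
      = density g y * mtrace g y (covOne (chris g) θ y) := by
  have hμ : DifferentiableAt ℝ (density g) y :=
    (hg.smooth_density.contDiffAt (hg.isOpen.mem_nhds hy)).differentiableAt (by simp)
  have hdual : ∀ j, DifferentiableAt ℝ (fun z => dualVec g z j) y := fun j =>
    ((hg.smooth_dualVec j).contDiffAt (hg.isOpen.mem_nhds hy)).differentiableAt (by simp)
  set T := sharp g y (θ y) with hT
  have hθT : ∀ ϖ, θ y (sharp g y ϖ) = ϖ T := fun ϖ => hg.sharp_symm hy (θ y) ϖ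
  have h1 : ∀ j, fderiv ℝ (fun z => density g z * θ z (dualVec g z j)) y (EuclideanSpace.single j 1)
      = density g y * (fderiv ℝ θ y (EuclideanSpace.single j 1) (dualVec g y j)
        - fderiv ℝ g y (EuclideanSpace.single j 1) (dualVec g y j) T
        + (1 / 2 * mtrace g y (fderiv ℝ g y (EuclideanSpace.single j 1))) * T j) := by
    intro j
    have h0 : HasFDerivAt (fun z => density g z * θ z (dualVec g z j)) _ y :=
      hμ.hasFDerivAt.mul (hθ.hasFDerivAt.clm_apply (hdual j).hasFDerivAt)
    rw [h0.fderiv]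
    simp only [add_apply, FunLike.coe_smul, Pi.smul_apply, smul_eq_mul,
      ContinuousLinearMap.comp_apply, ContinuousLinearMap.flip_apply]
    rw [hg.fderiv_density hy]
    have e1 : fderiv ℝ (fun z => dualVec g z j) y (EuclideanSpace.single j 1)
        = -sharp g y (fderiv ℝ g y (EuclideanSpace.single j 1) (dualVec g y j)) :=
      hg.fderiv_sharp hy _ _
    have e2 : θ y (dualVec g y j) = T j := hθT _
    rw [e1, e2, map_neg, hθT]
    ring
  simp only [h1, ← Finset.mul_sum]
  congr 1
  rw [Finset.sum_add_distrib, Finset.sum_sub_distrib]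
  have e3 : ∑ j, (1 / 2 * mtrace g y (fderiv ℝ g y (EuclideanSpace.single j 1))) * T j
      = 1 / 2 * mtrace g y (fderiv ℝ g y T) := by
    have : fderiv ℝ g y T = ∑ j, T j • fderiv ℝ g y (EuclideanSpace.single j 1) := by
      conv_lhs => rw [← sum_proj_smul_single T]
      simp only [map_sum, map_smul]
    rw [this]
    simp only [mtrace, sum_apply, FunLike.coe_smul, Pi.smul_apply, smul_eq_mul,
      Finset.mul_sum, Finset.sum_mul]
    rw [Finset.sum_comm]
    refine Finset.sum_congr rfl fun i _ => Finset.sum_congr rfl fun j _ => ?_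
    ring
  have e4 : ∑ j, fderiv ℝ g y (EuclideanSpace.single j 1) (dualVec g y j) T
      = ∑ j, fderiv ℝ g y (dualVec g y j) (EuclideanSpace.single j 1) T := by
    let BB : EuclideanSpace ℝ (Fin m) →L[ℝ] EuclideanSpace ℝ (Fin m) →L[ℝ] ℝ :=
      (ContinuousLinearMap.compL ℝ (EuclideanSpace ℝ (Fin m)) (EuclideanSpace ℝ (Fin m) →L[ℝ] ℝ) ℝ
        (ContinuousLinearMap.apply ℝ ℝ T)).comp (fderiv ℝ g y)
    exact (hg.mtrace_flip hy BB).symm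
  -- The contracted Christoffel term `θ(Γ(eⱼ, eʲ))` is `∑ⱼ ∂ⱼg(eʲ, T) - ½ tr ∂_T g`. Its two parts
  -- come from differentiating the inverse metric and the volume density.
  rw [e3]
  simp only [mtrace, covOne_apply, chris_apply, hθT, koszulL_apply, Finset.sum_sub_distrib,
    ← Finset.mul_sum, Finset.sum_add_distrib, e4]
  ring

/-- Integration by parts against a Lipschitz function. -/
lemma IsMetricOn.integral_lipschitz_mul_div (hg : IsMetricOn g Ω)
    {θ : EuclideanSpace ℝ (Fin m) → EuclideanSpace ℝ (Fin m) →L[ℝ] ℝ}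
    (hθ : ContDiffOn ℝ ∞ θ Ω) (hc : HasCompactSupport θ) (hs : tsupport θ ⊆ Ω)
    {C : NNReal} {ζ : EuclideanSpace ℝ (Fin m) → ℝ} (hζ : LipschitzWith C ζ) :
    ∫ y, ζ y * (density g y * mtrace g y (covOne (chris g) θ y))
      = -∫ y, density g y * fderiv ℝ ζ y (sharp g y (θ y)) := by
  -- These are the components of the vector field dual to `θ`, multiplied by the volume density;
  -- their Euclidean divergence is the weighted Riemannian one.
  let k : Fin m → EuclideanSpace ℝ (Fin m) → ℝ := fun j y => density g y * θ y (dualVec g y j)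
  have hsupp : ∀ j, Function.support (k j) ⊆ Function.support θ := by
    intro j y hy h0
    apply hy
    simp [k, h0]
  have hkc : ∀ j, HasCompactSupport (k j) := fun j => hc.mono (hsupp j)
  have hks : ∀ j, ContDiff ℝ ∞ (k j) := fun j =>
    contDiff_of_tsupport_subset hg.isOpen
      (hg.smooth_density.mul (hθ.clm_apply (hg.smooth_dualVec j)))
      ((closure_mono (hsupp j)).trans hs)
  have hA : ∀ y, ζ y * (density g y * mtrace g y (covOne (chris g) θ y))
      = ∑ j, fderiv ℝ (k j) y (EuclideanSpace.single j 1) * ζ y := by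
    intro y
    rw [← Finset.sum_mul, mul_comm]
    congr 1
    by_cases hy : y ∈ Ω
    · exact (hg.sum_fderiv_density hy
        ((hθ.contDiffAt (hg.isOpen.mem_nhds hy)).differentiableAt (by simp))).symm
    · have h0 : θ =ᶠ[𝓝 y] fun _ => 0 :=
        notMem_tsupport_iff_eventuallyEq.mp fun h => hy (hs h)
      have h1 : ∀ j, k j =ᶠ[𝓝 y] fun _ => 0 := fun j => by
        filter_upwards [h0] with z hz
        simp [k, hz]
      have h2 : covOne (chris g) θ y = 0 := by
        ext a b
        rw [covOne_apply, h0.fderiv_eq, h0.self_of_nhds]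
        simp
      have h3 : ∀ j, fderiv ℝ (k j) y = 0 := fun j => by rw [(h1 j).fderiv_eq]; simp
      simp [h2, mtrace, h3]
  have hI : ∀ j, Integrable fun y => fderiv ℝ (k j) y (EuclideanSpace.single j 1) * ζ y := by
    intro j
    have hcf : Continuous fun y => fderiv ℝ (k j) y (EuclideanSpace.single j 1) :=
      ((hks j).continuous_fderiv (by simp)).clm_apply continuous_const
    refine (hcf.mul hζ.continuous).integrable_of_hasCompactSupport ?_
    refine HasCompactSupport.mul_right ?_
    exact ((hkc j).fderiv ℝ).mono fun y hy h0 => hy (by simp [h0])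
  -- Euclidean integration by parts for a Lipschitz function against a smooth compactly supported
  -- one, in each coordinate direction.
  have hL : ∀ j, ∫ y, fderiv ℝ (k j) y (EuclideanSpace.single j 1) * ζ y
      = -∫ y, lineDeriv ℝ ζ y (EuclideanSpace.single j 1) * k j y := by
    intro j
    obtain ⟨D, hD⟩ := ContDiff.lipschitzWith_of_hasCompactSupport (hkc j) (hks j) (by simp)
    rw [hζ.integral_lineDeriv_mul_eq hD (hkc j), ← integral_neg]
    refine integral_congr_ae (Filter.Eventually.of_forall fun y => ?_)
    simp only
    rw [((hks j).differentiable (by simp)).differentiableAt.lineDeriv_eq_fderiv]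
    simp
  have hI' : ∀ j, Integrable fun y => lineDeriv ℝ ζ y (EuclideanSpace.single j 1) * k j y := by
    intro j
    have h1 : Integrable (k j) := (hks j).continuous.integrable_of_hasCompactSupport (hkc j)
    exact h1.bdd_mul (aestronglyMeasurable_lineDeriv hζ.continuous _)
      (Filter.Eventually.of_forall fun _ => norm_lineDeriv_le_of_lipschitz ℝ hζ)
  simp_rw [hA]
  rw [integral_finsetSum _ fun j _ => hI j]
  simp_rw [hL]
  rw [Finset.sum_neg_distrib, ← integral_finsetSum _ fun j _ => hI' j]
  congr 1
  refine integral_congr_ae ?_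
  -- By Rademacher's theorem the directional derivatives of `ζ` assemble almost everywhere into
  -- `fderiv`.
  filter_upwards [hζ.ae_differentiableAt (μ := volume)] with y hy
  simp only [hy.lineDeriv_eq_fderiv, k]
  by_cases hyΩ : y ∈ Ω
  · conv_rhs => rw [← sum_proj_smul_single (sharp g y (θ y))]
    simp only [map_sum, map_smul, smul_eq_mul, Finset.mul_sum]
    refine Finset.sum_congr rfl fun j _ => ?_
    have : θ y (dualVec g y j) = (sharp g y (θ y)) j :=
      hg.sharp_symm hyΩ (θ y) (EuclideanSpace.proj j)
    rw [this]; ring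
  · have h0 : θ y = 0 := image_eq_zero_of_notMem_tsupport fun h => hyΩ (hs h)
    simp [h0]

/-- The divergence theorem for compactly supported one-forms. -/
lemma IsMetricOn.integral_div (hg : IsMetricOn g Ω)
    {θ : EuclideanSpace ℝ (Fin m) → EuclideanSpace ℝ (Fin m) →L[ℝ] ℝ}
    (hθ : ContDiffOn ℝ ∞ θ Ω) (hc : HasCompactSupport θ) (hs : tsupport θ ⊆ Ω) :
    ∫ y, density g y * mtrace g y (covOne (chris g) θ y) = 0 := by
  have := hg.integral_lipschitz_mul_div hθ hc hs (LipschitzWith.const (1 : ℝ))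
  simpa using this

end Divergence

/-! ### Tension field, rough Laplacian and first variation in coordinates -/

/-- The model space of an `m`-dimensional manifold. -/
abbrev Eucl (m : ℕ) : Type := EuclideanSpace ℝ (Fin m)

section Variation

variable {m : ℕ}

variable {F : Type*} [NormedAddCommGroup F] [NormedSpace ℝ F]

lemma IsMetricOn.mono {h : F → F →L[ℝ] F →L[ℝ] ℝ} {Ω Ω' : Set F} (hm : IsMetricOn h Ω)
    (hΩ' : IsOpen Ω') (hs : Ω' ⊆ Ω) : IsMetricOn h Ω' :=
  ⟨hΩ', hm.smooth.mono hs, fun y hy => hm.symm y (hs hy), fun y hy => hm.pos y (hs hy)⟩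

lemma fderiv_slice {G : Type*} [NormedAddCommGroup G] [NormedSpace ℝ G] {X : Type*}
    [NormedAddCommGroup X] [NormedSpace ℝ X] {A : ℝ × X → G} {t : ℝ} {y : X}
    (hA : DifferentiableAt ℝ A (t, y)) (a : X) :
    fderiv ℝ (fun z => A (t, z)) y a = fderiv ℝ A (t, y) (0, a) := by
  have h1 : HasFDerivAt (fun z => A (t, z)) _ y :=
    hA.hasFDerivAt.comp y (hasFDerivAt_prodMk_right t y)
  rw [h1.fderiv]
  simp

lemma hasDerivAt_slice {G : Type*} [NormedAddCommGroup G] [NormedSpace ℝ G] {X : Type*}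
    [NormedAddCommGroup X] [NormedSpace ℝ X] {A : ℝ × X → G} {t : ℝ} {y : X}
    (hA : DifferentiableAt ℝ A (t, y)) :
    HasDerivAt (fun s => A (s, y)) (fderiv ℝ A (t, y) (1, 0)) t := by
  have h1 : HasFDerivAt (fun s => A (s, y)) _ t :=
    hA.hasFDerivAt.comp t (hasFDerivAt_prodMk_left t y)
  simpa using h1.hasDerivAt

lemma cov_slice {X : Type*} [NormedAddCommGroup X] [NormedSpace ℝ X]
    {Γ : F → F →L[ℝ] F →L[ℝ] F} {f V : ℝ × X → F} {t : ℝ} {y : X}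
    (hf : DifferentiableAt ℝ f (t, y)) (hV : DifferentiableAt ℝ V (t, y)) (a : X) :
    cov Γ (fun z => f (t, z)) (fun z => V (t, z)) y a = cov Γ f V (t, y) (0, a) := by
  rw [cov_apply, cov_apply, fderiv_slice hf, fderiv_slice hV]

lemma cov_congr {X : Type*} [NormedAddCommGroup X] [NormedSpace ℝ X]
    {Γ : F → F →L[ℝ] F →L[ℝ] F} {f V W : X → F} {x : X} (hVW : V =ᶠ[𝓝 x] W) :
    cov Γ f V x = cov Γ f W x := by
  ext a
  have h0 : V x = W x := hVW.self_of_nhds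
  rw [cov_apply, cov_apply, hVW.fderiv_eq, h0]

/-- A time derivative at `(t, y)` sees a section only on the line over `y`. This allows
position-dependent vectors such as `dualVec g p.2 j` to be frozen at `y`. -/
lemma cov_congr_line {X : Type*} [NormedAddCommGroup X] [NormedSpace ℝ X]
    {Γ : F → F →L[ℝ] F →L[ℝ] F} {f V W : ℝ × X → F} {t : ℝ} {y : X}
    (hV : DifferentiableAt ℝ V (t, y)) (hW : DifferentiableAt ℝ W (t, y))
    (h : ∀ s, V (s, y) = W (s, y)) : cov Γ f V (t, y) (1, 0) = cov Γ f W (t, y) (1, 0) := by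
  have h1 := hasDerivAt_slice hV
  have h2 := hasDerivAt_slice hW
  simp only [h] at h1
  rw [cov_apply, cov_apply, h1.unique h2, h]

variable (g : Eucl m → Eucl m →L[ℝ] Eucl m →L[ℝ] ℝ) (h : F → F →L[ℝ] F →L[ℝ] ℝ)

/-- The tension field in coordinates. -/
def tensionC (f : Eucl m → F) (y : Eucl m) : F :=
  mtrace g y (covForm (chris g) (chris h) f (fderiv ℝ f) y)

/-- The rough Laplacian in coordinates. -/
def lapC (f V : Eucl m → F) (y : Eucl m) : F :=
  -mtrace g y (covForm (chris g) (chris h) f (cov (chris h) f V) y)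

/-- The pairing of the covariant derivatives of two sections. -/
def gradPair (f V Z : Eucl m → F) (y : Eucl m) : ℝ :=
  ∑ j, h (f y) (cov (chris h) f V y (EuclideanSpace.single j 1)) (cov (chris h) f Z y (dualVec g y j))

/-- The curvature term of the variation of the tension field. -/
def riemTrace (f V : Eucl m → F) (y : Eucl m) : F :=
  ∑ j, riem (chris h) (f y) (V y) (fderiv ℝ f y (EuclideanSpace.single j 1))
    (fderiv ℝ f y (dualVec g y j))

/-- The curvature term of the variation of the covariant derivative of the section `T`. -/
def riemPair (f V T : Eucl m → F) (y : Eucl m) : ℝ :=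
  ∑ j, (h (f y) (riem (chris h) (f y) (V y) (fderiv ℝ f y (EuclideanSpace.single j 1)) (T y))
      (cov (chris h) f T y (dualVec g y j))
    + h (f y) (cov (chris h) f T y (EuclideanSpace.single j 1))
      (riem (chris h) (f y) (V y) (fderiv ℝ f y (dualVec g y j)) (T y)))

variable {g h} {U : Set (Eucl m)} {Ω : Set F}

lemma smooth_tensionC [FiniteDimensional ℝ F] (hg : IsMetricOn g U) (hh : IsMetricOn h Ω)
    {f : Eucl m → F} (hf : ContDiffOn ℝ ∞ f U) (hfU : Set.MapsTo f U Ω) :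
    ContDiffOn ℝ ∞ (tensionC g h f) U :=
  hg.smooth_mtrace subset_rfl (smooth_covForm hg.smooth_chris hh.smooth_chris hg.isOpen hf hfU
    (hf.fderiv_of_isOpen hg.isOpen (by simp)))

lemma smooth_lapC [FiniteDimensional ℝ F] (hg : IsMetricOn g U) (hh : IsMetricOn h Ω)
    {f V : Eucl m → F} (hf : ContDiffOn ℝ ∞ f U) (hfU : Set.MapsTo f U Ω) (hV : ContDiffOn ℝ ∞ V U) :
    ContDiffOn ℝ ∞ (lapC g h f V) U :=
  (hg.smooth_mtrace subset_rfl (smooth_covForm hg.smooth_chris hh.smooth_chris hg.isOpen hf hfU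
    (smooth_cov hh.smooth_chris hg.isOpen hf hfU hV))).neg

lemma gradPair_flip (hg : IsMetricOn g U) {f V Z : Eucl m → F} {y : Eucl m} (hy : y ∈ U) :
    gradPair g h f V Z y = ∑ j, h (f y) (cov (chris h) f V y (dualVec g y j))
      (cov (chris h) f Z y (EuclideanSpace.single j 1)) := by
  let B : Eucl m →L[ℝ] Eucl m →L[ℝ] ℝ :=
    (((ContinuousLinearMap.compL ℝ (Eucl m) F ℝ).flip (cov (chris h) f Z y)).comp (h (f y))).comp
      (cov (chris h) f V y)
  exact (hg.mtrace_flip hy B).symm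

lemma gradPair_comm (hg : IsMetricOn g U) (hh : IsMetricOn h Ω) {f V Z : Eucl m → F} {y : Eucl m}
    (hy : y ∈ U) (hfy : f y ∈ Ω) : gradPair g h f V Z y = gradPair g h f Z V y := by
  rw [gradPair_flip hg hy]
  exact Finset.sum_congr rfl fun j _ => hh.symm _ hfy _ _

/-- The divergence of `⟨∇V, Z⟩`. -/
lemma mtrace_covOne_pairForm_cov [FiniteDimensional ℝ F] (hg : IsMetricOn g U)
    (hh : IsMetricOn h Ω)
    {f V Z : Eucl m → F} (hf : ContDiffOn ℝ ∞ f U) (hfU : Set.MapsTo f U Ω) (hV : ContDiffOn ℝ ∞ V U)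
    (hZ : ContDiffOn ℝ ∞ Z U) {y : Eucl m} (hy : y ∈ U) :
    mtrace g y (covOne (chris g) (pairForm h f (cov (chris h) f V) Z) y)
      = -h (f y) (lapC g h f V y) (Z y) + gradPair g h f V Z y := by
  have hUy := hg.isOpen.mem_nhds hy
  have h1 := (hf.contDiffAt hUy).differentiableAt (by simp)
  have h2 := ((smooth_cov hh.smooth_chris hg.isOpen hf hfU hV).contDiffAt hUy).differentiableAt
    (by simp)
  have h3 := (hZ.contDiffAt hUy).differentiableAt (by simp)
  rw [gradPair_flip hg hy]
  simp only [mtrace, hh.covOne_pairForm (hfU hy) h1 h2 h3, Finset.sum_add_distrib, lapC, map_neg,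
    map_sum, neg_apply, neg_neg, sum_apply]

/-! ### Differentiation in time of a one-parameter family of maps. -/

section FirstVariation

variable {fv : ℝ × Eucl m → F}

/-- The dual vectors and the symbols of `g` are frozen at `y`, so the right side involves only
covariant derivatives of `fv` on `ℝ × Eucl m` in constant directions, to which `cov_comm` applies.
-/
lemma tensionC_slice (hg : IsMetricOn g U) (hfv : ContDiffOn ℝ ∞ fv (Set.univ ×ˢ U)) (t : ℝ) {y : Eucl m}
    (hy : y ∈ U) :
    tensionC g h (fun z => fv (t, z)) y
      = ∑ j, (cov (chris h) fv (fun z => fderiv ℝ fv z (0, dualVec g y j)) (t, y)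
          (0, EuclideanSpace.single j 1)
        - fderiv ℝ fv (t, y) (0, chris g y (EuclideanSpace.single j 1) (dualVec g y j))) := by
  have hS : IsOpen ((Set.univ : Set ℝ) ×ˢ U) := isOpen_univ.prod hg.isOpen
  have hd : ∀ z ∈ U, DifferentiableAt ℝ fv (t, z) := fun z hz =>
    (hfv.contDiffAt (hS.mem_nhds ⟨trivial, hz⟩)).differentiableAt (by simp)
  have hd2 : DifferentiableAt ℝ (fderiv ℝ fv) (t, y) :=
    ((hfv.fderiv_of_isOpen (m := ∞) hS (by simp)).contDiffAt
      (hS.mem_nhds ⟨trivial, hy⟩)).differentiableAt (by simp)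
  have hft : ContDiffOn ℝ ∞ (fun z => fv (t, z)) U :=
    hfv.comp (contDiffOn_const.prodMk contDiffOn_id) fun z hz => ⟨trivial, hz⟩
  have hft2 : DifferentiableAt ℝ (fderiv ℝ fun z => fv (t, z)) y :=
    ((hft.fderiv_of_isOpen (m := ∞) hg.isOpen (by simp)).contDiffAt
      (hg.isOpen.mem_nhds hy)).differentiableAt (by simp)
  rw [tensionC, mtrace]
  refine Finset.sum_congr rfl fun j _ => ?_
  rw [covForm_eq hft2, fderiv_slice (hd y hy)]
  congr 1
  rw [← cov_slice (hd y hy) (hd2.clm_apply (differentiableAt_const _))]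
  have : (fun z => fderiv ℝ (fun z => fv (t, z)) z (dualVec g y j)) =ᶠ[𝓝 y]
      fun z => fderiv ℝ fv (t, z) (0, dualVec g y j) := by
    filter_upwards [hg.isOpen.mem_nhds hy] with z hz using fderiv_slice (hd z hz) _
  rw [cov_congr this]

variable [FiniteDimensional ℝ F]

lemma smooth_tensionC_slice (hg : IsMetricOn g U) (hh : IsMetricOn h Ω)
    (hfv : ContDiffOn ℝ ∞ fv (Set.univ ×ˢ U)) (hmap : Set.MapsTo fv (Set.univ ×ˢ U) Ω) :
    ContDiffOn ℝ ∞ (fun p : ℝ × Eucl m => tensionC g h (fun z => fv (p.1, z)) p.2) (Set.univ ×ˢ U) := by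
  have hS : IsOpen ((Set.univ : Set ℝ) ×ˢ U) := isOpen_univ.prod hg.isOpen
  have hsnd : ContDiffOn ℝ ∞ (fun p : ℝ × Eucl m => p.2) (Set.univ ×ˢ U) := contDiffOn_snd
  have hdual : ∀ j, ContDiffOn ℝ ∞ (fun p : ℝ × Eucl m => dualVec g p.2 j) (Set.univ ×ˢ U) := fun j =>
    (hg.smooth_dualVec j).comp hsnd fun p hp => hp.2
  have hdf : ContDiffOn ℝ ∞ (fderiv ℝ fv) (Set.univ ×ˢ U) := hfv.fderiv_of_isOpen hS (by simp)
  have hddf : ContDiffOn ℝ ∞ (fderiv ℝ (fderiv ℝ fv)) (Set.univ ×ˢ U) :=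
    hdf.fderiv_of_isOpen hS (by simp)
  have hΓ : ContDiffOn ℝ ∞ (fun p => chris h (fv p)) (Set.univ ×ˢ U) := hh.smooth_chris.comp hfv hmap
  have hΓg : ContDiffOn ℝ ∞ (fun p : ℝ × Eucl m => chris g p.2) (Set.univ ×ˢ U) :=
    hg.smooth_chris.comp hsnd fun p hp => hp.2
  have h1 : ContDiffOn ℝ ∞ (fun p : ℝ × Eucl m => ∑ j,
      (fderiv ℝ (fderiv ℝ fv) p (0, EuclideanSpace.single j 1) (0, dualVec g p.2 j)
      + chris h (fv p) (fderiv ℝ fv p (0, EuclideanSpace.single j 1))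
          (fderiv ℝ fv p (0, dualVec g p.2 j))
      - fderiv ℝ fv p (0, chris g p.2 (EuclideanSpace.single j 1) (dualVec g p.2 j))))
      (Set.univ ×ˢ U) := by
    refine ContDiffOn.sum fun j _ => ?_
    have hz : ContDiffOn ℝ ∞ (fun p : ℝ × Eucl m => ((0 : ℝ), dualVec g p.2 j)) (Set.univ ×ˢ U) :=
      contDiffOn_const.prodMk (hdual j)
    have he : ContDiffOn ℝ ∞ (fun p : ℝ × Eucl m => ((0 : ℝ), EuclideanSpace.single j (1 : ℝ)))
      (Set.univ ×ˢ U) := contDiffOn_const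
    exact (((hddf.clm_apply he).clm_apply hz).add ((hΓ.clm_apply (hdf.clm_apply he)).clm_apply
      (hdf.clm_apply hz))).sub (hdf.clm_apply (contDiffOn_const.prodMk
        ((hΓg.clm_apply contDiffOn_const).clm_apply (hdual j))))
  refine h1.congr fun p hp => ?_
  obtain ⟨t, y⟩ := p
  have hd2 : DifferentiableAt ℝ (fderiv ℝ fv) (t, y) :=
    (hdf.contDiffAt (hS.mem_nhds hp)).differentiableAt (by simp)
  rw [tensionC_slice hg hfv t hp.2]
  refine Finset.sum_congr rfl fun j _ => ?_
  rw [cov_apply, fderiv_clm_apply_const hd2]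

/-- The variation of the tension field. -/
lemma cov_time_tensionC (hg : IsMetricOn g U) (hh : IsMetricOn h Ω)
    (hfv : ContDiffOn ℝ ∞ fv (Set.univ ×ˢ U)) (hmap : Set.MapsTo fv (Set.univ ×ˢ U) Ω) (t : ℝ) {y : Eucl m}
    (hy : y ∈ U) :
    cov (chris h) fv (fun p : ℝ × Eucl m => tensionC g h (fun z => fv (p.1, z)) p.2) (t, y) (1, 0)
      = -lapC g h (fun z => fv (t, z)) (fun z => fderiv ℝ fv (t, z) (1, 0)) y
        + riemTrace g h (fun z => fv (t, z)) (fun z => fderiv ℝ fv (t, z) (1, 0)) y := by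
  have hS : IsOpen ((Set.univ : Set ℝ) ×ˢ U) := isOpen_univ.prod hg.isOpen
  have hp : ((t, y) : ℝ × Eucl m) ∈ (Set.univ : Set ℝ) ×ˢ U := ⟨trivial, hy⟩
  have hΓ := hh.diffAt_chris (hmap hp)
  have hdf : ContDiffOn ℝ ∞ (fderiv ℝ fv) (Set.univ ×ˢ U) := hfv.fderiv_of_isOpen hS (by simp)
  have hdir : ∀ v : ℝ × Eucl m, ContDiffOn ℝ ∞ (fun z => fderiv ℝ fv z v) (Set.univ ×ˢ U) := fun v =>
    hdf.clm_apply contDiffOn_const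
  have hcov : ∀ v w : ℝ × Eucl m, ContDiffOn ℝ ∞
      (fun z => cov (chris h) fv (fun z => fderiv ℝ fv z v) z w) (Set.univ ×ˢ U) := fun v w =>
    (smooth_cov hh.smooth_chris hS hfv hmap (hdir v)).clm_apply contDiffOn_const
  have dat : ∀ {A : ℝ × Eucl m → F}, ContDiffOn ℝ ∞ A (Set.univ ×ˢ U) →
      ∀ z ∈ (Set.univ : Set ℝ) ×ˢ U, DifferentiableAt ℝ A z := fun hA z hz =>
    (hA.contDiffAt (hS.mem_nhds hz)).differentiableAt (by simp)
  have at2 : ∀ {A : ℝ × Eucl m → F}, ContDiffOn ℝ ∞ A (Set.univ ×ˢ U) → ContDiffAt ℝ 2 A (t, y) :=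
    fun hA => (hA.contDiffAt (hS.mem_nhds hp)).of_le (by norm_cast)
  have h1 : ∀ s, tensionC g h (fun z => fv (s, z)) y
      = ∑ j, (cov (chris h) fv (fun z => fderiv ℝ fv z (0, dualVec g y j)) (s, y)
          (0, EuclideanSpace.single j 1)
        - fderiv ℝ fv (s, y) (0, chris g y (EuclideanSpace.single j 1) (dualVec g y j))) :=
    fun s => tensionC_slice hg hfv s hy
  have h2 := cov_congr_line (Γ := chris h) (f := fv) (t := t) (y := y)
    (V := fun p : ℝ × Eucl m => tensionC g h (fun z => fv (p.1, z)) p.2)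
    (W := fun p : ℝ × Eucl m => ∑ j, (cov (chris h) fv (fun z => fderiv ℝ fv z (0, dualVec g y j)) p
          (0, EuclideanSpace.single j 1)
        - fderiv ℝ fv p (0, chris g y (EuclideanSpace.single j 1) (dualVec g y j))))
    (dat (smooth_tensionC_slice hg hh hfv hmap) _ hp)
    (DifferentiableAt.fun_sum fun j _ => (dat (hcov _ _) _ hp).fun_sub (dat (hdir _) _ hp)) h1
  rw [h2]
  have h3 : cov (chris h) fv (fun p : ℝ × Eucl m => ∑ j, (cov (chris h) fv
          (fun z => fderiv ℝ fv z (0, dualVec g y j)) p (0, EuclideanSpace.single j 1)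
        - fderiv ℝ fv p (0, chris g y (EuclideanSpace.single j 1) (dualVec g y j)))) (t, y) (1, 0)
      = ∑ j, (cov (chris h) fv (fun p => cov (chris h) fv
          (fun z => fderiv ℝ fv z (0, dualVec g y j)) p (0, EuclideanSpace.single j 1)) (t, y) (1, 0)
        - cov (chris h) fv (fun p => fderiv ℝ fv p (0, chris g y (EuclideanSpace.single j 1)
          (dualVec g y j))) (t, y) (1, 0)) := by
    simp only [cov_apply _ _ _ (t, y) (1, 0)]
    rw [fderiv_fun_sum fun j _ => (dat (hcov _ _) _ hp).fun_sub (dat (hdir _) _ hp)]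
    simp only [sum_apply, map_sum, ← Finset.sum_add_distrib]
    refine Finset.sum_congr rfl fun j _ => ?_
    rw [fderiv_fun_sub (dat (hcov _ _) _ hp) (dat (hdir _) _ hp)]
    simp only [sub_apply, map_sub]
    abel
  have hsym : ∀ z ∈ (Set.univ : Set ℝ) ×ˢ U, ∀ v w : ℝ × Eucl m,
      cov (chris h) fv (fun z => fderiv ℝ fv z v) z w = cov (chris h) fv (fun z => fderiv ℝ fv z w) z v :=
    fun z hz v w => cov_fderiv_comm (fun a b => hh.chris_symm (hmap hz) a b)
      ((hfv.contDiffAt (hS.mem_nhds hz)).of_le (by norm_cast)) w v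
  have hft : ContDiffOn ℝ ∞ (fun z => fv (t, z)) U :=
    hfv.comp (contDiffOn_const.prodMk contDiffOn_id) fun z hz => ⟨trivial, hz⟩
  have hVt : ContDiffOn ℝ ∞ (fun z => fderiv ℝ fv (t, z) (1, 0)) U :=
    (hdir (1, 0)).comp (contDiffOn_const.prodMk contDiffOn_id) fun z hz => ⟨trivial, hz⟩
  have hcovt : DifferentiableAt ℝ (cov (chris h) (fun z => fv (t, z))
      (fun z => fderiv ℝ fv (t, z) (1, 0))) y :=
    ((smooth_cov hh.smooth_chris hg.isOpen hft (fun z hz => hmap ⟨trivial, hz⟩) hVt).contDiffAt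
      (hg.isOpen.mem_nhds hy)).differentiableAt (by simp)
  rw [h3, lapC, neg_neg, riemTrace, mtrace, ← Finset.sum_add_distrib]
  refine Finset.sum_congr rfl fun j _ => ?_
  -- The time derivative passes the outer space derivative at the cost of the curvature term. Then
  -- torsion-freeness turns the time derivative of `df` into the space derivative of the variation
  -- field.
  rw [cov_comm hΓ (at2 hfv) (at2 (hdir _)), hsym _ hp, covForm_eq hcovt,
    cov_slice (dat hfv _ hp) (dat (hdir _) _ hp), fderiv_slice (dat hfv _ hp),
    fderiv_slice (dat hfv _ hp)]
  have e1 : (fun z => cov (chris h) fv (fun z => fderiv ℝ fv z (0, dualVec g y j)) z (1, 0))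
      =ᶠ[𝓝 (t, y)] fun z => cov (chris h) fv (fun z => fderiv ℝ fv z (1, 0)) z (0, dualVec g y j) := by
    filter_upwards [hS.mem_nhds hp] with z hz using hsym z hz _ _
  have e2 : (fun z => cov (chris h) (fun z => fv (t, z)) (fun z => fderiv ℝ fv (t, z) (1, 0)) z
      (dualVec g y j)) =ᶠ[𝓝 y]
      fun z => cov (chris h) fv (fun z => fderiv ℝ fv z (1, 0)) (t, z) (0, dualVec g y j) := by
    filter_upwards [hg.isOpen.mem_nhds hy] with z hz
    exact cov_slice (V := fun z => fderiv ℝ fv z (1, 0)) (dat hfv _ ⟨trivial, hz⟩)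
      (dat (hdir _) _ ⟨trivial, hz⟩) _
  have e3 : cov (chris h) (fun z => fv (t, z)) (fun z => cov (chris h) (fun z => fv (t, z))
      (fun z => fderiv ℝ fv (t, z) (1, 0)) z (dualVec g y j)) y (EuclideanSpace.single j 1)
      = cov (chris h) fv (fun z => cov (chris h) fv (fun z => fderiv ℝ fv z (0, dualVec g y j)) z (1, 0))
        (t, y) (0, EuclideanSpace.single j 1) := by
    rw [cov_congr e2, cov_slice (V := fun z =>
      cov (chris h) fv (fun z => fderiv ℝ fv z (1, 0)) z (0, dualVec g y j))
      (dat hfv _ hp) (dat (hcov _ _) _ hp), cov_congr e1]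
  rw [e3]
  abel

/-- The variation of `|∇τ|²`. -/
lemma hasDerivAt_gradPair_tensionC (hg : IsMetricOn g U) (hh : IsMetricOn h Ω)
    (hfv : ContDiffOn ℝ ∞ fv (Set.univ ×ˢ U)) (hmap : Set.MapsTo fv (Set.univ ×ˢ U) Ω) (t : ℝ) {y : Eucl m}
    (hy : y ∈ U) :
    HasDerivAt (fun s => gradPair g h (fun z => fv (s, z)) (tensionC g h fun z => fv (s, z))
        (tensionC g h fun z => fv (s, z)) y)
      (2 * gradPair g h (fun z => fv (t, z))
        (fun y => -lapC g h (fun z => fv (t, z)) (fun z => fderiv ℝ fv (t, z) (1, 0)) y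
          + riemTrace g h (fun z => fv (t, z)) (fun z => fderiv ℝ fv (t, z) (1, 0)) y)
        (tensionC g h fun z => fv (t, z)) y
      + riemPair g h (fun z => fv (t, z)) (fun z => fderiv ℝ fv (t, z) (1, 0))
        (tensionC g h fun z => fv (t, z)) y) t := by
  have hS : IsOpen ((Set.univ : Set ℝ) ×ˢ U) := isOpen_univ.prod hg.isOpen
  have hp : ∀ s, ((s, y) : ℝ × Eucl m) ∈ (Set.univ : Set ℝ) ×ˢ U := fun s => ⟨trivial, hy⟩
  have dat : ∀ {A : ℝ × Eucl m → F}, ContDiffOn ℝ ∞ A (Set.univ ×ˢ U) →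
      ∀ z ∈ (Set.univ : Set ℝ) ×ˢ U, DifferentiableAt ℝ A z := fun hA z hz =>
    (hA.contDiffAt (hS.mem_nhds hz)).differentiableAt (by simp)
  have at2 : ∀ {A : ℝ × Eucl m → F}, ContDiffOn ℝ ∞ A (Set.univ ×ˢ U) → ContDiffAt ℝ 2 A (t, y) :=
    fun hA => (hA.contDiffAt (hS.mem_nhds (hp t))).of_le (by norm_cast)
  set T : ℝ × Eucl m → F := fun p => tensionC g h (fun z => fv (p.1, z)) p.2 with hTdef
  have hT : ContDiffOn ℝ ∞ T (Set.univ ×ˢ U) := smooth_tensionC_slice hg hh hfv hmap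
  have hcT : ∀ v : ℝ × Eucl m, ContDiffOn ℝ ∞ (fun z => cov (chris h) fv T z v) (Set.univ ×ˢ U) := fun v =>
    (smooth_cov hh.smooth_chris hS hfv hmap hT).clm_apply contDiffOn_const
  have hcs : ∀ (s : ℝ) (a : Eucl m), cov (chris h) (fun z => fv (s, z)) (tensionC g h fun z => fv (s, z)) y a
      = cov (chris h) fv T (s, y) (0, a) := fun s a =>
    cov_slice (V := T) (dat hfv _ (hp s)) (dat hT _ (hp s)) a
  have hZ : (fun z => cov (chris h) fv T (t, z) (1, 0)) =ᶠ[𝓝 y]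
      (fun y => -lapC g h (fun z => fv (t, z)) (fun z => fderiv ℝ fv (t, z) (1, 0)) y
          + riemTrace g h (fun z => fv (t, z)) (fun z => fderiv ℝ fv (t, z) (1, 0)) y) := by
    filter_upwards [hg.isOpen.mem_nhds hy] with z hz using cov_time_tensionC hg hh hfv hmap t hz
  have hcZ : ∀ a : Eucl m, cov (chris h) (fun z => fv (t, z))
      (fun y => -lapC g h (fun z => fv (t, z)) (fun z => fderiv ℝ fv (t, z) (1, 0)) y
          + riemTrace g h (fun z => fv (t, z)) (fun z => fderiv ℝ fv (t, z) (1, 0)) y) y a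
      = cov (chris h) fv (fun z => cov (chris h) fv T z (1, 0)) (t, y) (0, a) := by
    intro a
    rw [← cov_congr hZ]
    exact cov_slice (V := fun z => cov (chris h) fv T z (1, 0)) (dat hfv _ (hp t))
      (dat (hcT _) _ (hp t)) a
  -- Exchanging the time and space derivatives of the tension field is what produces `riemPair`.
  have hcomm : ∀ a : Eucl m, cov (chris h) fv (fun z => cov (chris h) fv T z (0, a)) (t, y) (1, 0)
      = cov (chris h) fv (fun z => cov (chris h) fv T z (1, 0)) (t, y) (0, a)
        + riem (chris h) (fv (t, y)) (fderiv ℝ fv (t, y) (1, 0))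
          (fderiv ℝ (fun z => fv (t, z)) y a) (T (t, y)) := by
    intro a
    rw [fderiv_slice (dat hfv _ (hp t))]
    exact cov_comm (hh.diffAt_chris (hmap (hp t))) (at2 hfv) (at2 hT) (1, 0) (0, a)
  have hterm : ∀ j, HasDerivAt (fun s => h (fv (s, y)) (cov (chris h) fv T (s, y)
      (0, EuclideanSpace.single j 1)) (cov (chris h) fv T (s, y) (0, dualVec g y j)))
      (h (fv (t, y)) (cov (chris h) fv (fun z => cov (chris h) fv T z (0, EuclideanSpace.single j 1))
          (t, y) (1, 0)) (cov (chris h) fv T (t, y) (0, dualVec g y j))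
        + h (fv (t, y)) (cov (chris h) fv T (t, y) (0, EuclideanSpace.single j 1))
          (cov (chris h) fv (fun z => cov (chris h) fv T z (0, dualVec g y j)) (t, y) (1, 0))) t := by
    intro j
    have h1 := hh.hasFDerivAt_inner (f := fv)
      (V := fun z => cov (chris h) fv T z (0, EuclideanSpace.single j 1))
      (W := fun z => cov (chris h) fv T z (0, dualVec g y j)) (hmap (hp t)) (dat hfv _ (hp t))
      (dat (hcT _) _ (hp t)) (dat (hcT _) _ (hp t))
    have h2 := hasDerivAt_slice (A := fun z => h (fv z)
      (cov (chris h) fv T z (0, EuclideanSpace.single j 1))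
      (cov (chris h) fv T z (0, dualVec g y j))) h1.differentiableAt
    rw [h1.fderiv] at h2
    simpa using h2
  have hsum := HasDerivAt.fun_sum (u := Finset.univ) fun j (_ : j ∈ Finset.univ) => hterm j
  have hgoal : (fun s => gradPair g h (fun z => fv (s, z)) (tensionC g h fun z => fv (s, z))
        (tensionC g h fun z => fv (s, z)) y) = fun s => ∑ j, h (fv (s, y)) (cov (chris h) fv T (s, y)
      (0, EuclideanSpace.single j 1)) (cov (chris h) fv T (s, y) (0, dualVec g y j)) := by
    funext s
    simp only [gradPair, hcs]
  rw [hgoal]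
  refine hsum.congr_deriv ?_
  rw [two_mul]
  -- The product rule yields the pairing in both orders; symmetry makes them the factor 2.
  nth_rewrite 2 [gradPair_comm hg hh hy (hmap (hp t))]
  simp only [gradPair, riemPair, ← Finset.sum_add_distrib, hcZ, hcs, hcomm]
  refine Finset.sum_congr rfl fun j _ => ?_
  simp only [map_add, add_apply]
  ring

lemma smooth_gradPair_slice (hg : IsMetricOn g U) (hh : IsMetricOn h Ω)
    (hfv : ContDiffOn ℝ ∞ fv (Set.univ ×ˢ U)) (hmap : Set.MapsTo fv (Set.univ ×ˢ U) Ω) :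
    ContDiffOn ℝ ∞ (fun p : ℝ × Eucl m => gradPair g h (fun z => fv (p.1, z))
      (tensionC g h fun z => fv (p.1, z)) (tensionC g h fun z => fv (p.1, z)) p.2)
      (Set.univ ×ˢ U) := by
  have hS : IsOpen ((Set.univ : Set ℝ) ×ˢ U) := isOpen_univ.prod hg.isOpen
  set T : ℝ × Eucl m → F := fun p => tensionC g h (fun z => fv (p.1, z)) p.2 with hTdef
  have hT : ContDiffOn ℝ ∞ T (Set.univ ×ˢ U) := smooth_tensionC_slice hg hh hfv hmap
  have hcT := smooth_cov hh.smooth_chris hS hfv hmap hT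
  have dat : ∀ {A : ℝ × Eucl m → F}, ContDiffOn ℝ ∞ A (Set.univ ×ˢ U) →
      ∀ z ∈ (Set.univ : Set ℝ) ×ˢ U, DifferentiableAt ℝ A z := fun hA z hz =>
    (hA.contDiffAt (hS.mem_nhds hz)).differentiableAt (by simp)
  have h1 : ContDiffOn ℝ ∞ (fun p : ℝ × Eucl m => ∑ j, h (fv p) (cov (chris h) fv T p
      (0, EuclideanSpace.single j 1)) (cov (chris h) fv T p (0, dualVec g p.2 j)))
      (Set.univ ×ˢ U) := by
    refine ContDiffOn.sum fun j _ => ?_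
    exact ((hh.smooth.comp hfv hmap).clm_apply (hcT.clm_apply contDiffOn_const)).clm_apply
      (hcT.clm_apply (contDiffOn_const.prodMk
        ((hg.smooth_dualVec j).comp contDiffOn_snd fun p hp => hp.2)))
  refine h1.congr fun p hp => ?_
  obtain ⟨t, y⟩ := p
  refine Finset.sum_congr rfl fun j _ => ?_
  have hcs : ∀ (a : Eucl m), cov (chris h) (fun z => fv (t, z)) (tensionC g h fun z => fv (t, z)) y a
      = cov (chris h) fv T (t, y) (0, a) := fun a => cov_slice (V := T) (dat hfv _ hp) (dat hT _ hp) a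
  simp only [hcs]

end FirstVariation

end Variation

/-! ### The Euler–Lagrange equation in coordinates -/

section EulerLagrange

/-- Differentiation under the integral sign, dominated by a bound of the time derivative on the
compact set `[-1, 1] × K`. -/
lemma hasDerivAt_setIntegral_slice {E : Type*} [NormedAddCommGroup E] [NormedSpace ℝ E]
    [MeasurableSpace E] [BorelSpace E] {ν : Measure E} [IsFiniteMeasureOnCompacts ν]
    {A : ℝ × E → ℝ} {U K : Set E} (hU : IsOpen U) (hK : IsCompact K)
    (hKU : K ⊆ U) (hA : ContDiffOn ℝ ∞ A (Set.univ ×ˢ U)) :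
    Integrable (fun y => fderiv ℝ A (0, y) (1, 0)) (ν.restrict K) ∧
    HasDerivAt (fun t => ∫ y in K, A (t, y) ∂ν) (∫ y in K, fderiv ℝ A (0, y) (1, 0) ∂ν) 0 := by
  have hS : IsOpen ((Set.univ : Set ℝ) ×ˢ U) := isOpen_univ.prod hU
  have hD : ContinuousOn (fun p => fderiv ℝ A p (1, 0)) (Set.univ ×ˢ U) :=
    ((hA.fderiv_of_isOpen (m := ∞) hS (by simp)).continuousOn).clm_apply continuousOn_const
  have hcK : IsCompact (Set.Icc (-1 : ℝ) 1 ×ˢ K) := isCompact_Icc.prod hK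
  obtain ⟨C, hC⟩ := hcK.exists_bound_of_continuousOn
    (hD.mono (Set.prod_mono (Set.subset_univ _) hKU))
  have hmeas : MeasurableSet K := hK.isClosed.measurableSet
  have hslice : ∀ {B : ℝ × E → ℝ} (_ : ContinuousOn B (Set.univ ×ˢ U)) (t : ℝ),
      ContinuousOn (fun y => B (t, y)) K := fun hB t =>
    hB.comp (Continuous.prodMk_right t).continuousOn fun y hy => ⟨trivial, hKU hy⟩
  refine hasDerivAt_integral_of_dominated_loc_of_deriv_le (F := fun t y => A (t, y))
    (F' := fun t y => fderiv ℝ A (t, y) (1, 0)) (bound := fun _ => C)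
    (s := Set.Icc (-1) 1) (Icc_mem_nhds (by norm_num) (by norm_num)) ?_ ?_ ?_ ?_ ?_ ?_
  · exact Filter.Eventually.of_forall fun t =>
      (hslice hA.continuousOn t).aestronglyMeasurable_of_isCompact hK hmeas
  · exact (hslice hA.continuousOn 0).integrableOn_compact hK
  · exact (hslice hD 0).aestronglyMeasurable_of_isCompact hK hmeas
  · filter_upwards [ae_restrict_mem hmeas] with y hy t ht using hC (t, y) ⟨ht, hy⟩
  · have : IsFiniteMeasure (ν.restrict K) := ⟨by simpa using hK.measure_lt_top⟩
    exact integrable_const C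
  · filter_upwards [ae_restrict_mem hmeas] with y hy t ht
    exact hasDerivAt_slice ((hA.contDiffAt (hS.mem_nhds ⟨trivial, hKU hy⟩)).differentiableAt
      (by simp))

variable {m : ℕ} {F : Type*} [NormedAddCommGroup F] [NormedSpace ℝ F]

lemma riem_smul (Γ : F → F →L[ℝ] F →L[ℝ] F) (r : ℝ) (y a b w : F) :
    riem Γ y (r • a) b w = r • riem Γ y a b w := by
  simp [riem, smul_sub, smul_add]

lemma smooth_riem {X : Type*} [NormedAddCommGroup X] [NormedSpace ℝ X]
    {Γ : F → F →L[ℝ] F →L[ℝ] F} {Ω : Set F} {U : Set X} (hΩ : IsOpen Ω)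
    (hΓ : ContDiffOn ℝ ∞ Γ Ω) {f a b w : X → F} (hf : ContDiffOn ℝ ∞ f U) (hfU : Set.MapsTo f U Ω)
    (ha : ContDiffOn ℝ ∞ a U) (hb : ContDiffOn ℝ ∞ b U) (hw : ContDiffOn ℝ ∞ w U) :
    ContDiffOn ℝ ∞ (fun x => riem Γ (f x) (a x) (b x) (w x)) U := by
  have h1 : ContDiffOn ℝ ∞ (fun x => Γ (f x)) U := hΓ.comp hf hfU
  have h2 : ContDiffOn ℝ ∞ (fun x => fderiv ℝ Γ (f x)) U :=
    (hΓ.fderiv_of_isOpen (m := ∞) hΩ (by simp)).comp hf hfU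
  exact (((((h2.clm_apply ha).clm_apply hb).clm_apply hw).sub
    (((h2.clm_apply hb).clm_apply ha).clm_apply hw)).add
    ((h1.clm_apply ha).clm_apply ((h1.clm_apply hb).clm_apply hw))).sub
    ((h1.clm_apply hb).clm_apply ((h1.clm_apply ha).clm_apply hw))

variable (g : Eucl m → Eucl m →L[ℝ] Eucl m →L[ℝ] ℝ) (h : F → F →L[ℝ] F →L[ℝ] ℝ)

/-- Twice the first variation of the 3-energy density, up to a divergence. -/
def eulerForm (f : Eucl m → F) (y : Eucl m) (v : F) : ℝ :=
  2 * (-h (f y) (lapC g h f (lapC g h f (tensionC g h f)) y) v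
      + h (f y) (lapC g h f (tensionC g h f) y) (riemTrace g h f (fun _ => v) y))
    + riemPair g h f (fun _ => v) (tensionC g h f) y

variable {g h} {U : Set (Eucl m)} {Ω : Set F}

/-- The form is tensorial in `v`, so scalar test functions can be pulled out of it. -/
lemma eulerForm_smul (f : Eucl m → F) (y : Eucl m) (r : ℝ) (v : F) :
    eulerForm g h f y (r • v) = r * eulerForm g h f y v := by
  simp only [eulerForm, riemTrace, riemPair, riem_smul, map_smul, FunLike.coe_smul, Pi.smul_apply,
    smul_eq_mul, ← Finset.smul_sum, ← mul_add, ← Finset.mul_sum]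
  ring

lemma cov_eventually_zero {X : Type*} [NormedAddCommGroup X] [NormedSpace ℝ X]
    {Γ : F → F →L[ℝ] F →L[ℝ] F} {f V : X → F} {x : X} (hV : V =ᶠ[𝓝 x] 0) :
    cov Γ f V =ᶠ[𝓝 x] 0 := by
  filter_upwards [hV.eventuallyEq_nhds] with z hz
  have h0 : V z = 0 := hz.self_of_nhds
  ext a
  rw [cov_apply, hz.fderiv_eq, h0]
  simp

lemma lapC_eq_zero {f V : Eucl m → F} {y : Eucl m} (hV : V =ᶠ[𝓝 y] 0) : lapC g h f V y = 0 := by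
  have h1 := cov_eventually_zero (Γ := chris h) (f := f) hV
  have h0 : cov (chris h) f V y = 0 := h1.self_of_nhds
  have : covForm (chris g) (chris h) f (cov (chris h) f V) y = 0 := by
    ext a b
    rw [covForm_apply, h1.fderiv_eq, h0]
    simp
  simp [lapC, this, mtrace]

variable [FiniteDimensional ℝ F]

lemma smooth_riemTrace (hg : IsMetricOn g U) (hh : IsMetricOn h Ω) {f V : Eucl m → F}
    (hf : ContDiffOn ℝ ∞ f U) (hfU : Set.MapsTo f U Ω) (hV : ContDiffOn ℝ ∞ V U) :
    ContDiffOn ℝ ∞ (riemTrace g h f V) U := by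
  have hdf : ContDiffOn ℝ ∞ (fderiv ℝ f) U := hf.fderiv_of_isOpen hg.isOpen (by simp)
  refine ContDiffOn.sum fun j _ => ?_
  exact smooth_riem hh.isOpen hh.smooth_chris hf hfU hV (hdf.clm_apply contDiffOn_const)
    (hdf.clm_apply (hg.smooth_dualVec j))

lemma smooth_riemPair (hg : IsMetricOn g U) (hh : IsMetricOn h Ω) {f V T : Eucl m → F}
    (hf : ContDiffOn ℝ ∞ f U) (hfU : Set.MapsTo f U Ω) (hV : ContDiffOn ℝ ∞ V U)
    (hT : ContDiffOn ℝ ∞ T U) : ContDiffOn ℝ ∞ (riemPair g h f V T) U := by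
  have hdf : ContDiffOn ℝ ∞ (fderiv ℝ f) U := hf.fderiv_of_isOpen hg.isOpen (by simp)
  have hcT := smooth_cov hh.smooth_chris hg.isOpen hf hfU hT
  have hhf : ContDiffOn ℝ ∞ (fun y => h (f y)) U := hh.smooth.comp hf hfU
  refine ContDiffOn.sum fun j _ => ?_
  have hd := hg.smooth_dualVec j
  exact ((hhf.clm_apply (smooth_riem hh.isOpen hh.smooth_chris hf hfU hV
      (hdf.clm_apply contDiffOn_const) hT)).clm_apply (hcT.clm_apply hd)).add
    ((hhf.clm_apply (hcT.clm_apply contDiffOn_const)).clm_apply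
      (smooth_riem hh.isOpen hh.smooth_chris hf hfU hV (hdf.clm_apply hd) hT))

lemma smooth_eulerForm (hg : IsMetricOn g U) (hh : IsMetricOn h Ω) {f : Eucl m → F}
    (hf : ContDiffOn ℝ ∞ f U) (hfU : Set.MapsTo f U Ω) (v : F) :
    ContDiffOn ℝ ∞ (fun y => eulerForm g h f y v) U := by
  have hhf : ContDiffOn ℝ ∞ (fun y => h (f y)) U := hh.smooth.comp hf hfU
  have hT := smooth_tensionC hg hh hf hfU
  have hW := smooth_lapC hg hh hf hfU hT
  have hLW := smooth_lapC hg hh hf hfU hW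
  exact (contDiffOn_const.mul (((hhf.clm_apply hLW).clm_apply contDiffOn_const).neg.add
    ((hhf.clm_apply hW).clm_apply (smooth_riemTrace hg hh hf hfU contDiffOn_const)))).add
    (smooth_riemPair hg hh hf hfU contDiffOn_const hT)

/-- The divergence of a compactly supported one-form has integral zero and is integrable. -/
lemma IsMetricOn.setIntegral_div (hg : IsMetricOn g U) {θ : Eucl m → Eucl m →L[ℝ] ℝ}
    (hθ : ContDiffOn ℝ ∞ θ U) {K : Set (Eucl m)} (hK : IsCompact K) (hKU : K ⊆ U)
    (hs : Function.support θ ⊆ K) :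
    IntegrableOn (fun y => density g y * mtrace g y (covOne (chris g) θ y)) K ∧
      ∫ y in K, density g y * mtrace g y (covOne (chris g) θ y) = 0 := by
  have hts : tsupport θ ⊆ K := closure_minimal hs hK.isClosed
  have hcont : ContinuousOn (fun y => density g y * mtrace g y (covOne (chris g) θ y)) U := by
    refine hg.smooth_density.continuousOn.mul
      (hg.smooth_mtrace (B := fun y => covOne (chris g) θ y) subset_rfl ?_).continuousOn
    have h3 : ContDiffOn ℝ ∞ (fun x => (ContinuousLinearMap.compL ℝ (Eucl m) (Eucl m) ℝ) (θ x)) U :=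
      (ContinuousLinearMap.contDiff _).comp_contDiffOn hθ
    exact (hθ.fderiv_of_isOpen hg.isOpen (by simp)).sub (h3.clm_comp hg.smooth_chris)
  refine ⟨(hcont.mono hKU).integrableOn_compact hK, ?_⟩
  rw [setIntegral_eq_integral_of_forall_compl_eq_zero]
  · exact hg.integral_div hθ (HasCompactSupport.of_support_subset_isCompact hK hs) (hts.trans hKU)
  · intro y hy
    have h0 : θ =ᶠ[𝓝 y] 0 := notMem_tsupport_iff_eventuallyEq.mp fun h => hy (hts h)
    have h1 : θ y = 0 := h0.self_of_nhds
    have h2 : covOne (chris g) θ y = 0 := by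
      ext a b
      rw [covOne_apply, h0.fderiv_eq, h1]
      simp
    simp [h2, mtrace]

/-- The first variation of the 3-energy is given by the Euler–Lagrange form. -/
lemma setIntegral_first_variation (hg : IsMetricOn g U) (hh : IsMetricOn h Ω) {f V : Eucl m → F}
    (hf : ContDiffOn ℝ ∞ f U) (hfU : Set.MapsTo f U Ω) (hV : ContDiff ℝ ∞ V)
    {K : Set (Eucl m)} (hK : IsCompact K) (hKU : K ⊆ U) (hs : tsupport V ⊆ K)
    (hint : IntegrableOn (fun y => density g y * (2 * gradPair g h f
        (fun y => -lapC g h f V y + riemTrace g h f V y) (tensionC g h f) y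
      + riemPair g h f V (tensionC g h f) y)) K) :
    ∫ y in K, density g y * (2 * gradPair g h f
        (fun y => -lapC g h f V y + riemTrace g h f V y) (tensionC g h f) y
      + riemPair g h f V (tensionC g h f) y)
      = ∫ y in K, density g y * eulerForm g h f y (V y) := by
  have hT := smooth_tensionC hg hh hf hfU
  have hW := smooth_lapC hg hh hf hfU hT
  have hVU : ContDiffOn ℝ ∞ V U := hV.contDiffOn
  set T := tensionC g h f
  set W := lapC g h f T
  set Z : Eucl m → F := fun y => -lapC g h f V y + riemTrace g h f V y with hZdef
  have hZ : ContDiffOn ℝ ∞ Z U :=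
    (smooth_lapC hg hh hf hfU hVU).neg.add (smooth_riemTrace hg hh hf hfU hVU)
  have hV0 : ∀ y, y ∉ K → V =ᶠ[𝓝 y] 0 := fun y hy =>
    notMem_tsupport_iff_eventuallyEq.mp fun h => hy (hs h)
  have hcov : ∀ {A : Eucl m → F}, ContDiffOn ℝ ∞ A U → ContDiffOn ℝ ∞ (cov (chris h) f A) U :=
    fun hA => smooth_cov hh.smooth_chris hg.isOpen hf hfU hA
  -- Three divergences remove all derivatives from `V`: `⟨∇T, Z⟩` moves the one on `Z` over to `T`,
  -- while `⟨∇V, W⟩` and `⟨∇W, V⟩` together exchange `⟨ΔV, W⟩` for `⟨V, ΔW⟩`.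
  obtain ⟨i1, e1⟩ := hg.setIntegral_div (smooth_pairForm hh hf hfU (hcov hT) hZ) hK hKU (by
    intro y hy
    by_contra hyK
    apply hy
    have h1 : V y = 0 := (hV0 y hyK).self_of_nhds
    have : Z y = 0 := by
      simp [hZdef, lapC_eq_zero (hV0 y hyK), riemTrace, h1, riem]
    ext a
    simp [pairForm_apply, this])
  obtain ⟨i2, e2⟩ := hg.setIntegral_div (smooth_pairForm hh hf hfU (hcov hVU) hW) hK hKU (by
    intro y hy
    by_contra hyK
    apply hy
    have : cov (chris h) f V y = 0 := (cov_eventually_zero (hV0 y hyK)).self_of_nhds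
    ext a
    simp [pairForm_apply, this])
  obtain ⟨i3, e3⟩ := hg.setIntegral_div (smooth_pairForm hh hf hfU (hcov hW) hVU) hK hKU (by
    intro y hy
    by_contra hyK
    apply hy
    have h1 : V y = 0 := (hV0 y hyK).self_of_nhds
    ext a
    simp [pairForm_apply, h1])
  have key : ∀ y ∈ K, density g y * eulerForm g h f y (V y)
      = density g y * (2 * gradPair g h f Z T y + riemPair g h f V T y)
        - 2 * (density g y * mtrace g y (covOne (chris g)
            (pairForm h f (cov (chris h) f T) Z) y))
        - 2 * (density g y * mtrace g y (covOne (chris g)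
            (pairForm h f (cov (chris h) f V) W) y))
        + 2 * (density g y * mtrace g y (covOne (chris g)
            (pairForm h f (cov (chris h) f W) V) y)) := by
    intro y hyK
    have hy := hKU hyK
    rw [mtrace_covOne_pairForm_cov hg hh hf hfU hT hZ hy,
      mtrace_covOne_pairForm_cov hg hh hf hfU hVU hW hy,
      mtrace_covOne_pairForm_cov hg hh hf hfU hW hVU hy,
      gradPair_comm hg hh hy (hfU hy) (V := Z), gradPair_comm hg hh hy (hfU hy) (V := V),
      hh.symm _ (hfU hy) (lapC g h f V y)]
    have hZy : h (f y) (W y) (Z y)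
        = -h (f y) (W y) (lapC g h f V y) + h (f y) (W y) (riemTrace g h f V y) := by
      simp [hZdef]
    have hWT : lapC g h f T y = W y := rfl
    have hE : eulerForm g h f y (V y) = 2 * (-h (f y) (lapC g h f W y) (V y)
      + h (f y) (W y) (riemTrace g h f V y)) + riemPair g h f V T y := rfl
    rw [hE, hWT, hZy]
    ring
  rw [setIntegral_congr_fun hK.isClosed.measurableSet key]
  have j1 : IntegrableOn (fun y => density g y * (2 * gradPair g h f Z T y + riemPair g h f V T y)
      - 2 * (density g y * mtrace g y (covOne (chris g)
        (pairForm h f (cov (chris h) f T) Z) y))) K := hint.sub (i1.const_mul 2)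
  have j2 : IntegrableOn (fun y => density g y * (2 * gradPair g h f Z T y + riemPair g h f V T y)
      - 2 * (density g y * mtrace g y (covOne (chris g)
        (pairForm h f (cov (chris h) f T) Z) y))
      - 2 * (density g y * mtrace g y (covOne (chris g)
        (pairForm h f (cov (chris h) f V) W) y))) K := j1.sub (i2.const_mul 2)
  rw [integral_add j2 (i3.const_mul 2), integral_sub j1 (i2.const_mul 2),
    integral_sub hint (i1.const_mul 2), integral_const_mul, integral_const_mul,
    integral_const_mul, e1, e2, e3]
  simp

/-- A map that is critical for the coordinate 3-energy satisfies the Euler–Lagrange equation. -/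
lemma eulerForm_eq_zero (hg : IsMetricOn g U) (hh : IsMetricOn h Ω) {f : Eucl m → F}
    (hf : ContDiffOn ℝ ∞ f U) (hfU : Set.MapsTo f U Ω)
    (hcrit : ∀ (V : Eucl m → F) (K : Set (Eucl m)), ContDiff ℝ ∞ V → IsCompact K → K ⊆ U →
      tsupport V ⊆ K → (∀ y ∈ U, ∀ s : ℝ, |s| ≤ 1 → f y + s • V y ∈ Ω) →
      HasDerivAt (fun t : ℝ => ∫ y in K, density g y * gradPair g h
        (fun z => f z + Real.sin t • V z) (tensionC g h fun z => f z + Real.sin t • V z)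
        (tensionC g h fun z => f z + Real.sin t • V z) y) 0 0)
    {y : Eucl m} (hy : y ∈ U) (v : F) : eulerForm g h f y v = 0 := by
  have hsm := smooth_eulerForm hg hh hf hfU v
  have main : ∀ ρ : Eucl m → ℝ, ContDiff ℝ ∞ ρ → HasCompactSupport ρ → tsupport ρ ⊆ U →
      ∫ y, ρ y • (density g y * eulerForm g h f y v) = 0 := by
    intro ρ hρ hρc hρU
    set K := tsupport ρ
    have hK : IsCompact K := hρc
    -- The image of the compact set `K` keeps a distance `ε` from the complement of `Ω`.
    obtain ⟨ε, hε, hεΩ⟩ := (hK.image_of_continuousOn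
      (hf.continuousOn.mono hρU)).exists_cthickening_subset_open hh.isOpen
      (Set.image_subset_iff.2 fun z hz => hfU (hρU hz))
    obtain ⟨C, hC⟩ := hρc.exists_bound_of_continuous hρ.continuous
    have hC0 : 0 ≤ C := (norm_nonneg _).trans (hC 0)
    -- This scale makes the displacement `ρ • (δ • v)` at most `ε`; the summand 1 keeps the
    -- denominator positive even when `v = 0`.
    set δ : ℝ := ε / (1 + C * ‖v‖) with hδdef
    have hden : 0 < 1 + C * ‖v‖ := by positivity
    have hδ : 0 < δ := div_pos hε hden
    set V : Eucl m → F := fun z => ρ z • (δ • v) with hVdef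
    have hVs : ContDiff ℝ ∞ V := hρ.smul contDiff_const
    have hsupp : tsupport V ⊆ K := closure_mono fun z hz h0 => hz (by simp [hVdef, h0])
    have hmap : ∀ z ∈ U, ∀ s : ℝ, |s| ≤ 1 → f z + s • V z ∈ Ω := by
      intro z hz s hs
      by_cases hzK : z ∈ K
      · apply hεΩ
        refine Metric.mem_cthickening_of_dist_le _ (f z) ε _ (Set.mem_image_of_mem f hzK) ?_
        rw [dist_eq_norm, add_sub_cancel_left, hVdef, norm_smul, norm_smul, norm_smul,
          Real.norm_eq_abs, Real.norm_of_nonneg hδ.le]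
        have h1 : ‖ρ z‖ * (δ * ‖v‖) ≤ C * (δ * ‖v‖) :=
          mul_le_mul_of_nonneg_right (hC z) (by positivity)
        have h2 : C * (δ * ‖v‖) ≤ δ * (1 + C * ‖v‖) := by nlinarith
        have h3 : δ * (1 + C * ‖v‖) = ε := div_mul_cancel₀ _ hden.ne'
        calc |s| * (‖ρ z‖ * (δ * ‖v‖)) ≤ 1 * (‖ρ z‖ * (δ * ‖v‖)) :=
              mul_le_mul_of_nonneg_right hs (by positivity)
          _ ≤ ε := by linarith
      · have : V z = 0 := image_eq_zero_of_notMem_tsupport fun h => hzK (hsupp h)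
        simpa [this] using hfU hz
    have hd := hcrit V K hVs hK hρU hsupp hmap
    -- The sine has derivative 1 at 0 and values in `[-1, 1]`, so the family stays in `Ω` for every
    -- real time.
    set fv : ℝ × Eucl m → F := fun p => f p.2 + Real.sin p.1 • V p.2 with hfvdef
    have hfv : ContDiffOn ℝ ∞ fv (Set.univ ×ˢ U) :=
      (hf.comp contDiffOn_snd fun p hp => hp.2).add
        ((Real.contDiff_sin.comp contDiff_fst).smul (hVs.comp contDiff_snd)).contDiffOn
    have hfvm : Set.MapsTo fv (Set.univ ×ˢ U) Ω := fun p hp =>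
      hmap p.2 hp.2 _ (Real.abs_sin_le_one _)
    have hS : IsOpen ((Set.univ : Set ℝ) ×ˢ U) := isOpen_univ.prod hg.isOpen
    have hA : ContDiffOn ℝ ∞ (fun p : ℝ × Eucl m => density g p.2 * gradPair g h
        (fun z => fv (p.1, z)) (tensionC g h fun z => fv (p.1, z))
        (tensionC g h fun z => fv (p.1, z)) p.2) (Set.univ ×ˢ U) :=
      (hg.smooth_density.comp contDiffOn_snd fun p hp => hp.2).mul
        (smooth_gradPair_slice hg hh hfv hfvm)
    obtain ⟨hi, hd2⟩ := hasDerivAt_setIntegral_slice (ν := volume) hg.isOpen hK hρU hA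
    have hzero := hd2.unique hd
    have hf0 : (fun z => fv (0, z)) = f := by funext z; simp [hfvdef]
    have hmem : ∀ z ∈ U, ((0 : ℝ), z) ∈ (Set.univ : Set ℝ) ×ˢ U := fun z hz => ⟨trivial, hz⟩
    have hV0 : ∀ z ∈ U, fderiv ℝ fv (0, z) (1, 0) = V z := by
      intro z hz
      have h1 := hasDerivAt_slice ((hfv.contDiffAt
        (hS.mem_nhds (hmem z hz))).differentiableAt (by simp))
      have h2 : HasDerivAt (fun s => fv (s, z)) (V z) 0 := by
        exact (((Real.hasDerivAt_sin 0).smul_const (V z)).const_add (f z)).congr_deriv (by simp)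
      exact h1.unique h2
    have hfd : ∀ z ∈ K, fderiv ℝ (fun p : ℝ × Eucl m => density g p.2 * gradPair g h
        (fun z => fv (p.1, z)) (tensionC g h fun z => fv (p.1, z))
        (tensionC g h fun z => fv (p.1, z)) p.2) (0, z) (1, 0)
        = density g z * (2 * gradPair g h f
          (fun y => -lapC g h f V y + riemTrace g h f V y) (tensionC g h f) z
          + riemPair g h f V (tensionC g h f) z) := by
      intro z hzK
      have hz := hρU hzK
      have h1 := hasDerivAt_slice ((hA.contDiffAt
        (hS.mem_nhds (hmem z hz))).differentiableAt (by simp))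
      have h2 := (hasDerivAt_gradPair_tensionC hg hh hfv hfvm 0 hz).const_mul (density g z)
      have h3 := h1.unique h2
      rw [h3, hf0]
      have hVe : ∀ z ∈ U, (fun z => fderiv ℝ fv (0, z) (1, 0)) =ᶠ[𝓝 z] V := fun z hz => by
        filter_upwards [hg.isOpen.mem_nhds hz] with w hw using hV0 w hw
      have hlap : ∀ z ∈ U, lapC g h f (fun z => fderiv ℝ fv (0, z) (1, 0)) z = lapC g h f V z := by
        intro z hz
        have e1 : cov (chris h) f (fun z => fderiv ℝ fv (0, z) (1, 0)) =ᶠ[𝓝 z]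
            cov (chris h) f V := by
          filter_upwards [hg.isOpen.mem_nhds hz] with w hw using cov_congr (hVe w hw)
        have e2 : covForm (chris g) (chris h) f
            (cov (chris h) f (fun z => fderiv ℝ fv (0, z) (1, 0))) z
            = covForm (chris g) (chris h) f (cov (chris h) f V) z := by
          ext a b
          rw [covForm_apply, covForm_apply, e1.fderiv_eq, cov_congr (hVe z hz)]
        rw [lapC, lapC, e2]
      have hrt : ∀ z ∈ U, riemTrace g h f (fun z => fderiv ℝ fv (0, z) (1, 0)) z
          = riemTrace g h f V z := by
        intro z hz
        simp only [riemTrace, hV0 z hz]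
      have hZ : (fun y => -lapC g h f (fun z => fderiv ℝ fv (0, z) (1, 0)) y
          + riemTrace g h f (fun z => fderiv ℝ fv (0, z) (1, 0)) y) =ᶠ[𝓝 z]
          fun y => -lapC g h f V y + riemTrace g h f V y := by
        filter_upwards [hg.isOpen.mem_nhds hz] with w hw
        rw [hlap w hw, hrt w hw]
      simp only [gradPair, riemPair, cov_congr hZ, hV0 z hz]
    have hmeas : MeasurableSet K := hK.isClosed.measurableSet
    rw [setIntegral_congr_fun hmeas hfd] at hzero
    have hi' : IntegrableOn (fun z => density g z * (2 * gradPair g h f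
          (fun y => -lapC g h f V y + riemTrace g h f V y) (tensionC g h f) z
          + riemPair g h f V (tensionC g h f) z)) K :=
      IntegrableOn.congr_fun hi hfd hmeas
    rw [setIntegral_first_variation hg hh hf hfU hVs hK hρU hsupp hi'] at hzero
    -- Tensoriality extracts `δ` and `ρ`, leaving an integral against an arbitrary test function.
    have h5 : ∀ z, density g z * eulerForm g h f z (V z)
        = δ * (ρ z • (density g z * eulerForm g h f z v)) := by
      intro z
      rw [hVdef, eulerForm_smul, eulerForm_smul, smul_eq_mul]
      ring
    simp only [h5] at hzero
    rw [integral_const_mul, setIntegral_eq_integral_of_forall_compl_eq_zero] at hzero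
    · exact (mul_eq_zero.1 hzero).resolve_left hδ.ne'
    · intro z hz
      rw [image_eq_zero_of_notMem_tsupport hz, zero_smul]
  have hcont : ContinuousOn (fun y => density g y * eulerForm g h f y v) U :=
    hg.smooth_density.continuousOn.mul hsm.continuousOn
  -- The fundamental lemma of the calculus of variations gives vanishing almost everywhere;
  -- continuity then gives it everywhere on `U`.
  have hae := hg.isOpen.ae_eq_zero_of_integral_contDiff_smul_eq_zero (μ := volume)
    (hcont.locallyIntegrableOn hg.isOpen.measurableSet) main
  have h1 : (fun y => density g y * eulerForm g h f y v) =ᵐ[volume.restrict U] fun _ => 0 :=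
    (ae_restrict_iff' hg.isOpen.measurableSet).2 hae
  have h2 := Measure.eqOn_open_of_ae_eq h1 hg.isOpen hcont continuousOn_const hy
  exact (mul_eq_zero.1 h2).resolve_left (hg.density_pos hy).ne'

end EulerLagrange

/-! ### Charts and coordinates -/

section Charts

variable {n : ℕ} {N : Type*} [TopologicalSpace N] [ChartedSpace (EuclideanSpace ℝ (Fin n)) N]

lemma mem_chart_of_mem_target {p : N} {y : Eucl n} (hy : y ∈ (extChartAt (𝓡 n) p).target) :
    (extChartAt (𝓡 n) p).symm y ∈ (chartAt (EuclideanSpace ℝ (Fin n)) p).source := by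
  simpa only [extChartAt_source] using (extChartAt (𝓡 n) p).map_target hy

variable [IsManifold (𝓡 n) ∞ N]

lemma mem_baseSet {p q : N} (hq : q ∈ (chartAt (EuclideanSpace ℝ (Fin n)) p).source) :
    q ∈ (trivializationAt (EuclideanSpace ℝ (Fin n)) (TangentSpace (𝓡 n)) p).baseSet := by
  simpa using hq

lemma coords_constField {p q : N} (hq : q ∈ (chartAt (EuclideanSpace ℝ (Fin n)) p).source)
    (v : Eucl n) : coords p q (constField p v q) = v :=
  (trivializationAt (EuclideanSpace ℝ (Fin n)) (TangentSpace (𝓡 n)) p).continuousLinearMapAt_symmL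
    (mem_baseSet hq) v

lemma constField_coords {p q : N} (hq : q ∈ (chartAt (EuclideanSpace ℝ (Fin n)) p).source)
    (u : TangentSpace (𝓡 n) q) : constField p (coords p q u) q = u :=
  (trivializationAt (EuclideanSpace ℝ (Fin n)) (TangentSpace (𝓡 n)) p).symmL_continuousLinearMapAt
    (mem_baseSet hq) u

lemma coords_injective {p q : N} (hq : q ∈ (chartAt (EuclideanSpace ℝ (Fin n)) p).source)
    {u v : TangentSpace (𝓡 n) q} (h : coords p q u = coords p q v) : u = v := by
  rw [← constField_coords hq u, h, constField_coords hq]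

/-- The change of coordinates between two preferred charts. -/
def trans (p p' : N) (y : Eucl n) : Eucl n := extChartAt (𝓡 n) p' ((extChartAt (𝓡 n) p).symm y)

lemma contDiffAt_trans {p p' : N} {y : Eucl n} (hy : y ∈ (extChartAt (𝓡 n) p).target)
    (hq : (extChartAt (𝓡 n) p).symm y ∈ (chartAt (EuclideanSpace ℝ (Fin n)) p').source) :
    ContDiffAt ℝ ∞ (trans p p') y := by
  have h := contDiffWithinAt_ext_coord_change (I := 𝓡 n) (n := ∞) p' p (y := y) (by
    rw [PartialEquiv.trans_source, PartialEquiv.symm_source]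
    exact ⟨hy, by simpa only [Set.mem_preimage, extChartAt_source] using hq⟩)
  simpa only [ModelWithCorners.Boundaryless.range_eq_univ, contDiffWithinAt_univ] using! h

/-- The differential of a change of coordinates. -/
lemma coords_constField_eq_fderiv {p p' q : N}
    (hq : q ∈ (chartAt (EuclideanSpace ℝ (Fin n)) p).source)
    (hq' : q ∈ (chartAt (EuclideanSpace ℝ (Fin n)) p').source) (v : Eucl n) :
    coords p' q (constField p v q) = fderiv ℝ (trans p p') (extChartAt (𝓡 n) p q) v := by
  have e1 : ∀ w : TangentSpace (𝓡 n) q, coords p' q w = tangentCoordChange (𝓡 n) q p' q w :=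
    fun w => congrArg (fun L => L w)
      (TangentBundle.continuousLinearMapAt_trivializationAt_eq_core (I := 𝓡 n) hq')
  have e2 : constField p v q = tangentCoordChange (𝓡 n) p q q v := by
    exact congrArg (fun L => L v) (TangentBundle.symmL_trivializationAt_eq_core (I := 𝓡 n) hq)
  rw [e1, e2]
  -- Both trivializations are expressed through the chart at `q`, which drops out by the cocycle
  -- identity.
  have e3 := tangentCoordChange_comp (I := 𝓡 n) (w := p) (x := q) (y := p') (z := q) (v := v) (by
    simp only [extChartAt_source]
    exact ⟨⟨hq, mem_chart_source _ q⟩, hq'⟩)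
  refine e3.trans ?_
  rw [tangentCoordChange_def, ModelWithCorners.Boundaryless.range_eq_univ, fderivWithin_univ]
  rfl

lemma contMDiffOn_constField (p : N) (v : Eucl n) :
    ContMDiffOn (𝓡 n) ((𝓡 n).prod 𝓘(ℝ, EuclideanSpace ℝ (Fin n))) ∞
      (fun q => (⟨q, constField p v q⟩ : TangentBundle (𝓡 n) N))
      (chartAt (EuclideanSpace ℝ (Fin n)) p).source := by
  have h := (trivializationAt (EuclideanSpace ℝ (Fin n)) (TangentSpace (𝓡 n))
    p).contMDiffOn_section_baseSet_iff (IB := 𝓡 n) (n := ∞) (s := constField p v)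
  rw [TangentBundle.trivializationAt_baseSet] at h
  rw [h]
  refine (contMDiffOn_const (c := v)).congr fun q hq => ?_
  have := coords_constField hq v
  rw [coords, Trivialization.continuousLinearMapAt_apply, Trivialization.linearMapAt_apply] at this
  simpa [mem_baseSet hq, hq] using this

variable [RiemannianBundle (fun p : N => TangentSpace (𝓡 n) p)]

/-- The metric in the preferred chart at `p`, as a continuous bilinear map. -/
def metricC (p : N) (y : Eucl n) : Eucl n →L[ℝ] Eucl n →L[ℝ] ℝ :=
  ((RiemannianBundle.g (E := fun p : N => TangentSpace (𝓡 n) p)).inner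
      ((extChartAt (𝓡 n) p).symm y)).bilinearComp
    ((trivializationAt (EuclideanSpace ℝ (Fin n)) (TangentSpace (𝓡 n)) p).symmL ℝ
      ((extChartAt (𝓡 n) p).symm y))
    ((trivializationAt (EuclideanSpace ℝ (Fin n)) (TangentSpace (𝓡 n)) p).symmL ℝ
      ((extChartAt (𝓡 n) p).symm y))

lemma metricC_apply (p : N) (y u v : Eucl n) : metricC p y u v = chartMetric p y u v := rfl

lemma metricC_extChartAt {p q : N} (hq : q ∈ (chartAt (EuclideanSpace ℝ (Fin n)) p).source)
    (u v : Eucl n) :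
    metricC p (extChartAt (𝓡 n) p q) u v = inner ℝ (constField p u q) (constField p v q) := by
  rw [metricC_apply, chartMetric,
    (extChartAt (𝓡 n) p).left_inv (by simpa only [extChartAt_source] using hq)]

lemma inner_eq_metricC {p q : N} (hq : q ∈ (chartAt (EuclideanSpace ℝ (Fin n)) p).source)
    (u v : TangentSpace (𝓡 n) q) :
    inner ℝ u v = metricC p (extChartAt (𝓡 n) p q) (coords p q u) (coords p q v) := by
  rw [metricC_extChartAt hq, constField_coords hq, constField_coords hq]

lemma isMetricOn_metricC [IsContMDiffRiemannianBundle (𝓡 n) ∞ (EuclideanSpace ℝ (Fin n))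
      (fun p : N => TangentSpace (𝓡 n) p)] (p : N) :
    IsMetricOn (metricC p) (extChartAt (𝓡 n) p).target where
  isOpen := isOpen_extChartAt_target p
  smooth := by
    rw [contDiffOn_clm_apply]
    intro u
    rw [contDiffOn_clm_apply]
    intro v
    rw [← contMDiffOn_iff_contDiffOn]
    have h1 := (contMDiffOn_constField p u).inner_bundle (contMDiffOn_constField p v)
    exact h1.comp (contMDiffOn_extChartAt_symm p) fun y hy => mem_chart_of_mem_target hy
  symm y hy a b := by
    rw [metricC_apply, metricC_apply, chartMetric, chartMetric, real_inner_comm]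
  pos y hy a ha := by
    rw [metricC_apply, chartMetric, real_inner_self_pos]
    intro h0
    apply ha
    have := coords_constField (mem_chart_of_mem_target hy) a
    rw [h0, map_zero] at this
    exact this.symm

end Charts

/-! ### Transformation of the metric and of the Christoffel symbols -/

section Overlaps

variable {n : ℕ} {N : Type*} [TopologicalSpace N] [ChartedSpace (EuclideanSpace ℝ (Fin n)) N]

lemma extChartAt_symm_apply {p q : N} (hq : q ∈ (chartAt (EuclideanSpace ℝ (Fin n)) p).source) :
    (extChartAt (𝓡 n) p).symm (extChartAt (𝓡 n) p q) = q :=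
  (extChartAt (𝓡 n) p).left_inv (by simpa only [extChartAt_source] using hq)

lemma extChartAt_mem_target {p q : N} (hq : q ∈ (chartAt (EuclideanSpace ℝ (Fin n)) p).source) :
    extChartAt (𝓡 n) p q ∈ (extChartAt (𝓡 n) p).target :=
  (extChartAt (𝓡 n) p).map_source (by simpa only [extChartAt_source] using hq)

lemma isOpen_chart_preimage (p : N) {s : Set N} (hs : IsOpen s) :
    IsOpen ((extChartAt (𝓡 n) p).target ∩ (extChartAt (𝓡 n) p).symm ⁻¹' s) :=
  (continuousOn_extChartAt_symm p).isOpen_inter_preimage (isOpen_extChartAt_target p) hs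

lemma trans_extChartAt {p q : N} (p' : N)
    (hq : q ∈ (chartAt (EuclideanSpace ℝ (Fin n)) p).source) :
    trans p p' (extChartAt (𝓡 n) p q) = extChartAt (𝓡 n) p' q := by
  rw [trans, extChartAt_symm_apply hq]

variable [IsManifold (𝓡 n) ∞ N]

lemma surjective_fderiv_trans {p p' q : N}
    (hq : q ∈ (chartAt (EuclideanSpace ℝ (Fin n)) p).source)
    (hq' : q ∈ (chartAt (EuclideanSpace ℝ (Fin n)) p').source) :
    Function.Surjective (fderiv ℝ (trans p p') (extChartAt (𝓡 n) p q)) := fun v =>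
  ⟨coords p q (constField p' v q), by
    rw [← coords_constField_eq_fderiv hq hq', constField_coords hq, coords_constField hq']⟩

lemma coords_eq_fderiv_trans {p p' q : N}
    (hq : q ∈ (chartAt (EuclideanSpace ℝ (Fin n)) p).source)
    (hq' : q ∈ (chartAt (EuclideanSpace ℝ (Fin n)) p').source) (u : TangentSpace (𝓡 n) q) :
    coords p' q u = fderiv ℝ (trans p p') (extChartAt (𝓡 n) p q) (coords p q u) := by
  rw [← coords_constField_eq_fderiv hq hq', constField_coords hq]

variable [RiemannianBundle (fun p : N => TangentSpace (𝓡 n) p)]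

lemma metricC_trans {p p' q : N}
    (hq : q ∈ (chartAt (EuclideanSpace ℝ (Fin n)) p).source)
    (hq' : q ∈ (chartAt (EuclideanSpace ℝ (Fin n)) p').source) (a b : Eucl n) :
    metricC p (extChartAt (𝓡 n) p q) a b = metricC p' (extChartAt (𝓡 n) p' q)
      (fderiv ℝ (trans p p') (extChartAt (𝓡 n) p q) a)
      (fderiv ℝ (trans p p') (extChartAt (𝓡 n) p q) b) := by
  rw [metricC_extChartAt hq, inner_eq_metricC hq', coords_constField_eq_fderiv hq hq',
    coords_constField_eq_fderiv hq hq']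

variable (n) in
/-- The coordinates of the orthonormal basis `frame`. -/
def frameBasis (p q : N) (hq : q ∈ (chartAt (EuclideanSpace ℝ (Fin n)) p).source) :
    Module.Basis (Fin (Module.finrank ℝ (TangentSpace (𝓡 n) q))) ℝ (Eucl n) :=
  (frame n q).toBasis.map (LinearEquiv.ofBijective (coords p q).toLinearMap
    ⟨fun _ _ h => coords_injective hq h, fun v => ⟨constField p v q, coords_constField hq v⟩⟩)

lemma frameBasis_apply {p q : N} (hq : q ∈ (chartAt (EuclideanSpace ℝ (Fin n)) p).source)
    (i : Fin (Module.finrank ℝ (TangentSpace (𝓡 n) q))) :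
    frameBasis n p q hq i = coords p q (frame n q i) := by
  simp only [frameBasis, Module.Basis.map_apply, OrthonormalBasis.coe_toBasis]
  rfl

variable [IsContMDiffRiemannianBundle (𝓡 n) ∞ (EuclideanSpace ℝ (Fin n))
      (fun p : N => TangentSpace (𝓡 n) p)]

lemma chris_metricC_trans {p p' q : N}
    (hq : q ∈ (chartAt (EuclideanSpace ℝ (Fin n)) p).source)
    (hq' : q ∈ (chartAt (EuclideanSpace ℝ (Fin n)) p').source) (a b : Eucl n) :
    fderiv ℝ (trans p p') (extChartAt (𝓡 n) p q)
        (chris (metricC p) (extChartAt (𝓡 n) p q) a b)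
      = chris (metricC p') (extChartAt (𝓡 n) p' q)
          (fderiv ℝ (trans p p') (extChartAt (𝓡 n) p q) a)
          (fderiv ℝ (trans p p') (extChartAt (𝓡 n) p q) b)
        + fderiv ℝ (fderiv ℝ (trans p p')) (extChartAt (𝓡 n) p q) a b := by
  have hy := extChartAt_mem_target hq
  have h1 := (isMetricOn_metricC p).chris_transform (isMetricOn_metricC p') (ψ := trans p p') hy
    (by rw [trans_extChartAt p' hq]; exact extChartAt_mem_target hq')
    ((contDiffAt_trans hy (by rwa [extChartAt_symm_apply hq])).of_le (by norm_cast))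
    (surjective_fderiv_trans hq hq') ?_ a b
  · rwa [trans_extChartAt p' hq] at h1
  · have ho := isOpen_chart_preimage (n := n) p
      (chartAt (EuclideanSpace ℝ (Fin n)) p').open_source
    filter_upwards [ho.mem_nhds ⟨hy, by rwa [Set.mem_preimage, extChartAt_symm_apply hq]⟩] with z hz
    intro a b
    have h2 := metricC_trans (mem_chart_of_mem_target hz.1) hz.2 a b
    rwa [(extChartAt (𝓡 n) p).right_inv hz.1] at h2

lemma fderiv_chartMetric {p : N} {y : Eucl n} (hy : y ∈ (extChartAt (𝓡 n) p).target)
    (a b c : Eucl n) :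
    fderiv ℝ (fun y => chartMetric p y a b) y c = fderiv ℝ (metricC p) y c a b := by
  have hd := (isMetricOn_metricC p).diffAt hy
  rw [← fderiv_clm_apply_const hd a c, ← fderiv_clm_apply_const (hd.clm_apply
    (differentiableAt_const a)) b c]
  rfl

/-- The frame in the definition of `christoffel` is irrelevant: its coefficients are Koszul
expressions, hence the components of the coordinate Christoffel vector in that frame. -/
lemma christoffel_eq (p : N) (u v : TangentSpace (𝓡 n) p) :
    christoffel p u v = constField p
      (chris (metricC p) (extChartAt (𝓡 n) p p) (coords p p u) (coords p p v)) p := by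
  have hp := mem_chart_source (EuclideanSpace ℝ (Fin n)) p
  have hy := extChartAt_mem_target hp
  set w := constField p
      (chris (metricC p) (extChartAt (𝓡 n) p p) (coords p p u) (coords p p v)) p with hw
  rw [← (frame n p).sum_repr' w, christoffel]
  refine Finset.sum_congr rfl fun k _ => ?_
  congr 1
  rw [real_inner_comm, inner_eq_metricC hp, hw, coords_constField hp,
    (isMetricOn_metricC p).apply_chris hy, fderiv_chartMetric hy, fderiv_chartMetric hy,
    fderiv_chartMetric hy]

lemma coords_christoffel (p : N) (u v : TangentSpace (𝓡 n) p) :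
    coords p p (christoffel p u v)
      = chris (metricC p) (extChartAt (𝓡 n) p p) (coords p p u) (coords p p v) := by
  rw [christoffel_eq, coords_constField (mem_chart_source _ p)]

/-- This translates every sum over `frame` in the definitions into a coordinate trace, valid in any
chart around `q` and not only in the one at `q`. -/
lemma mtrace_metricC {F : Type*} [NormedAddCommGroup F] [NormedSpace ℝ F] {p q : N}
    (hq : q ∈ (chartAt (EuclideanSpace ℝ (Fin n)) p).source) (B : Eucl n →L[ℝ] Eucl n →L[ℝ] F) :
    mtrace (metricC p) (extChartAt (𝓡 n) p q) B
      = ∑ i, B (coords p q (frame n q i)) (coords p q (frame n q i)) := by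
  rw [(isMetricOn_metricC p).mtrace_eq_sum (extChartAt_mem_target hq) (frameBasis n p q hq)]
  · simp only [frameBasis_apply]
  · intro i
    rw [frameBasis_apply, ← inner_eq_metricC hq, real_inner_self_eq_norm_sq,
      (frame n q).orthonormal.1 i, one_pow]
  · intro i k hik
    rw [frameBasis_apply, frameBasis_apply, ← inner_eq_metricC hq]
    exact (frame n q).orthonormal.2 hik

end Overlaps

/-! ### Maps and sections in coordinates -/

section Representatives

variable {m n : ℕ}
  {M : Type*} [TopologicalSpace M] [ChartedSpace (EuclideanSpace ℝ (Fin m)) M]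
  {N : Type*} [TopologicalSpace N] [ChartedSpace (EuclideanSpace ℝ (Fin n)) N]

/-- The map `φ` in the preferred charts at `x₀` and `p₀`. -/
def crep (x₀ : M) (p₀ : N) (φ : M → N) (y : Eucl m) : Eucl n :=
  extChartAt (𝓡 n) p₀ (φ ((extChartAt (𝓡 m) x₀).symm y))

/-- The domain of the representative `crep x₀ p₀ φ`. -/
def cdom (x₀ : M) (p₀ : N) (φ : M → N) : Set (Eucl m) :=
  (extChartAt (𝓡 m) x₀).target ∩
    (extChartAt (𝓡 m) x₀).symm ⁻¹' (φ ⁻¹' (chartAt (EuclideanSpace ℝ (Fin n)) p₀).source)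

variable {φ : M → N} {x₀ q : M} {p₀ : N}

lemma isOpen_cdom (hφ : Continuous φ) (x₀ : M) (p₀ : N) : IsOpen (cdom (m := m) (n := n) x₀ p₀ φ) :=
  isOpen_chart_preimage x₀ ((chartAt (EuclideanSpace ℝ (Fin n)) p₀).open_source.preimage hφ)

lemma mem_cdom (hq : q ∈ (chartAt (EuclideanSpace ℝ (Fin m)) x₀).source)
    (hp : φ q ∈ (chartAt (EuclideanSpace ℝ (Fin n)) p₀).source) :
    extChartAt (𝓡 m) x₀ q ∈ cdom (n := n) x₀ p₀ φ :=
  ⟨extChartAt_mem_target hq, by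
    rwa [Set.mem_preimage, Set.mem_preimage, extChartAt_symm_apply hq]⟩

/-- A point of `cdom` is the image of a point of the two chart domains. -/
lemma exists_of_mem_cdom {y : Eucl m} (hy : y ∈ cdom (m := m) (n := n) x₀ p₀ φ) :
    ∃ q, q ∈ (chartAt (EuclideanSpace ℝ (Fin m)) x₀).source ∧
      φ q ∈ (chartAt (EuclideanSpace ℝ (Fin n)) p₀).source ∧ extChartAt (𝓡 m) x₀ q = y :=
  ⟨_, mem_chart_of_mem_target hy.1, hy.2, (extChartAt (𝓡 m) x₀).right_inv hy.1⟩

lemma crep_extChartAt (p₀ : N) (hq : q ∈ (chartAt (EuclideanSpace ℝ (Fin m)) x₀).source) :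
    crep x₀ p₀ φ (extChartAt (𝓡 m) x₀ q) = extChartAt (𝓡 n) p₀ (φ q) := by
  rw [crep, extChartAt_symm_apply hq]

lemma mapsTo_crep (x₀ : M) (p₀ : N) (φ : M → N) :
    Set.MapsTo (crep x₀ p₀ φ) (cdom (m := m) (n := n) x₀ p₀ φ) (extChartAt (𝓡 n) p₀).target :=
  fun _ hy => extChartAt_mem_target hy.2

lemma crep_id_eventuallyEq (hq : q ∈ (chartAt (EuclideanSpace ℝ (Fin m)) x₀).source) :
    crep x₀ x₀ (fun q : M => q) =ᶠ[𝓝 (extChartAt (𝓡 m) x₀ q)] fun y => y := by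
  filter_upwards [(isOpen_extChartAt_target (I := 𝓡 m) x₀).mem_nhds (extChartAt_mem_target hq)]
    with z hz
  exact (extChartAt (𝓡 m) x₀).right_inv hz

variable [IsManifold (𝓡 n) ∞ N]

/-- The section `V` of the pullback bundle in the preferred charts at `x₀` and `p₀`. -/
def srep (x₀ : M) (p₀ : N) (φ : M → N) (V : ∀ x : M, TangentSpace (𝓡 n) (φ x)) (y : Eucl m) :
    Eucl n :=
  coords p₀ (φ ((extChartAt (𝓡 m) x₀).symm y)) (V ((extChartAt (𝓡 m) x₀).symm y))

lemma srep_extChartAt (p₀ : N) (V : ∀ x : M, TangentSpace (𝓡 n) (φ x))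
    (hq : q ∈ (chartAt (EuclideanSpace ℝ (Fin m)) x₀).source) :
    srep x₀ p₀ φ V (extChartAt (𝓡 m) x₀ q) = coords p₀ (φ q) (V q) := by
  rw [srep, extChartAt_symm_apply hq]

variable [IsManifold (𝓡 m) ∞ M]

lemma smooth_crep (hφ : ContMDiff (𝓡 m) (𝓡 n) ∞ φ) (x₀ : M) (p₀ : N) :
    ContDiffOn ℝ ∞ (crep (m := m) (n := n) x₀ p₀ φ) (cdom (m := m) (n := n) x₀ p₀ φ) := by
  rw [← contMDiffOn_iff_contDiffOn]
  have h1 : ContMDiffOn 𝓘(ℝ, Eucl m) (𝓡 n) ∞ (fun y => φ ((extChartAt (𝓡 m) x₀).symm y))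
      (cdom (m := m) (n := n) x₀ p₀ φ) :=
    hφ.comp_contMDiffOn ((contMDiffOn_extChartAt_symm x₀).mono Set.inter_subset_left)
  exact (contMDiffOn_extChartAt (I := 𝓡 n) (n := ∞) (x := p₀)).comp h1 fun y hy => hy.2

lemma contDiffAt_crep (hφ : ContMDiff (𝓡 m) (𝓡 n) ∞ φ)
    (hq : q ∈ (chartAt (EuclideanSpace ℝ (Fin m)) x₀).source)
    (hp : φ q ∈ (chartAt (EuclideanSpace ℝ (Fin n)) p₀).source) :
    ContDiffAt ℝ ∞ (crep (m := m) (n := n) x₀ p₀ φ) (extChartAt (𝓡 m) x₀ q) :=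
  (smooth_crep hφ x₀ p₀).contDiffAt
    ((isOpen_cdom (n := n) hφ.continuous x₀ p₀).mem_nhds (mem_cdom hq hp))

/-- The differential of `φ` in coordinates. -/
lemma coords_mfderiv (hφ : ContMDiff (𝓡 m) (𝓡 n) ∞ φ)
    (hq : q ∈ (chartAt (EuclideanSpace ℝ (Fin m)) x₀).source)
    (hp : φ q ∈ (chartAt (EuclideanSpace ℝ (Fin n)) p₀).source) (u : TangentSpace (𝓡 m) q) :
    coords p₀ (φ q) (mfderiv (𝓡 m) (𝓡 n) φ q u)
      = fderiv ℝ (crep x₀ p₀ φ) (extChartAt (𝓡 m) x₀ q) (coords x₀ q u) := by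
  have hy := extChartAt_mem_target hq
  have e1 : ∀ w : TangentSpace (𝓡 n) (φ q), coords p₀ (φ q) w
      = mfderiv (𝓡 n) 𝓘(ℝ, Eucl n) (extChartAt (𝓡 n) p₀) (φ q) w :=
    fun w => congrArg (fun L => L w)
      (TangentBundle.continuousLinearMapAt_trivializationAt (I := 𝓡 n) hp)
  have e2 : ∀ w : TangentSpace (𝓡 m) q, coords x₀ q w
      = mfderiv (𝓡 m) 𝓘(ℝ, Eucl m) (extChartAt (𝓡 m) x₀) q w :=
    fun w => congrArg (fun L => L w)
      (TangentBundle.continuousLinearMapAt_trivializationAt (I := 𝓡 m) hq)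
  have d1 : MDifferentiableAt (𝓡 m) 𝓘(ℝ, Eucl m) (extChartAt (𝓡 m) x₀) q :=
    ((contMDiffOn_extChartAt (n := ∞) (x := x₀)).contMDiffAt
      ((chartAt (EuclideanSpace ℝ (Fin m)) x₀).open_source.mem_nhds hq)).mdifferentiableAt (by simp)
  have d2 : MDifferentiableAt (𝓡 m) (𝓡 n) φ q := (hφ _).mdifferentiableAt (by simp)
  have d3 : MDifferentiableAt (𝓡 n) 𝓘(ℝ, Eucl n) (extChartAt (𝓡 n) p₀) (φ q) :=
    ((contMDiffOn_extChartAt (n := ∞) (x := p₀)).contMDiffAt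
      ((chartAt (EuclideanSpace ℝ (Fin n)) p₀).open_source.mem_nhds hp)).mdifferentiableAt (by simp)
  have d4 : MDifferentiableAt 𝓘(ℝ, Eucl m) 𝓘(ℝ, Eucl n) (crep (n := n) x₀ p₀ φ)
      (extChartAt (𝓡 m) x₀ q) := by
    rw [mdifferentiableAt_iff_differentiableAt]
    exact (contDiffAt_crep hφ hq hp).differentiableAt (by simp)
  have e3 : (fun z => extChartAt (𝓡 n) p₀ (φ z))
      =ᶠ[𝓝 q] fun z => (crep x₀ p₀ φ (extChartAt (𝓡 m) x₀ z) : Eucl n) := by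
    filter_upwards [(chartAt (EuclideanSpace ℝ (Fin m)) x₀).open_source.mem_nhds hq] with z hz
    exact (crep_extChartAt p₀ hz).symm
  have e4 := mfderiv_comp_apply q d3 d2 u
  have e5 := mfderiv_comp_apply q d4 d1 u
  rw [e1, e2, ← mfderiv_eq_fderiv]
  have e6 : (mfderiv (𝓡 m) 𝓘(ℝ, Eucl n) (extChartAt (𝓡 n) p₀ ∘ φ) q : Eucl m →L[ℝ] Eucl n)
      = mfderiv (𝓡 m) 𝓘(ℝ, Eucl n) (crep (n := n) x₀ p₀ φ ∘ extChartAt (𝓡 m) x₀) q :=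
    Filter.EventuallyEq.mfderiv_eq (I := 𝓡 m) (I' := 𝓘(ℝ, Eucl n)) e3
  exact e4.symm.trans ((congrArg (fun L : Eucl m →L[ℝ] Eucl n => L u) e6).trans e5)

section Connection

variable [RiemannianBundle (fun p : N => TangentSpace (𝓡 n) p)]
  [IsContMDiffRiemannianBundle (𝓡 n) ∞ (EuclideanSpace ℝ (Fin n))
      (fun p : N => TangentSpace (𝓡 n) p)]

/-- The induced connection in arbitrary preferred charts. -/
lemma coords_covDeriv (hφ : ContMDiff (𝓡 m) (𝓡 n) ∞ φ)
    (hq : q ∈ (chartAt (EuclideanSpace ℝ (Fin m)) x₀).source)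
    (hp : φ q ∈ (chartAt (EuclideanSpace ℝ (Fin n)) p₀).source)
    {V : ∀ x : M, TangentSpace (𝓡 n) (φ x)}
    (hV : DifferentiableAt ℝ (srep x₀ p₀ φ V) (extChartAt (𝓡 m) x₀ q))
    (u : TangentSpace (𝓡 m) q) :
    coords p₀ (φ q) (covDeriv m n φ V q u)
      = cov (chris (metricC p₀)) (crep x₀ p₀ φ) (srep x₀ p₀ φ V) (extChartAt (𝓡 m) x₀ q)
          (coords x₀ q u) := by
  have hqq := mem_chart_source (EuclideanSpace ℝ (Fin m)) q
  have hpp := mem_chart_source (EuclideanSpace ℝ (Fin n)) (φ q)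
  set y := extChartAt (𝓡 m) x₀ q with hy
  set z := extChartAt (𝓡 m) q q with hz
  set a := coords x₀ q u with ha
  have hfy : crep x₀ p₀ φ y = extChartAt (𝓡 n) p₀ (φ q) := crep_extChartAt p₀ hq
  have hχz : trans q x₀ z = y := trans_extChartAt x₀ hqq
  -- the differentials of the changes of coordinates
  have hχ : HasFDerivAt (trans q x₀) (fderiv ℝ (trans q x₀) z) z :=
    ((contDiffAt_trans (extChartAt_mem_target hqq)
      (by rwa [extChartAt_symm_apply hqq])).differentiableAt (by simp)).hasFDerivAt
  have hψ : ContDiffAt ℝ ∞ (trans p₀ (φ q)) (extChartAt (𝓡 n) p₀ (φ q)) :=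
    contDiffAt_trans (extChartAt_mem_target hp) (by rwa [extChartAt_symm_apply hp])
  have hψ' : HasFDerivAt (fderiv ℝ (trans (n := n) p₀ (φ q)))
      (fderiv ℝ (fderiv ℝ (trans p₀ (φ q))) (crep x₀ p₀ φ y)) (crep x₀ p₀ φ y) := by
    rw [hfy]
    exact ((hψ.fderiv_right (m := ∞) (by simp)).differentiableAt (by simp)).hasFDerivAt
  have hf : HasFDerivAt (crep (n := n) x₀ p₀ φ) (fderiv ℝ (crep x₀ p₀ φ) y) y :=
    ((contDiffAt_crep hφ hq hp).differentiableAt (by simp)).hasFDerivAt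
  -- The definition of `covDeriv` uses the charts centred at `q` and `φ q`. There the section is the
  -- representative in the charts at `x₀` and `p₀` composed with the differential of the transition
  -- map, whose derivative adds a Hessian term.
  have hs : srep q (φ q) φ V =ᶠ[𝓝 z] fun w => fderiv ℝ (trans p₀ (φ q))
      (crep x₀ p₀ φ (trans q x₀ w)) (srep x₀ p₀ φ V (trans q x₀ w)) := by
    have ho := isOpen_chart_preimage (n := m) q
      (((chartAt (EuclideanSpace ℝ (Fin m)) x₀).open_source.inter
        ((chartAt (EuclideanSpace ℝ (Fin n)) p₀).open_source.preimage hφ.continuous)).inter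
        ((chartAt (EuclideanSpace ℝ (Fin n)) (φ q)).open_source.preimage hφ.continuous))
    filter_upwards [ho.mem_nhds ⟨extChartAt_mem_target hqq, by
      rw [Set.mem_preimage, extChartAt_symm_apply hqq]; exact ⟨⟨hq, hp⟩, hpp⟩⟩] with w hw
    obtain ⟨hw1, ⟨hw2, hw3⟩, hw4⟩ := hw
    rw [trans, crep_extChartAt p₀ hw2, srep_extChartAt p₀ V hw2, srep]
    exact coords_eq_fderiv_trans hw3 hw4 _
  have hD := by
    rw [← hχz] at hψ' hf hV
    exact ((hψ'.comp z (hf.comp z hχ)).clm_apply (hV.hasFDerivAt.comp z hχ)).congr_of_eventuallyEq hs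
  have hau : fderiv ℝ (trans q x₀) z (coords q q u) = a := (coords_eq_fderiv_trans hqq hq u).symm
  suffices h : covDeriv m n φ V q u = constField p₀ (cov (chris (metricC p₀)) (crep x₀ p₀ φ)
      (srep x₀ p₀ φ V) y a) (φ q) by rw [h, coords_constField hp]
  apply coords_injective hpp
  -- The inhomogeneous term in the transformation of the Christoffel symbols cancels that Hessian.
  have hΓ := chris_metricC_trans hp hpp (fderiv ℝ (crep x₀ p₀ φ) y a) (srep x₀ p₀ φ V y)
  rw [covDeriv, map_add, coords_constField hpp, coords_christoffel,
    coords_constField_eq_fderiv hp hpp, cov_apply, coords_eq_fderiv_trans hp hpp (V q),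
    coords_eq_fderiv_trans hp hpp (mfderiv (𝓡 m) (𝓡 n) φ q u), coords_mfderiv hφ hq hp,
    ← srep_extChartAt p₀ V hq, map_add, ← ha, ← hy, hfy, hΓ]
  have hD' := congrArg (fun L => L (coords q q u)) hD.fderiv
  simp only [add_apply, ContinuousLinearMap.comp_apply,
    ContinuousLinearMap.flip_apply, Function.comp_apply, hau, hχz, hfy] at hD'
  refine (congrArg (· + _) hD').trans ?_
  abel

end Connection

end Representatives

/-! ### Tension field, rough Laplacian and curvature in coordinates -/

section FieldCalculus

variable {F : Type*} [NormedAddCommGroup F] [NormedSpace ℝ F]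
  {X : Type*} [NormedAddCommGroup X] [NormedSpace ℝ X]

/-- By the Leibniz rule the derivative of `Y` cancels, so only the value of `Y` at `x` matters. This
makes second covariant derivatives independent of how a vector is extended to a field. -/
lemma cov_apply_field {Γg : X → X →L[ℝ] X →L[ℝ] X} {Γ : F → F →L[ℝ] F →L[ℝ] F} {f : X → F}
    {ϖ : X → X →L[ℝ] F} {Y : X → X} {x : X} (hϖ : DifferentiableAt ℝ ϖ x)
    (hY : DifferentiableAt ℝ Y x) (a : X) :
    cov Γ f (fun z => ϖ z (Y z)) x a - ϖ x (fderiv ℝ Y x a + Γg x a (Y x))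
      = covForm Γg Γ f ϖ x a (Y x) := by
  rw [cov_apply, covForm_apply, (hϖ.hasFDerivAt.clm_apply hY.hasFDerivAt).fderiv]
  simp only [add_apply, ContinuousLinearMap.comp_apply, ContinuousLinearMap.flip_apply, map_add]
  abel

lemma cov_congr_map {Γ : F → F →L[ℝ] F →L[ℝ] F} {f f' V : X → F} {x : X} (hf : f =ᶠ[𝓝 x] f') :
    cov Γ f V x = cov Γ f' V x := by
  rw [cov, cov, hf.eq_of_nhds, hf.fderiv_eq]

end FieldCalculus

section LeviCivita

variable {n : ℕ} {N : Type*} [TopologicalSpace N] [ChartedSpace (EuclideanSpace ℝ (Fin n)) N]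
  [IsManifold (𝓡 n) ∞ N]

lemma contDiffAt_srep_constField {p p' q : N}
    (hq : q ∈ (chartAt (EuclideanSpace ℝ (Fin n)) p).source)
    (hq' : q ∈ (chartAt (EuclideanSpace ℝ (Fin n)) p').source) (w : Eucl n) :
    ContDiffAt ℝ ∞ (srep p p (fun q : N => q) (constField p' w)) (extChartAt (𝓡 n) p q) := by
  have h1 : ContDiffAt ℝ ∞ (trans p p') (extChartAt (𝓡 n) p q) :=
    contDiffAt_trans (extChartAt_mem_target hq) (by rwa [extChartAt_symm_apply hq])
  have h2 : ContDiffAt ℝ ∞ (fderiv ℝ (trans p' p)) (trans p p' (extChartAt (𝓡 n) p q)) := by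
    rw [trans_extChartAt p' hq]
    exact (contDiffAt_trans (extChartAt_mem_target hq')
      (by rwa [extChartAt_symm_apply hq'])).fderiv_right (by simp)
  refine ((h2.comp _ h1).clm_apply (contDiffAt_const (c := w))).congr_of_eventuallyEq ?_
  have ho := isOpen_chart_preimage (n := n) p (chartAt (EuclideanSpace ℝ (Fin n)) p').open_source
  filter_upwards [ho.mem_nhds ⟨extChartAt_mem_target hq, by
    rwa [Set.mem_preimage, extChartAt_symm_apply hq]⟩] with z hz
  exact coords_constField_eq_fderiv hz.2 (mem_chart_of_mem_target hz.1) w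

variable [RiemannianBundle (fun p : N => TangentSpace (𝓡 n) p)]
  [IsContMDiffRiemannianBundle (𝓡 n) ∞ (EuclideanSpace ℝ (Fin n))
      (fun p : N => TangentSpace (𝓡 n) p)]

lemma coords_leviCivita {p q : N} (hq : q ∈ (chartAt (EuclideanSpace ℝ (Fin n)) p).source)
    {Y : ∀ p : N, TangentSpace (𝓡 n) p}
    (hY : DifferentiableAt ℝ (srep p p (fun q : N => q) Y) (extChartAt (𝓡 n) p q))
    (u : TangentSpace (𝓡 n) q) :
    coords p q (leviCivita n Y q u)
      = cov (chris (metricC p)) (fun y => y) (srep p p (fun q : N => q) Y) (extChartAt (𝓡 n) p q)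
          (coords p q u) := by
  rw [leviCivita, ← cov_congr_map (crep_id_eventuallyEq hq)]
  exact coords_covDeriv contMDiff_id hq hq hY u

/-- The extended fields have constant representatives in the chart at `p`, so `cov_comm` along the
identity map applies. -/
lemma curvature_eq (p : N) (u v w : TangentSpace (𝓡 n) p) :
    coords p p (curvature n p u v w) = riem (chris (metricC p)) (extChartAt (𝓡 n) p p)
      (coords p p u) (coords p p v) (coords p p w) := by
  have hp := mem_chart_source (EuclideanSpace ℝ (Fin n)) p
  set y := extChartAt (𝓡 n) p p with hy
  have ht := (isOpen_extChartAt_target (I := 𝓡 n) p).mem_nhds (extChartAt_mem_target hp)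
  have hW : ∀ z ∈ (extChartAt (𝓡 n) p).target,
      srep p p (fun q : N => q) (extendVec p w) =ᶠ[𝓝 z] fun _ => coords p p w := by
    intro z hz
    filter_upwards [(isOpen_extChartAt_target (I := 𝓡 n) p).mem_nhds hz] with z' hz'
    exact coords_constField (mem_chart_of_mem_target hz') _
  have key : ∀ a : TangentSpace (𝓡 n) p,
      srep p p (fun q : N => q) (fun q => leviCivita n (extendVec p w) q (extendVec p a q))
        =ᶠ[𝓝 y] fun z => cov (chris (metricC p)) (fun y => y) (fun _ => coords p p w) z
          (coords p p a) := by
    intro a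
    filter_upwards [ht] with z hz
    have hz' := mem_chart_of_mem_target hz
    have hr := (extChartAt (𝓡 n) p).right_inv hz
    have := coords_leviCivita hz' (Y := extendVec p w)
      (by rw [hr]; exact (differentiableAt_const _).congr_of_eventuallyEq (hW z hz))
      (extendVec p a _)
    rw [srep, this, hr, cov_congr (hW z hz), extendVec, coords_constField hz']
  have hcov : ∀ a : Eucl n, DifferentiableAt ℝ (fun z => cov (chris (metricC p)) (fun y => y)
      (fun _ => coords p p w) z a) y := by
    intro a
    have hs := smooth_cov (isMetricOn_metricC p).smooth_chris (isMetricOn_metricC p).isOpen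
      contDiffOn_id (fun _ h => h) (contDiffOn_const (c := coords p p w))
    exact ((hs.contDiffAt ht).differentiableAt (by simp)).clm_apply (differentiableAt_const a)
  have h2 : ∀ a b : TangentSpace (𝓡 n) p,
      coords p p (leviCivita n (fun q => leviCivita n (extendVec p w) q (extendVec p a q)) p b)
        = cov (chris (metricC p)) (fun y => y) (fun z => cov (chris (metricC p)) (fun y => y)
          (fun _ => coords p p w) z (coords p p a)) y (coords p p b) := by
    intro a b
    rw [coords_leviCivita hp ((hcov _).congr_of_eventuallyEq (key a)), cov_congr (key a)]
  have h3 := cov_comm (Γ := chris (metricC p)) (f := fun y => y) (V := fun _ => coords p p w)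
    ((isMetricOn_metricC p).diffAt_chris (extChartAt_mem_target hp)) contDiffAt_id
    contDiffAt_const (coords p p u) (coords p p v)
  rw [← hy, fderiv_fun_id] at h3
  rw [curvature, map_sub, h2, h2, h3]
  simp only [ContinuousLinearMap.id_apply, add_sub_cancel_left]

end LeviCivita

section Sections

variable {m n : ℕ}
  {M : Type*} [TopologicalSpace M] [ChartedSpace (EuclideanSpace ℝ (Fin m)) M]
  [IsManifold (𝓡 m) ∞ M]
  {N : Type*} [TopologicalSpace N] [ChartedSpace (EuclideanSpace ℝ (Fin n)) N]
  [IsManifold (𝓡 n) ∞ N]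

variable (m n) in
/-- A section of the pullback bundle is smooth if all its representatives are. -/
def SmoothSec (φ : M → N) (V : ∀ x : M, TangentSpace (𝓡 n) (φ x)) : Prop :=
  ∀ (x₀ : M) (p₀ : N), ContDiffOn ℝ ∞ (srep x₀ p₀ φ V) (cdom (m := m) (n := n) x₀ p₀ φ)

variable {φ : M → N} {x₀ q : M} {p₀ : N} {V Z : ∀ x : M, TangentSpace (𝓡 n) (φ x)}

lemma SmoothSec.contDiffAt (hφ : ContMDiff (𝓡 m) (𝓡 n) ∞ φ) (hV : SmoothSec m n φ V)
    (hq : q ∈ (chartAt (EuclideanSpace ℝ (Fin m)) x₀).source)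
    (hp : φ q ∈ (chartAt (EuclideanSpace ℝ (Fin n)) p₀).source) :
    ContDiffAt ℝ ∞ (srep x₀ p₀ φ V) (extChartAt (𝓡 m) x₀ q) :=
  (hV x₀ p₀).contDiffAt ((isOpen_cdom (n := n) hφ.continuous x₀ p₀).mem_nhds (mem_cdom hq hp))

variable [RiemannianBundle (fun p : N => TangentSpace (𝓡 n) p)]

lemma inner_eq_srep (hq : q ∈ (chartAt (EuclideanSpace ℝ (Fin m)) x₀).source)
    (hp : φ q ∈ (chartAt (EuclideanSpace ℝ (Fin n)) p₀).source) :
    inner ℝ (V q) (Z q) = metricC p₀ (crep x₀ p₀ φ (extChartAt (𝓡 m) x₀ q))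
      (srep x₀ p₀ φ V (extChartAt (𝓡 m) x₀ q)) (srep x₀ p₀ φ Z (extChartAt (𝓡 m) x₀ q)) := by
  rw [inner_eq_metricC hp, crep_extChartAt p₀ hq, srep_extChartAt p₀ _ hq, srep_extChartAt p₀ _ hq]

variable [IsContMDiffRiemannianBundle (𝓡 n) ∞ (EuclideanSpace ℝ (Fin n))
      (fun p : N => TangentSpace (𝓡 n) p)]

variable [RiemannianBundle (fun x : M => TangentSpace (𝓡 m) x)]
  [IsContMDiffRiemannianBundle (𝓡 m) ∞ (EuclideanSpace ℝ (Fin m))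
      (fun x : M => TangentSpace (𝓡 m) x)]

/-- The second covariant derivative in coordinates, for a form `ϖ` with values in the pullback
bundle. -/
lemma coords_covDeriv_sub (hφ : ContMDiff (𝓡 m) (𝓡 n) ∞ φ)
    (hq : q ∈ (chartAt (EuclideanSpace ℝ (Fin m)) x₀).source)
    (hp : φ q ∈ (chartAt (EuclideanSpace ℝ (Fin n)) p₀).source)
    {L : ∀ x : M, TangentSpace (𝓡 m) x → TangentSpace (𝓡 n) (φ x)}
    {ϖ : Eucl m → Eucl m →L[ℝ] Eucl n}
    (hϖ : DifferentiableAt ℝ ϖ (extChartAt (𝓡 m) x₀ q))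
    (hL : ∀ q, q ∈ (chartAt (EuclideanSpace ℝ (Fin m)) x₀).source →
      φ q ∈ (chartAt (EuclideanSpace ℝ (Fin n)) p₀).source → ∀ u,
      coords p₀ (φ q) (L q u) = ϖ (extChartAt (𝓡 m) x₀ q) (coords x₀ q u))
    (u v : TangentSpace (𝓡 m) q) :
    coords p₀ (φ q) (covDeriv m n φ (fun q' => L q' (extendVec q v q')) q u
        - L q (leviCivita m (extendVec q v) q u))
      = covForm (chris (metricC x₀)) (chris (metricC p₀)) (crep x₀ p₀ φ) ϖ
          (extChartAt (𝓡 m) x₀ q) (coords x₀ q u) (coords x₀ q v) := by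
  have hqq := mem_chart_source (EuclideanSpace ℝ (Fin m)) q
  -- The extension of `v` is constant in the chart at `q`, not in the one at `x₀`; its varying
  -- representative is dealt with by `cov_apply_field`.
  have hY : DifferentiableAt ℝ (srep x₀ x₀ (fun q : M => q) (extendVec q v))
      (extChartAt (𝓡 m) x₀ q) :=
    (contDiffAt_srep_constField hq hqq _).differentiableAt (by simp)
  have hs : srep x₀ p₀ φ (fun q' => L q' (extendVec q v q')) =ᶠ[𝓝 (extChartAt (𝓡 m) x₀ q)]
      fun z => ϖ z (srep x₀ x₀ (fun q : M => q) (extendVec q v) z) := by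
    filter_upwards [(isOpen_cdom (n := n) hφ.continuous x₀ p₀).mem_nhds (mem_cdom hq hp)] with z hz
    obtain ⟨q', h1, h2, rfl⟩ := exists_of_mem_cdom hz
    rw [srep_extChartAt p₀ _ h1, hL q' h1 h2]
    exact congrArg _ (srep_extChartAt (φ := fun q : M => q) x₀ _ h1).symm
  have hv : srep x₀ x₀ (fun q : M => q) (extendVec q v) (extChartAt (𝓡 m) x₀ q) = coords x₀ q v := by
    rw [srep_extChartAt (φ := fun q : M => q) x₀ _ hq, extendVec, constField_coords hqq]
  rw [map_sub, coords_covDeriv hφ hq hp ((hϖ.clm_apply hY).congr_of_eventuallyEq hs),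
    cov_congr hs, hL q hq hp, coords_leviCivita hq hY, cov_apply _ _ (srep x₀ x₀ _ _), ← hv,
    ← cov_apply_field hϖ hY]
  simp

lemma coords_tension (hφ : ContMDiff (𝓡 m) (𝓡 n) ∞ φ)
    (hq : q ∈ (chartAt (EuclideanSpace ℝ (Fin m)) x₀).source)
    (hp : φ q ∈ (chartAt (EuclideanSpace ℝ (Fin n)) p₀).source) :
    coords p₀ (φ q) (tension m n φ q)
      = tensionC (metricC x₀) (metricC p₀) (crep x₀ p₀ φ) (extChartAt (𝓡 m) x₀ q) := by
  rw [tension, map_sum, tensionC, mtrace_metricC hq]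
  refine Finset.sum_congr rfl fun i _ => ?_
  exact coords_covDeriv_sub hφ hq hp
    (((contDiffAt_crep hφ hq hp).fderiv_right (m := ∞) (by simp)).differentiableAt (by simp))
    (L := fun x u => mfderiv (𝓡 m) (𝓡 n) φ x u) (fun q h1 h2 u => coords_mfderiv hφ h1 h2 u) _ _

lemma smooth_cov_srep (hφ : ContMDiff (𝓡 m) (𝓡 n) ∞ φ) (hV : SmoothSec m n φ V) (x₀ : M) (p₀ : N) :
    ContDiffOn ℝ ∞ (cov (chris (metricC p₀)) (crep x₀ p₀ φ) (srep x₀ p₀ φ V))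
      (cdom (m := m) (n := n) x₀ p₀ φ) :=
  smooth_cov (isMetricOn_metricC p₀).smooth_chris (isOpen_cdom hφ.continuous x₀ p₀)
    (smooth_crep hφ x₀ p₀) (mapsTo_crep x₀ p₀ φ) (hV x₀ p₀)

lemma coords_roughLaplacian (hφ : ContMDiff (𝓡 m) (𝓡 n) ∞ φ) (hV : SmoothSec m n φ V)
    (hq : q ∈ (chartAt (EuclideanSpace ℝ (Fin m)) x₀).source)
    (hp : φ q ∈ (chartAt (EuclideanSpace ℝ (Fin n)) p₀).source) :
    coords p₀ (φ q) (roughLaplacian m n φ V q)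
      = lapC (metricC x₀) (metricC p₀) (crep x₀ p₀ φ) (srep x₀ p₀ φ V)
          (extChartAt (𝓡 m) x₀ q) := by
  rw [roughLaplacian, map_neg, map_sum, lapC, mtrace_metricC hq]
  refine congrArg Neg.neg (Finset.sum_congr rfl fun i _ => ?_)
  exact coords_covDeriv_sub hφ hq hp
    (((smooth_cov_srep hφ hV x₀ p₀).contDiffAt ((isOpen_cdom hφ.continuous x₀ p₀).mem_nhds
      (mem_cdom hq hp))).differentiableAt (by simp))
    (L := fun x u => covDeriv m n φ V x u)
    (fun q h1 h2 u => coords_covDeriv hφ h1 h2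
      ((hV.contDiffAt hφ h1 h2).differentiableAt (by simp)) u) _ _

lemma isMetricOn_cdom (hφ : Continuous φ) (x₀ : M) (p₀ : N) :
    IsMetricOn (metricC x₀) (cdom (m := m) (n := n) x₀ p₀ φ) :=
  (isMetricOn_metricC x₀).mono (isOpen_cdom hφ x₀ p₀) Set.inter_subset_left

lemma smoothSec_tension (hφ : ContMDiff (𝓡 m) (𝓡 n) ∞ φ) : SmoothSec m n φ (tension m n φ) := by
  intro x₀ p₀
  refine (smooth_tensionC (isMetricOn_cdom hφ.continuous x₀ p₀) (isMetricOn_metricC p₀)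
    (smooth_crep hφ x₀ p₀) (mapsTo_crep x₀ p₀ φ)).congr fun y hy => ?_
  obtain ⟨q, h1, h2, rfl⟩ := exists_of_mem_cdom hy
  rw [srep_extChartAt p₀ _ h1, coords_tension hφ h1 h2]

lemma SmoothSec.roughLaplacian (hφ : ContMDiff (𝓡 m) (𝓡 n) ∞ φ) (hV : SmoothSec m n φ V) :
    SmoothSec m n φ (roughLaplacian m n φ V) := by
  intro x₀ p₀
  refine (smooth_lapC (isMetricOn_cdom hφ.continuous x₀ p₀) (isMetricOn_metricC p₀)
    (smooth_crep hφ x₀ p₀) (mapsTo_crep x₀ p₀ φ) (hV x₀ p₀)).congr fun y hy => ?_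
  obtain ⟨q, h1, h2, rfl⟩ := exists_of_mem_cdom hy
  rw [srep_extChartAt p₀ _ h1, coords_roughLaplacian hφ hV h1 h2]

variable (m n) in
/-- The pairing `∑ i, ⟨∇̄_eᵢ V, ∇̄_eᵢ Z⟩`. -/
def gradInner (φ : M → N) (V Z : ∀ x : M, TangentSpace (𝓡 n) (φ x)) (q : M) : ℝ :=
  ∑ i, inner ℝ (covDeriv m n φ V q (frame m q i)) (covDeriv m n φ Z q (frame m q i))

lemma gradInner_self (φ : M → N) (V : ∀ x : M, TangentSpace (𝓡 n) (φ x)) (q : M) :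
    gradInner m n φ V V q = normSqCovDeriv m n φ V q := by
  simp only [gradInner, normSqCovDeriv, real_inner_self_eq_norm_sq]

lemma gradInner_eq (hφ : ContMDiff (𝓡 m) (𝓡 n) ∞ φ) (hV : SmoothSec m n φ V)
    (hZ : SmoothSec m n φ Z)
    (hq : q ∈ (chartAt (EuclideanSpace ℝ (Fin m)) x₀).source)
    (hp : φ q ∈ (chartAt (EuclideanSpace ℝ (Fin n)) p₀).source) :
    gradInner m n φ V Z q = gradPair (metricC x₀) (metricC p₀) (crep x₀ p₀ φ) (srep x₀ p₀ φ V)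
      (srep x₀ p₀ φ Z) (extChartAt (𝓡 m) x₀ q) := by
  have h := mtrace_metricC hq ((metricC p₀ (crep x₀ p₀ φ (extChartAt (𝓡 m) x₀ q))).bilinearComp
    (cov (chris (metricC p₀)) (crep x₀ p₀ φ) (srep x₀ p₀ φ V) (extChartAt (𝓡 m) x₀ q))
    (cov (chris (metricC p₀)) (crep x₀ p₀ φ) (srep x₀ p₀ φ Z) (extChartAt (𝓡 m) x₀ q)))
  rw [gradInner]
  refine Eq.trans (Finset.sum_congr rfl fun i _ => ?_) h.symm
  rw [inner_eq_metricC hp, ← crep_extChartAt p₀ hq,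
    coords_covDeriv hφ hq hp ((hV.contDiffAt hφ hq hp).differentiableAt (by simp)),
    coords_covDeriv hφ hq hp ((hZ.contDiffAt hφ hq hp).differentiableAt (by simp))]
  rfl

end Sections

/-! ### The Riemannian volume in charts -/

section Volume

/-- With `J` the matrix of `L`, the Gram matrices are related by `Jᵀ G' J`; taking square roots of
determinants gives the Jacobian factor. -/
lemma density_comp {m : ℕ} {g g' : Eucl m → Eucl m →L[ℝ] Eucl m →L[ℝ] ℝ} {y y' : Eucl m}
    {L : Eucl m →L[ℝ] Eucl m} (h : ∀ a b, g y a b = g' y' (L a) (L b)) :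
    density g y = |L.det| * density g' y' := by
  set J : Matrix (Fin m) (Fin m) ℝ := Matrix.of fun i j => L (EuclideanSpace.single j 1) i with hJ
  have hdet : L.det = J.det := by
    rw [ContinuousLinearMap.det, ← LinearMap.det_toMatrix (EuclideanSpace.basisFun (Fin m) ℝ).toBasis]
    congr 1
  have hgram : gram g y = J.transpose * gram g' y' * J := by
    ext i j
    have hL : ∀ k, L (EuclideanSpace.single k 1) = ∑ l, J l k • EuclideanSpace.single l (1 : ℝ) :=
      fun k => (sum_proj_smul_single _).symm
    simp only [gram, Matrix.of_apply, Matrix.mul_apply, Matrix.transpose_apply, h, hL, map_sum,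
      map_smul, sum_apply, smul_apply, smul_eq_mul,
      Finset.sum_mul, Finset.mul_sum]
    refine (Finset.sum_congr rfl fun k _ => Finset.sum_congr rfl fun l _ => ?_)
    ring
  rw [density, density, hgram, Matrix.det_mul, Matrix.det_mul, Matrix.det_transpose, hdet,
    show J.det * (gram g' y').det * J.det = J.det ^ 2 * (gram g' y').det by ring,
    Real.sqrt_mul (sq_nonneg _), Real.sqrt_sq_eq_abs]

variable {n : ℕ} {N : Type*} [TopologicalSpace N] [ChartedSpace (EuclideanSpace ℝ (Fin n)) N]
  [IsManifold (𝓡 n) ∞ N] [RiemannianBundle (fun p : N => TangentSpace (𝓡 n) p)]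
  [MeasurableSpace N] [BorelSpace N]

lemma chartVolume_eq (p : N) : chartVolume (n := n) p
    = ((volume.restrict (extChartAt (𝓡 n) p).target).withDensity
        fun y => ENNReal.ofReal (density (metricC p) y)).map (extChartAt (𝓡 n) p).symm := rfl

lemma aemeasurable_extChartAt_symm (p : N) : AEMeasurable (extChartAt (𝓡 n) p).symm
    ((volume.restrict (extChartAt (𝓡 n) p).target).withDensity
        fun y => ENNReal.ofReal (density (metricC p) y)) :=
  ((continuousOn_extChartAt_symm p).aemeasurable
    (isOpen_extChartAt_target p).measurableSet).mono_ac (withDensity_absolutelyContinuous _ _)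

lemma measurableSet_chart_preimage (p : N) {A : Set N} (hA : MeasurableSet A) :
    MeasurableSet ((extChartAt (𝓡 n) p).target ∩ (extChartAt (𝓡 n) p).symm ⁻¹' A) := by
  classical
  -- The inverse chart is continuous only on its target; extended by a constant it becomes a
  -- measurable map on the whole space.
  have h := (continuousOn_extChartAt_symm (I := 𝓡 n) p).measurable_piecewise
    (g := fun _ => p) continuousOn_const (isOpen_extChartAt_target p).measurableSet
  have h' := (isOpen_extChartAt_target (I := 𝓡 n) p).measurableSet.inter (h hA)
  convert h' using 1
  ext y
  simp only [Set.mem_inter_iff, Set.mem_preimage]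
  refine and_congr_right fun hy => ?_
  rw [Set.piecewise_eq_of_mem _ _ _ hy]

lemma chartVolume_apply (p : N) {A : Set N} (hA : MeasurableSet A) :
    chartVolume (n := n) p A
      = ∫⁻ y in (extChartAt (𝓡 n) p).target ∩ (extChartAt (𝓡 n) p).symm ⁻¹' A,
          ENNReal.ofReal (density (metricC p) y) := by
  have hT := (isOpen_extChartAt_target (I := 𝓡 n) p).measurableSet
  rw [chartVolume_eq, Measure.map_apply_of_aemeasurable (aemeasurable_extChartAt_symm p) hA]
  have h0 : ((volume.restrict (extChartAt (𝓡 n) p).target).withDensity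
        fun y => ENNReal.ofReal (density (metricC p) y)) (extChartAt (𝓡 n) p).targetᶜ = 0 := by
    refine withDensity_absolutelyContinuous _ _ ?_
    rw [Measure.restrict_apply hT.compl, Set.compl_inter_self, measure_empty]
  have h1 := measurableSet_chart_preimage (n := n) p hA
  rw [← measure_inter_conull h0, Set.inter_comm, withDensity_apply _ h1, Measure.restrict_restrict h1,
    Set.inter_assoc, Set.inter_comm _ (extChartAt (𝓡 n) p).target, ← Set.inter_assoc, Set.inter_self]

lemma chartVolume_inter_source (p : N) {A : Set N} (hA : MeasurableSet A) :
    chartVolume (n := n) p A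
      = chartVolume (n := n) p (A ∩ (chartAt (EuclideanSpace ℝ (Fin n)) p).source) := by
  rw [chartVolume_apply p hA, chartVolume_apply p
    (hA.inter (chartAt (EuclideanSpace ℝ (Fin n)) p).open_source.measurableSet)]
  congr 2
  ext y
  simp only [Set.mem_inter_iff, Set.mem_preimage]
  exact and_congr_right fun hy => (and_iff_left (mem_chart_of_mem_target hy)).symm

/-- The volumes of two chart domains agree on the overlap. -/
lemma chartVolume_congr (p p' : N) {A : Set N} (hA : MeasurableSet A)
    (h : A ⊆ (chartAt (EuclideanSpace ℝ (Fin n)) p).source)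
    (h' : A ⊆ (chartAt (EuclideanSpace ℝ (Fin n)) p').source) :
    chartVolume (n := n) p A = chartVolume (n := n) p' A := by
  rw [chartVolume_apply p hA, chartVolume_apply p' hA]
  set S := (extChartAt (𝓡 n) p).target ∩ (extChartAt (𝓡 n) p).symm ⁻¹' A with hS
  have himg : (extChartAt (𝓡 n) p').target ∩ (extChartAt (𝓡 n) p').symm ⁻¹' A
      = trans p p' '' S := by
    ext y
    constructor
    · rintro ⟨h1, h2⟩
      refine ⟨extChartAt (𝓡 n) p ((extChartAt (𝓡 n) p').symm y), ⟨extChartAt_mem_target (h h2), ?_⟩, ?_⟩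
      · rwa [Set.mem_preimage, extChartAt_symm_apply (h h2)]
      · rw [trans_extChartAt p' (h h2), (extChartAt (𝓡 n) p').right_inv h1]
    · rintro ⟨z, ⟨h1, h2⟩, rfl⟩
      refine ⟨extChartAt_mem_target (h' h2), ?_⟩
      rwa [Set.mem_preimage, trans, extChartAt_symm_apply (h' h2)]
  have hinj : Set.InjOn (trans p p') S := by
    rintro y ⟨h1, h2⟩ z ⟨h3, h4⟩ hyz
    have := congrArg (extChartAt (𝓡 n) p').symm hyz
    rw [trans, trans, extChartAt_symm_apply (h' h2), extChartAt_symm_apply (h' h4)] at this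
    rw [← (extChartAt (𝓡 n) p).right_inv h1, this, (extChartAt (𝓡 n) p).right_inv h3]
  -- Change of variables along the transition map; its Jacobian is the ratio of the two densities.
  rw [himg, lintegral_image_eq_lintegral_abs_det_fderiv_mul volume
    (measurableSet_chart_preimage p hA) (fun y hy => ((contDiffAt_trans hy.1
      (h' hy.2)).differentiableAt (by simp)).hasFDerivAt.hasFDerivWithinAt) hinj]
  refine setLIntegral_congr_fun (measurableSet_chart_preimage p hA) fun y hy => ?_
  have hm := fun a b => metricC_trans (h hy.2) (h' hy.2) a b
  rw [(extChartAt (𝓡 n) p).right_inv hy.1] at hm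
  rw [density_comp hm, ENNReal.ofReal_mul (abs_nonneg _)]
  rfl

/-- A supremum of measures is not computed set by set. The measure equal to `chartVolume p` on the
source `S` and to the full volume off `S` dominates every `chartVolume p'`, hence the supremum, and
it has the required value on subsets of `S`. -/
lemma riemannianVolume_apply (p : N) {A : Set N} (hA : MeasurableSet A)
    (h : A ⊆ (chartAt (EuclideanSpace ℝ (Fin n)) p).source) :
    riemannianVolume n N A = chartVolume (n := n) p A := by
  set S := (chartAt (EuclideanSpace ℝ (Fin n)) p).source with hS
  have hSm : MeasurableSet S := (chartAt (EuclideanSpace ℝ (Fin n)) p).open_source.measurableSet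
  refine le_antisymm ?_ (le_iSup (fun p : N => chartVolume (n := n) p) p A)
  have hle : riemannianVolume n N
      ≤ (chartVolume (n := n) p).restrict S + (riemannianVolume n N).restrict Sᶜ := by
    refine iSup_le fun p' => Measure.le_iff.2 fun B hB => ?_
    rw [Measure.add_apply, Measure.restrict_apply hB, Measure.restrict_apply hB,
      ← measure_inter_add_sdiff B hSm]
    refine add_le_add ?_ (le_iSup (fun p : N => chartVolume (n := n) p) p' _)
    rw [chartVolume_inter_source p' (hB.inter hSm), chartVolume_congr p' p
      ((hB.inter hSm).inter (chartAt (EuclideanSpace ℝ (Fin n)) p').open_source.measurableSet)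
      Set.inter_subset_right (Set.inter_subset_left.trans Set.inter_subset_right)]
    exact measure_mono Set.inter_subset_left
  refine (hle A).trans ?_
  rw [Measure.add_apply, Measure.restrict_apply hA, Measure.restrict_apply hA,
    Set.inter_eq_left.2 h, ← Set.sdiff_eq, Set.sdiff_eq_empty.2 h, measure_empty, add_zero]

lemma riemannianVolume_restrict_source (p : N) :
    (riemannianVolume n N).restrict (chartAt (EuclideanSpace ℝ (Fin n)) p).source
      = chartVolume (n := n) p := by
  have hSm := (chartAt (EuclideanSpace ℝ (Fin n)) p).open_source.measurableSet
  ext A hA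
  rw [Measure.restrict_apply hA, riemannianVolume_apply p (hA.inter hSm) Set.inter_subset_right,
    ← chartVolume_inter_source p hA]

variable [IsContMDiffRiemannianBundle (𝓡 n) ∞ (EuclideanSpace ℝ (Fin n))
      (fun p : N => TangentSpace (𝓡 n) p)]

lemma aemeasurable_density (p : N) : AEMeasurable (density (metricC p))
    (volume.restrict (extChartAt (𝓡 n) p).target) :=
  (isMetricOn_metricC p).smooth_density.continuousOn.aemeasurable
    (isOpen_extChartAt_target p).measurableSet

lemma integral_chart (p : N) {u : N → ℝ} (hu : Measurable u)
    (h0 : ∀ q ∉ (chartAt (EuclideanSpace ℝ (Fin n)) p).source, u q = 0) :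
    ∫ q, u q ∂(riemannianVolume n N)
      = ∫ y in (extChartAt (𝓡 n) p).target,
          density (metricC p) y * u ((extChartAt (𝓡 n) p).symm y) := by
  rw [← setIntegral_eq_integral_of_forall_compl_eq_zero h0, riemannianVolume_restrict_source,
    chartVolume_eq, integral_map (aemeasurable_extChartAt_symm p) hu.aestronglyMeasurable,
    integral_withDensity_eq_integral_toReal_smul₀ (aemeasurable_density p).ennreal_ofReal
      (Filter.Eventually.of_forall fun _ => ENNReal.ofReal_lt_top)]
  refine setIntegral_congr_fun (isOpen_extChartAt_target p).measurableSet fun y hy => ?_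
  rw [ENNReal.toReal_ofReal ((isMetricOn_metricC p).density_pos hy).le, smul_eq_mul]

lemma setIntegral_chart (p : N) {u : N → ℝ} (hu : Measurable u) {A : Set N} (hA : MeasurableSet A)
    (h : A ⊆ (chartAt (EuclideanSpace ℝ (Fin n)) p).source) :
    ∫ q in A, u q ∂(riemannianVolume n N)
      = ∫ y in (extChartAt (𝓡 n) p).target ∩ (extChartAt (𝓡 n) p).symm ⁻¹' A,
          density (metricC p) y * u ((extChartAt (𝓡 n) p).symm y) := by
  have hS := measurableSet_chart_preimage (n := n) p hA
  rw [← integral_indicator hA, integral_chart p (hu.indicator hA)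
    (fun q hq => Set.indicator_of_notMem (fun h' => hq (h h')) _), ← integral_indicator hS,
    ← integral_indicator (isOpen_extChartAt_target p).measurableSet]
  congr 1
  ext y
  by_cases h1 : y ∈ (extChartAt (𝓡 n) p).target
  · by_cases h2 : (extChartAt (𝓡 n) p).symm y ∈ A
    · rw [Set.indicator_of_mem h1, Set.indicator_of_mem h2, Set.indicator_of_mem (Set.mem_inter h1 h2)]
    · rw [Set.indicator_of_mem h1, Set.indicator_of_notMem h2,
        Set.indicator_of_notMem fun h => h2 h.2, mul_zero]
  · rw [Set.indicator_of_notMem h1, Set.indicator_of_notMem fun h => h1 h.1]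

/-- This makes continuous functions with compact support integrable. -/
instance : IsLocallyFiniteMeasure (riemannianVolume n N) where
  finiteAtNhds x := by
    have hx := mem_chart_source (EuclideanSpace ℝ (Fin n)) x
    have hT := isOpen_extChartAt_target (I := 𝓡 n) x
    obtain ⟨r, hr, hball⟩ := Metric.nhds_basis_closedBall.mem_iff.1
      (hT.mem_nhds (extChartAt_mem_target hx))
    have hsub : Metric.ball (extChartAt (𝓡 n) x x) r ⊆ (extChartAt (𝓡 n) x).target :=
      Metric.ball_subset_closedBall.trans hball
    set A := (chartAt (EuclideanSpace ℝ (Fin n)) x).source ∩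
      extChartAt (𝓡 n) x ⁻¹' Metric.ball (extChartAt (𝓡 n) x x) r with hA
    have hAo : IsOpen A := by
      have := (continuousOn_extChartAt (I := 𝓡 n) x).isOpen_inter_preimage
        (isOpen_extChartAt_source x) (Metric.isOpen_ball (x := extChartAt (𝓡 n) x x) (ε := r))
      rwa [extChartAt_source] at this
    refine ⟨A, hAo.mem_nhds ⟨hx, Metric.mem_ball_self hr⟩, ?_⟩
    rw [riemannianVolume_apply x hAo.measurableSet Set.inter_subset_left,
      chartVolume_apply x hAo.measurableSet]
    have hc : ContinuousOn (density (metricC x)) (Metric.closedBall (extChartAt (𝓡 n) x x) r) :=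
      (isMetricOn_metricC x).smooth_density.continuousOn.mono hball
    have hi := (hc.integrableOn_compact (μ := volume) (isCompact_closedBall _ _)).lintegral_lt_top
    refine lt_of_le_of_lt (lintegral_mono_set ?_) hi
    rintro y ⟨h1, -, h3⟩
    rw [Set.mem_preimage, (extChartAt (𝓡 n) x).right_inv h1] at h3
    exact Metric.ball_subset_closedBall h3

/-- This upgrades almost everywhere vanishing of continuous functions to pointwise vanishing. -/
instance : (riemannianVolume n N).IsOpenPosMeasure where
  open_pos U hU hne := by
    obtain ⟨x, hxU⟩ := hne
    have hx := mem_chart_source (EuclideanSpace ℝ (Fin n)) x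
    have hSo := (chartAt (EuclideanSpace ℝ (Fin n)) x).open_source
    intro h0
    have h1 : riemannianVolume n N (U ∩ (chartAt (EuclideanSpace ℝ (Fin n)) x).source) = 0 :=
      measure_mono_null Set.inter_subset_left h0
    rw [riemannianVolume_apply x (hU.inter hSo).measurableSet Set.inter_subset_right,
      chartVolume_apply x (hU.inter hSo).measurableSet] at h1
    have ho := isOpen_chart_preimage (n := n) x (hU.inter hSo)
    rw [lintegral_eq_zero_iff' ((aemeasurable_density x).ennreal_ofReal.mono_measure
      (Measure.restrict_mono_set _ Set.inter_subset_left))] at h1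
    have h2 : ∀ᵐ y ∂(volume.restrict ((extChartAt (𝓡 n) x).target ∩
        (extChartAt (𝓡 n) x).symm ⁻¹' (U ∩ (chartAt (EuclideanSpace ℝ (Fin n)) x).source))),
        False := by
      filter_upwards [h1, ae_restrict_mem ho.measurableSet] with y hy hy'
      exact absurd (ENNReal.ofReal_eq_zero.1 hy)
        (not_le.2 ((isMetricOn_metricC x).density_pos hy'.1))
    rw [ae_iff] at h2
    simp only [not_false_eq_true, Set.ofPred_true, Measure.restrict_apply_univ] at h2
    exact (ho.measure_pos volume ⟨extChartAt (𝓡 n) x x, extChartAt_mem_target hx, by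
      rw [Set.mem_preimage, extChartAt_symm_apply hx]; exact ⟨hxU, hx⟩⟩).ne' h2

end Volume

/-! ### Isometric immersions in coordinates -/

section Isometry

variable {m : ℕ} {F : Type*} [NormedAddCommGroup F] [NormedSpace ℝ F] [FiniteDimensional ℝ F]
  {g : Eucl m → Eucl m →L[ℝ] Eucl m →L[ℝ] ℝ} {h : F → F →L[ℝ] F →L[ℝ] ℝ}
  {U : Set (Eucl m)} {Ω : Set F} {f : Eucl m → F}

/-- The second fundamental form of an isometric immersion takes its values in the normal bundle. -/
lemma covForm_fderiv_normal (hg : IsMetricOn g U) (hh : IsMetricOn h Ω) (hf : ContDiffOn ℝ ∞ f U)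
    (hfU : Set.MapsTo f U Ω) (hiso : ∀ y ∈ U, ∀ a b, g y a b = h (f y) (fderiv ℝ f y a) (fderiv ℝ f y b))
    {y : Eucl m} (hy : y ∈ U) (a b c : Eucl m) :
    h (f y) (covForm (chris g) (chris h) f (fderiv ℝ f) y a b) (fderiv ℝ f y c) = 0 := by
  have hfy := hf.contDiffAt (hg.isOpen.mem_nhds hy)
  have hdf : DifferentiableAt ℝ f y := hfy.differentiableAt (by simp)
  have hd2 : DifferentiableAt ℝ (fderiv ℝ f) y :=
    (hfy.fderiv_right (m := ∞) (by simp)).differentiableAt (by simp)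
  have hdc : ∀ b, DifferentiableAt ℝ (fun z => fderiv ℝ f z b) y :=
    fun b => hd2.clm_apply (differentiableAt_const b)
  set S : Eucl m → Eucl m → Eucl m → ℝ := fun a b c =>
    h (f y) (covForm (chris g) (chris h) f (fderiv ℝ f) y a b) (fderiv ℝ f y c) with hS
  have hSeq : ∀ a b c, S a b c = h (f y) (cov (chris h) f (fun z => fderiv ℝ f z b) y a)
      (fderiv ℝ f y c) - g y (chris g y a b) c := by
    intro a b c
    simp only [hS]
    rw [covForm_eq hd2, map_sub, sub_apply, hiso y hy]
  have hsymm : ∀ a b c, S a b c = S b a c := by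
    intro a b c
    rw [hSeq, hSeq, cov_fderiv_comm (fun a b => hh.chris_symm (hfU hy) a b)
      (hfy.of_le (by norm_cast)), hg.chris_symm hy]
  have hanti : ∀ a b c, S a b c = -S a c b := by
    intro a b c
    have e1 := hg.compat hy a b c
    have e2 := hh.fderiv_inner (hfU hy) hdf (hdc b) (hdc c) a
    have e3 : (fun z => h (f z) (fderiv ℝ f z b) (fderiv ℝ f z c)) =ᶠ[𝓝 y] fun z => g z b c := by
      filter_upwards [hg.isOpen.mem_nhds hy] with z hz using (hiso z hz b c).symm
    have hdg := hg.diffAt hy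
    rw [e3.fderiv_eq, fderiv_clm_apply_const (hdg.clm_apply (differentiableAt_const b)),
      fderiv_clm_apply_const hdg, e1] at e2
    rw [hSeq, hSeq, hh.symm _ (hfU hy) _ (fderiv ℝ f y b), hg.symm y hy _ b]
    linarith
  -- A trilinear form symmetric in the first two arguments and skew in the last two is zero;
  -- alternating the two rules six times returns it with the opposite sign.
  have := hanti a b c
  have := hsymm a c b
  have := hanti c a b
  have := hsymm c b a
  have := hanti b c a
  have := hsymm b a c
  change S a b c = 0
  linarith

lemma tensionC_normal (hg : IsMetricOn g U) (hh : IsMetricOn h Ω) (hf : ContDiffOn ℝ ∞ f U)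
    (hfU : Set.MapsTo f U Ω) (hiso : ∀ y ∈ U, ∀ a b, g y a b = h (f y) (fderiv ℝ f y a) (fderiv ℝ f y b))
    {y : Eucl m} (hy : y ∈ U) (c : Eucl m) :
    h (f y) (tensionC g h f y) (fderiv ℝ f y c) = 0 := by
  rw [tensionC, mtrace, map_sum, sum_apply]
  exact Finset.sum_eq_zero fun j _ => covForm_fderiv_normal hg hh hf hfU hiso hy _ _ c

/-- The tension field is normal; the identity comes from differentiating `⟨τ, df c⟩ = 0` along `a`.
-/
lemma cov_tensionC_tangent (hg : IsMetricOn g U) (hh : IsMetricOn h Ω) (hf : ContDiffOn ℝ ∞ f U)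
    (hfU : Set.MapsTo f U Ω) (hiso : ∀ y ∈ U, ∀ a b, g y a b = h (f y) (fderiv ℝ f y a) (fderiv ℝ f y b))
    {y : Eucl m} (hy : y ∈ U) (a c : Eucl m) :
    h (f y) (cov (chris h) f (tensionC g h f) y a) (fderiv ℝ f y c)
      = -h (f y) (tensionC g h f y) (covForm (chris g) (chris h) f (fderiv ℝ f) y a c) := by
  have hfy := hf.contDiffAt (hg.isOpen.mem_nhds hy)
  have hd2 : DifferentiableAt ℝ (fderiv ℝ f) y :=
    (hfy.fderiv_right (m := ∞) (by simp)).differentiableAt (by simp)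
  have hτ : DifferentiableAt ℝ (tensionC g h f) y :=
    ((smooth_tensionC hg hh hf hfU).contDiffAt (hg.isOpen.mem_nhds hy)).differentiableAt (by simp)
  have e1 := hh.fderiv_inner (hfU hy) (hfy.differentiableAt (by simp)) hτ
    (hd2.clm_apply (differentiableAt_const c)) a
  have e2 : (fun z => h (f z) (tensionC g h f z) (fderiv ℝ f z c)) =ᶠ[𝓝 y] fun _ => (0 : ℝ) := by
    filter_upwards [hg.isOpen.mem_nhds hy] with z hz using tensionC_normal hg hh hf hfU hiso hz c
  rw [e2.fderiv_eq] at e1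
  simp only [fderiv_fun_const, Pi.zero_apply, zero_apply] at e1
  rw [covForm_eq hd2, map_sub, tensionC_normal hg hh hf hfU hiso hy]
  linarith

/-- The trace of `cov_tensionC_tangent`. It is the reason why a parallel tension field of an
isometric immersion must vanish. -/
lemma mtrace_cov_tensionC (hg : IsMetricOn g U) (hh : IsMetricOn h Ω) (hf : ContDiffOn ℝ ∞ f U)
    (hfU : Set.MapsTo f U Ω) (hiso : ∀ y ∈ U, ∀ a b, g y a b = h (f y) (fderiv ℝ f y a) (fderiv ℝ f y b))
    {y : Eucl m} (hy : y ∈ U) :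
    mtrace g y ((h (f y)).bilinearComp (cov (chris h) f (tensionC g h f) y) (fderiv ℝ f y))
      = -h (f y) (tensionC g h f y) (tensionC g h f y) := by
  have e : h (f y) (tensionC g h f y) (tensionC g h f y) = ∑ j, h (f y) (tensionC g h f y)
      (covForm (chris g) (chris h) f (fderiv ℝ f) y (EuclideanSpace.single j 1) (dualVec g y j)) :=
    map_sum (h (f y) (tensionC g h f y)) (fun j => covForm (chris g) (chris h) f (fderiv ℝ f) y
      (EuclideanSpace.single j 1) (dualVec g y j)) Finset.univ
  rw [e, mtrace, ← Finset.sum_neg_distrib]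
  exact Finset.sum_congr rfl fun j _ => cov_tensionC_tangent hg hh hf hfU hiso hy _ _

/-- The Euler–Lagrange form of an isometric immersion at a point where the target has constant
curvature. -/
lemma eulerForm_of_riem (hg : IsMetricOn g U) (hh : IsMetricOn h Ω) (hf : ContDiffOn ℝ ∞ f U)
    (hfU : Set.MapsTo f U Ω) (hiso : ∀ y ∈ U, ∀ a b, g y a b = h (f y) (fderiv ℝ f y a) (fderiv ℝ f y b))
    {y : Eucl m} (hy : y ∈ U) {c : ℝ}
    (hc : ∀ a b w, riem (chris h) (f y) a b w = c • (h (f y) b w • a - h (f y) a w • b)) (v : F) :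
    eulerForm g h f y v
      = 2 * (-h (f y) (lapC g h f (lapC g h f (tensionC g h f)) y) v
        + c * (mtrace g y ((h (f y)).bilinearComp (fderiv ℝ f y) (fderiv ℝ f y))
            * h (f y) (lapC g h f (tensionC g h f) y) v
          - mtrace g y ((h (f y)).bilinearComp (fderiv ℝ f y)
              ((h (f y) v).smulRight (lapC g h f (tensionC g h f) y) ∘L fderiv ℝ f y)))
        + c * (h (f y) v (tensionC g h f y) * h (f y) (tensionC g h f y) (tensionC g h f y))) := by
  set τ := tensionC g h f y with hτ
  set W := lapC g h f (tensionC g h f) y with hW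
  have hs := hh.symm _ (hfU hy)
  have hn : ∀ a, h (f y) (fderiv ℝ f y a) τ = 0 := fun a => by
    rw [hs]; exact tensionC_normal hg hh hf hfU hiso hy a
  have h1 : h (f y) W (riemTrace g h f (fun _ => v) y)
      = c * (mtrace g y ((h (f y)).bilinearComp (fderiv ℝ f y) (fderiv ℝ f y)) * h (f y) W v
          - mtrace g y ((h (f y)).bilinearComp (fderiv ℝ f y)
              ((h (f y) v).smulRight W ∘L fderiv ℝ f y))) := by
    simp only [riemTrace, mtrace, map_sum, Finset.sum_mul, ← Finset.sum_sub_distrib, Finset.mul_sum]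
    refine Finset.sum_congr rfl fun j _ => ?_
    rw [hc]
    simp only [map_smul, map_sub, smul_eq_mul, ContinuousLinearMap.bilinearComp_apply,
      ContinuousLinearMap.comp_apply, ContinuousLinearMap.smulRight_apply]
    rw [hs W (fderiv ℝ f y (EuclideanSpace.single j 1))]
  -- Normality of `τ` leaves only `-c ⟨v, τ⟩ df eⱼ` of the curvature, so what remains is the trace
  -- of `⟨∇τ, df⟩`, which is `-|τ|²`.
  have h2 : riemPair g h f (fun _ => v) (tensionC g h f) y = 2 * (c * (h (f y) v τ * h (f y) τ τ)) := by
    have e1 := mtrace_cov_tensionC hg hh hf hfU hiso hy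
    have e2 : ∑ j, h (f y) (cov (chris h) f (tensionC g h f) y (dualVec g y j))
        (fderiv ℝ f y (EuclideanSpace.single j 1)) = -h (f y) τ τ := by
      rw [← e1, ← hg.mtrace_flip hy]
      rfl
    have e3 : ∑ j, h (f y) (cov (chris h) f (tensionC g h f) y (EuclideanSpace.single j 1))
        (fderiv ℝ f y (dualVec g y j)) = -h (f y) τ τ := e1
    have e4 : riemPair g h f (fun _ => v) (tensionC g h f) y
        = -(c * h (f y) v τ) * (∑ j, h (f y) (cov (chris h) f (tensionC g h f) y (dualVec g y j))
            (fderiv ℝ f y (EuclideanSpace.single j 1)))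
          - (c * h (f y) v τ) * ∑ j, h (f y) (cov (chris h) f (tensionC g h f) y
            (EuclideanSpace.single j 1)) (fderiv ℝ f y (dualVec g y j)) := by
      rw [riemPair, Finset.mul_sum, Finset.mul_sum, ← Finset.sum_sub_distrib]
      refine Finset.sum_congr rfl fun j _ => ?_
      rw [hc, hc, ← hτ, hn, hn]
      simp only [zero_smul, zero_sub, map_smul, map_neg, smul_apply, neg_apply, smul_eq_mul]
      rw [hs (fderiv ℝ f y (EuclideanSpace.single j 1))]
      ring
    rw [e4, e2, e3]
    ring
  rw [eulerForm, ← hW, h1, h2]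
  ring

end Isometry

/-! ### The Euler–Lagrange equation of triharmonic maps -/

section Smoothness

variable {m : ℕ} {F : Type*} [NormedAddCommGroup F] [NormedSpace ℝ F]
  {g : Eucl m → Eucl m →L[ℝ] Eucl m →L[ℝ] ℝ} {h : F → F →L[ℝ] F →L[ℝ] ℝ}

lemma smooth_gradPair [FiniteDimensional ℝ F] {U : Set (Eucl m)} {Ω : Set F} (hg : IsMetricOn g U)
    (hh : IsMetricOn h Ω) {f V Z : Eucl m → F} (hf : ContDiffOn ℝ ∞ f U) (hfU : Set.MapsTo f U Ω)
    (hV : ContDiffOn ℝ ∞ V U) (hZ : ContDiffOn ℝ ∞ Z U) :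
    ContDiffOn ℝ ∞ (gradPair g h f V Z) U := by
  refine ContDiffOn.sum fun j _ => ?_
  exact ((hh.smooth.comp hf hfU).clm_apply ((smooth_cov hh.smooth_chris hg.isOpen hf hfU hV).clm_apply
    contDiffOn_const)).clm_apply ((smooth_cov hh.smooth_chris hg.isOpen hf hfU hZ).clm_apply
      (hg.smooth_dualVec j))

lemma tensionC_congr {f f' : Eucl m → F} {y : Eucl m} (hf : f =ᶠ[𝓝 y] f') :
    tensionC g h f y = tensionC g h f' y := by
  rw [tensionC, tensionC, covForm, covForm, hf.eq_of_nhds, hf.fderiv_eq, hf.fderiv.fderiv_eq]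

lemma gradPair_congr {f f' V V' Z Z' : Eucl m → F} {y : Eucl m} (hf : f =ᶠ[𝓝 y] f')
    (hV : V =ᶠ[𝓝 y] V') (hZ : Z =ᶠ[𝓝 y] Z') :
    gradPair g h f V Z y = gradPair g h f' V' Z' y := by
  rw [gradPair, gradPair, cov_congr_map hf, cov_congr_map hf, cov_congr hV, cov_congr hZ,
    hf.eq_of_nhds]

end Smoothness

section Triharmonic

variable {m n : ℕ}
  {M : Type*} [TopologicalSpace M] [ChartedSpace (EuclideanSpace ℝ (Fin m)) M]
  [IsManifold (𝓡 m) ∞ M]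
  {N : Type*} [TopologicalSpace N] [ChartedSpace (EuclideanSpace ℝ (Fin n)) N]
  [IsManifold (𝓡 n) ∞ N]
  [RiemannianBundle (fun x : M => TangentSpace (𝓡 m) x)]
  [IsContMDiffRiemannianBundle (𝓡 m) ∞ (EuclideanSpace ℝ (Fin m))
      (fun x : M => TangentSpace (𝓡 m) x)]
  [RiemannianBundle (fun p : N => TangentSpace (𝓡 n) p)]
  [IsContMDiffRiemannianBundle (𝓡 n) ∞ (EuclideanSpace ℝ (Fin n))
      (fun p : N => TangentSpace (𝓡 n) p)]
  {φ : M → N}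

lemma continuous_gradInner (hφ : ContMDiff (𝓡 m) (𝓡 n) ∞ φ)
    {V Z : ∀ x : M, TangentSpace (𝓡 n) (φ x)} (hV : SmoothSec m n φ V) (hZ : SmoothSec m n φ Z) :
    Continuous (gradInner m n φ V Z) := by
  rw [continuous_iff_continuousAt]
  intro q
  have h1 := mem_chart_source (EuclideanSpace ℝ (Fin m)) q
  have h2 := mem_chart_source (EuclideanSpace ℝ (Fin n)) (φ q)
  have hs := smooth_gradPair (isMetricOn_cdom hφ.continuous q (φ q)) (isMetricOn_metricC (φ q))
    (smooth_crep hφ q (φ q)) (mapsTo_crep q (φ q) φ) (hV q (φ q)) (hZ q (φ q))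
  have hc := (hs.continuousOn.continuousAt ((isOpen_cdom (n := n) hφ.continuous q (φ q)).mem_nhds
    (mem_cdom h1 h2))).comp (continuousAt_extChartAt (I := 𝓡 m) q)
  refine hc.congr ?_
  filter_upwards [(chartAt (EuclideanSpace ℝ (Fin m)) q).open_source.mem_nhds h1,
    ((chartAt (EuclideanSpace ℝ (Fin n)) (φ q)).open_source.preimage hφ.continuous).mem_nhds h2]
    with z hz1 hz2
  exact (gradInner_eq hφ hV hZ hz1 hz2).symm

/-! ### Variations supported in one pair of charts. -/

section Variation

open Classical in
/-- The variation of `φ` inside the charts at `x₀` and `p₀` in the direction `V`. -/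
def chartVariation (x₀ : M) (p₀ : N) (φ : M → N) (V : Eucl m → Eucl n) (t : ℝ) (q : M) : N :=
  if q ∈ (chartAt (EuclideanSpace ℝ (Fin m)) x₀).source ∩
      φ ⁻¹' (chartAt (EuclideanSpace ℝ (Fin n)) p₀).source then
    (extChartAt (𝓡 n) p₀).symm (crep x₀ p₀ φ (extChartAt (𝓡 m) x₀ q)
      + Real.sin t • V (extChartAt (𝓡 m) x₀ q))
  else φ q

variable {x₀ : M} {p₀ : N} {V : Eucl m → Eucl n} {K : Set (Eucl m)}

lemma chartVariation_of_mem {q : M} (h1 : q ∈ (chartAt (EuclideanSpace ℝ (Fin m)) x₀).source)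
    (h2 : φ q ∈ (chartAt (EuclideanSpace ℝ (Fin n)) p₀).source) (t : ℝ) :
    chartVariation x₀ p₀ φ V t q = (extChartAt (𝓡 n) p₀).symm
      (crep x₀ p₀ φ (extChartAt (𝓡 m) x₀ q) + Real.sin t • V (extChartAt (𝓡 m) x₀ q)) :=
  if_pos ⟨h1, h2⟩

lemma chartVariation_eq_self {t : ℝ} {q : M}
    (h : q ∈ (chartAt (EuclideanSpace ℝ (Fin m)) x₀).source →
      φ q ∈ (chartAt (EuclideanSpace ℝ (Fin n)) p₀).source →
      Real.sin t • V (extChartAt (𝓡 m) x₀ q) = 0) :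
    chartVariation x₀ p₀ φ V t q = φ q := by
  by_cases hq : q ∈ (chartAt (EuclideanSpace ℝ (Fin m)) x₀).source ∩
      φ ⁻¹' (chartAt (EuclideanSpace ℝ (Fin n)) p₀).source
  · rw [chartVariation_of_mem hq.1 hq.2, h hq.1 hq.2, add_zero, crep_extChartAt p₀ hq.1,
      extChartAt_symm_apply hq.2]
  · exact if_neg hq

lemma chartVariation_eq_of_notMem (hs : tsupport V ⊆ K) (t : ℝ) {q : M}
    (hq : q ∉ (extChartAt (𝓡 m) x₀).symm '' K) : chartVariation x₀ p₀ φ V t q = φ q := by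
  refine chartVariation_eq_self fun h1 _ => ?_
  rw [image_eq_zero_of_notMem_tsupport (f := V), smul_zero]
  exact fun h => hq ⟨_, hs h, extChartAt_symm_apply h1⟩

/-- The set where the chart formula applies and the complement of the image of `K` cover `M`. Both
are open, the second because compact sets in a Hausdorff space are closed; on the second the
variation is constant in time. -/
lemma contMDiff_chartVariation [T2Space M] (hφ : ContMDiff (𝓡 m) (𝓡 n) ∞ φ) (hV : ContDiff ℝ ∞ V)
    (hK : IsCompact K) (hKU : K ⊆ cdom (m := m) (n := n) x₀ p₀ φ) (hs : tsupport V ⊆ K)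
    (hmap : ∀ y ∈ cdom (m := m) (n := n) x₀ p₀ φ, ∀ s : ℝ, |s| ≤ 1 →
      crep x₀ p₀ φ y + s • V y ∈ (extChartAt (𝓡 n) p₀).target) :
    ContMDiff (𝓘(ℝ, ℝ).prod (𝓡 m)) (𝓡 n) ∞
      (fun z : ℝ × M => chartVariation x₀ p₀ φ V z.1 z.2) := by
  set A := (chartAt (EuclideanSpace ℝ (Fin m)) x₀).source ∩
      φ ⁻¹' (chartAt (EuclideanSpace ℝ (Fin n)) p₀).source with hA
  have hAo : IsOpen A := (chartAt (EuclideanSpace ℝ (Fin m)) x₀).open_source.inter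
    ((chartAt (EuclideanSpace ℝ (Fin n)) p₀).open_source.preimage hφ.continuous)
  have hK' : IsCompact ((extChartAt (𝓡 m) x₀).symm '' K) :=
    hK.image_of_continuousOn ((continuousOn_extChartAt_symm x₀).mono
      (hKU.trans Set.inter_subset_left))
  intro ⟨t, q⟩
  by_cases hq : q ∈ A
  · have h1 : ContMDiffOn (𝓘(ℝ, ℝ).prod (𝓡 m)) 𝓘(ℝ, ℝ × Eucl m) ∞
        (fun z : ℝ × M => (z.1, extChartAt (𝓡 m) x₀ z.2)) (Set.univ ×ˢ A) :=
      contMDiffOn_fst.prodMk_space ((contMDiffOn_extChartAt (I := 𝓡 m) (x := x₀)).comp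
        contMDiffOn_snd fun z hz => hz.2.1)
    have h2 : ContDiffOn ℝ ∞ (fun z : ℝ × Eucl m => crep x₀ p₀ φ z.2 + Real.sin z.1 • V z.2)
        (Set.univ ×ˢ cdom (m := m) (n := n) x₀ p₀ φ) :=
      ((smooth_crep hφ x₀ p₀).comp contDiffOn_snd fun z hz => hz.2).add
        ((Real.contDiff_sin.comp contDiff_fst).smul (hV.comp contDiff_snd)).contDiffOn
    have h3 := h2.contMDiffOn.comp h1 fun z hz => ⟨Set.mem_univ _, mem_cdom hz.2.1 hz.2.2⟩
    have h4 := (contMDiffOn_extChartAt_symm (I := 𝓡 n) (n := ∞) p₀).comp h3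
      fun z hz => hmap _ (mem_cdom hz.2.1 hz.2.2) _ (Real.abs_sin_le_one _)
    have hmem : (Set.univ : Set ℝ) ×ˢ A ∈ 𝓝 (t, q) :=
      (isOpen_univ.prod hAo).mem_nhds ⟨Set.mem_univ t, hq⟩
    have h5 := h4.contMDiffAt hmem
    refine h5.congr_of_eventuallyEq ?_
    filter_upwards [hmem] with z hz
    exact chartVariation_of_mem hz.2.1 hz.2.2 z.1
  · have hqK : q ∈ ((extChartAt (𝓡 m) x₀).symm '' K)ᶜ := by
      rintro ⟨y, hy, rfl⟩
      exact hq ⟨mem_chart_of_mem_target (hKU hy).1, (hKU hy).2⟩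
    have h1 : ContMDiffAt (𝓘(ℝ, ℝ).prod (𝓡 m)) (𝓡 n) ∞ (fun z : ℝ × M => φ z.2) (t, q) :=
      (hφ.comp contMDiff_snd) _
    refine h1.congr_of_eventuallyEq ?_
    filter_upwards [(isOpen_univ.prod hK'.isClosed.isOpen_compl).mem_nhds
      (show (t, q) ∈ Set.univ ×ˢ ((extChartAt (𝓡 m) x₀).symm '' K)ᶜ from ⟨Set.mem_univ t, hqK⟩)]
      with z hz
    exact chartVariation_eq_of_notMem hs z.1 hz.2

variable [MeasurableSpace M] [BorelSpace M]

/-- The 3-energy of the variation in coordinates. -/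
lemma toReal_trienergyOn_chartVariation [T2Space M] (hφ : ContMDiff (𝓡 m) (𝓡 n) ∞ φ)
    (hV : ContDiff ℝ ∞ V)
    (hK : IsCompact K) (hKU : K ⊆ cdom (m := m) (n := n) x₀ p₀ φ) (hs : tsupport V ⊆ K)
    (hmap : ∀ y ∈ cdom (m := m) (n := n) x₀ p₀ φ, ∀ s : ℝ, |s| ≤ 1 →
      crep x₀ p₀ φ y + s • V y ∈ (extChartAt (𝓡 n) p₀).target) (t : ℝ) :
    (trienergyOn m n ((extChartAt (𝓡 m) x₀).symm '' K) (chartVariation x₀ p₀ φ V t)).toReal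
      = 1 / 2 * ∫ y in K, density (metricC x₀) y * gradPair (metricC x₀) (metricC p₀)
        (fun z => crep x₀ p₀ φ z + Real.sin t • V z)
        (tensionC (metricC x₀) (metricC p₀) fun z => crep x₀ p₀ φ z + Real.sin t • V z)
        (tensionC (metricC x₀) (metricC p₀) fun z => crep x₀ p₀ φ z + Real.sin t • V z) y := by
  set ψ := chartVariation x₀ p₀ φ V t with hψ
  have hK' : IsCompact ((extChartAt (𝓡 m) x₀).symm '' K) :=
    hK.image_of_continuousOn ((continuousOn_extChartAt_symm x₀).mono
      (hKU.trans Set.inter_subset_left))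
  have hψs : ContMDiff (𝓡 m) (𝓡 n) ∞ ψ :=
    (contMDiff_chartVariation hφ hV hK hKU hs hmap).comp (contMDiff_const.prodMk contMDiff_id)
  have hτ := smoothSec_tension hψs
  have hcont := continuous_gradInner hψs hτ hτ
  have hpos : ∀ q, 0 ≤ gradInner m n ψ (tension m n ψ) (tension m n ψ) q := fun q => by
    rw [gradInner_self]
    exact Finset.sum_nonneg fun i _ => sq_nonneg _
  have hpre : (extChartAt (𝓡 m) x₀).target ∩ (extChartAt (𝓡 m) x₀).symm ⁻¹'
      ((extChartAt (𝓡 m) x₀).symm '' K) = K := by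
    ext y
    constructor
    · rintro ⟨h1, z, hz, hzy⟩
      rwa [← (extChartAt (𝓡 m) x₀).symm.injOn (hKU hz).1 h1 hzy]
    · exact fun hy => ⟨(hKU hy).1, y, hy, rfl⟩
  rw [trienergyOn, ENNReal.toReal_mul]
  congr 1
  · simp
  simp only [← gradInner_self]
  rw [← integral_eq_lintegral_of_nonneg_ae (Filter.Eventually.of_forall hpos)
    hcont.aestronglyMeasurable, setIntegral_chart x₀ hcont.measurable hK'.measurableSet ?_, hpre]
  swap
  · rintro _ ⟨y, hy, rfl⟩
    exact mem_chart_of_mem_target (hKU hy).1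
  have hsrc : ∀ q, q ∈ (chartAt (EuclideanSpace ℝ (Fin m)) x₀).source →
      φ q ∈ (chartAt (EuclideanSpace ℝ (Fin n)) p₀).source →
      ψ q ∈ (chartAt (EuclideanSpace ℝ (Fin n)) p₀).source := by
    intro q h1 h2
    rw [hψ, chartVariation_of_mem h1 h2]
    exact mem_chart_of_mem_target (hmap _ (mem_cdom h1 h2) _ (Real.abs_sin_le_one _))
  have hf : ∀ y ∈ cdom (m := m) (n := n) x₀ p₀ φ,
      crep x₀ p₀ ψ =ᶠ[𝓝 y] fun z => crep x₀ p₀ φ z + Real.sin t • V z := by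
    intro y hy
    filter_upwards [(isOpen_cdom (n := n) hφ.continuous x₀ p₀).mem_nhds hy] with z hz
    obtain ⟨q, h1, h2, rfl⟩ := exists_of_mem_cdom hz
    rw [crep_extChartAt p₀ h1, hψ, chartVariation_of_mem h1 h2, (extChartAt (𝓡 n) p₀).right_inv
      (hmap _ hz _ (Real.abs_sin_le_one _))]
  have hT : ∀ y ∈ cdom (m := m) (n := n) x₀ p₀ φ, srep x₀ p₀ ψ (tension m n ψ) =ᶠ[𝓝 y]
      tensionC (metricC x₀) (metricC p₀) fun z => crep x₀ p₀ φ z + Real.sin t • V z := by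
    intro y hy
    filter_upwards [(isOpen_cdom (n := n) hφ.continuous x₀ p₀).mem_nhds hy] with z hz
    obtain ⟨q, h1, h2, rfl⟩ := exists_of_mem_cdom hz
    rw [srep_extChartAt p₀ _ h1, coords_tension hψs h1 (hsrc q h1 h2), tensionC_congr (hf _ hz)]
  refine setIntegral_congr_fun hK.measurableSet fun y hy => ?_
  obtain ⟨q, h1, h2, rfl⟩ := exists_of_mem_cdom (hKU hy)
  simp only [extChartAt_symm_apply h1]
  rw [gradInner_eq hψs hτ hτ h1 (hsrc q h1 h2),
    gradPair_congr (hf _ (hKU hy)) (hT _ (hKU hy)) (hT _ (hKU hy))]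

/-- Chart variations are admissible in the definition of triharmonicity, which reduces the claim to
the coordinate statement; the factor `1 / 2` of the energy is cleared first. -/
lemma IsTriharmonic.eulerForm_eq_zero [T2Space M] (hφ : IsTriharmonic m n φ) (x₀ : M) (p₀ : N)
    {y : Eucl m} (hy : y ∈ cdom (m := m) (n := n) x₀ p₀ φ) (v : Eucl n) :
    eulerForm (metricC x₀) (metricC p₀) (crep x₀ p₀ φ) y v = 0 := by
  obtain ⟨hs, hcrit⟩ := hφ
  refine Triharmonic.eulerForm_eq_zero (isMetricOn_cdom hs.continuous x₀ p₀)
    (isMetricOn_metricC p₀) (smooth_crep hs x₀ p₀) (mapsTo_crep x₀ p₀ φ) ?_ hy v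
  intro V K hV hK hKU hVK hmap
  have h := hcrit (chartVariation x₀ p₀ φ V) ((extChartAt (𝓡 m) x₀).symm '' K)
    (contMDiff_chartVariation hs hV hK hKU hVK hmap)
    (funext fun q => chartVariation_eq_self fun _ _ => by rw [Real.sin_zero, zero_smul])
    (hK.image_of_continuousOn ((continuousOn_extChartAt_symm x₀).mono
      (hKU.trans Set.inter_subset_left)))
    (fun t q hq => chartVariation_eq_of_notMem hVK t hq)
  simp only [toReal_trienergyOn_chartVariation hs hV hK hKU hVK hmap] at h
  have h' := h.const_mul 2
  simp only [mul_zero, ← mul_assoc] at h'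
  norm_num at h'
  exact h'

end Variation

end Triharmonic

/-! ### Triharmonic isometric immersions into spaces of constant curvature -/

section ConstantCurvature

variable {m n : ℕ}
  {M : Type*} [TopologicalSpace M] [ChartedSpace (EuclideanSpace ℝ (Fin m)) M]
  [IsManifold (𝓡 m) ∞ M]
  {N : Type*} [TopologicalSpace N] [ChartedSpace (EuclideanSpace ℝ (Fin n)) N]
  [IsManifold (𝓡 n) ∞ N]
  [RiemannianBundle (fun x : M => TangentSpace (𝓡 m) x)]
  [IsContMDiffRiemannianBundle (𝓡 m) ∞ (EuclideanSpace ℝ (Fin m))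
      (fun x : M => TangentSpace (𝓡 m) x)]
  [RiemannianBundle (fun p : N => TangentSpace (𝓡 n) p)]
  [IsContMDiffRiemannianBundle (𝓡 n) ∞ (EuclideanSpace ℝ (Fin n))
      (fun p : N => TangentSpace (𝓡 n) p)]
  {φ : M → N}

/-- `curvature` at `p` is computed in the chart at `p`, so the formula is obtained at the centre of
that chart. This suffices because the curvature enters the Euler–Lagrange form without being
differentiated. -/
lemma riem_of_hasConstantCurvature {c : ℝ} (hN : HasConstantCurvature n N c) (p : N)
    (a b w : Eucl n) :
    riem (chris (metricC p)) (extChartAt (𝓡 n) p p) a b w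
      = c • (metricC p (extChartAt (𝓡 n) p p) b w • a - metricC p (extChartAt (𝓡 n) p p) a w • b) := by
  have hp := mem_chart_source (EuclideanSpace ℝ (Fin n)) p
  refine (isMetricOn_metricC p).riem_of_sectional (extChartAt_mem_target hp) (fun u v => ?_) a b w
  have h := hN p (constField p u p) (constField p v p)
  rwa [inner_eq_metricC hp, curvature_eq, inner_eq_metricC hp, inner_eq_metricC hp,
    inner_eq_metricC hp, coords_constField hp, coords_constField hp] at h

lemma IsIsometricImmersion.metricC_eq (hφ : IsIsometricImmersion m n φ) (x₀ : M) (p₀ : N) :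
    ∀ y ∈ cdom (m := m) (n := n) x₀ p₀ φ, ∀ a b, metricC x₀ y a b
      = metricC (n := n) p₀ (crep x₀ p₀ φ y) (fderiv ℝ (crep x₀ p₀ φ) y a)
        (fderiv ℝ (crep x₀ p₀ φ) y b) := by
  intro y hy a b
  obtain ⟨q, h1, h2, rfl⟩ := exists_of_mem_cdom hy
  have h := hφ.2 q (constField x₀ a q) (constField x₀ b q)
  rw [← metricC_extChartAt h1, inner_eq_metricC h2, coords_mfderiv hφ.1 h1 h2,
    coords_mfderiv hφ.1 h1 h2, coords_constField h1, coords_constField h1] at h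
  rw [crep_extChartAt p₀ h1, h]

lemma srep_tension_eventuallyEq (hφ : ContMDiff (𝓡 m) (𝓡 n) ∞ φ) (x₀ : M) (p₀ : N) {y : Eucl m}
    (hy : y ∈ cdom (m := m) (n := n) x₀ p₀ φ) :
    srep x₀ p₀ φ (tension m n φ) =ᶠ[𝓝 y]
      tensionC (metricC x₀) (metricC p₀) (crep x₀ p₀ φ) := by
  filter_upwards [(isOpen_cdom (n := n) hφ.continuous x₀ p₀).mem_nhds hy] with z hz
  obtain ⟨q, h1, h2, rfl⟩ := exists_of_mem_cdom hz
  rw [srep_extChartAt p₀ _ h1, coords_tension hφ h1 h2]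

lemma lapC_congr {F : Type*} [NormedAddCommGroup F] [NormedSpace ℝ F]
    {g : Eucl m → Eucl m →L[ℝ] Eucl m →L[ℝ] ℝ} {h : F → F →L[ℝ] F →L[ℝ] ℝ} {f V W : Eucl m → F}
    {y : Eucl m} (hV : V =ᶠ[𝓝 y] W) : lapC g h f V y = lapC g h f W y := by
  have h1 : cov (chris h) f V =ᶠ[𝓝 y] cov (chris h) f W := by
    filter_upwards [hV.eventuallyEq_nhds] with z hz using cov_congr hz
  rw [lapC, lapC, covForm, covForm, h1.eq_of_nhds, h1.fderiv_eq]

lemma srep_roughLaplacian_tension_eventuallyEq (hφ : ContMDiff (𝓡 m) (𝓡 n) ∞ φ) (x₀ : M) (p₀ : N)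
    {y : Eucl m} (hy : y ∈ cdom (m := m) (n := n) x₀ p₀ φ) :
    srep x₀ p₀ φ (roughLaplacian m n φ (tension m n φ)) =ᶠ[𝓝 y]
      lapC (metricC x₀) (metricC p₀) (crep x₀ p₀ φ)
        (tensionC (metricC x₀) (metricC p₀) (crep x₀ p₀ φ)) := by
  filter_upwards [(isOpen_cdom (n := n) hφ.continuous x₀ p₀).mem_nhds hy] with z hz
  obtain ⟨q, h1, h2, rfl⟩ := exists_of_mem_cdom hz
  rw [srep_extChartAt p₀ _ h1, coords_roughLaplacian hφ (smoothSec_tension hφ) h1 h2,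
    lapC_congr (srep_tension_eventuallyEq hφ x₀ p₀ hz)]

/-- The tension field of an isometric immersion is normal, so the tangential part of its covariant
derivative determines its length. -/
lemma IsIsometricImmersion.sum_covDeriv_tension (hφ : IsIsometricImmersion m n φ) (q : M) :
    ∑ i, inner ℝ (covDeriv m n φ (tension m n φ) q (frame m q i))
      (mfderiv (𝓡 m) (𝓡 n) φ q (frame m q i)) = -‖tension m n φ q‖ ^ 2 := by
  have h1 := mem_chart_source (EuclideanSpace ℝ (Fin m)) q
  have h2 := mem_chart_source (EuclideanSpace ℝ (Fin n)) (φ q)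
  have hy := mem_cdom h1 h2
  have h := mtrace_cov_tensionC (isMetricOn_cdom hφ.1.continuous q (φ q)) (isMetricOn_metricC (φ q))
    (smooth_crep hφ.1 q (φ q)) (mapsTo_crep q (φ q) φ) (hφ.metricC_eq q (φ q)) hy
  rw [mtrace_metricC h1, crep_extChartAt (φ q) h1, ← coords_tension hφ.1 h1 h2,
    ← inner_eq_metricC h2, real_inner_self_eq_norm_sq] at h
  rw [← h]
  refine Finset.sum_congr rfl fun i _ => ?_
  rw [inner_eq_metricC h2, coords_mfderiv hφ.1 h1 h2, coords_covDeriv hφ.1 h1 h2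
    (((smoothSec_tension hφ.1).contDiffAt hφ.1 h1 h2).differentiableAt (by simp)),
    cov_congr (srep_tension_eventuallyEq hφ.1 q (φ q) hy)]
  rfl

/-- The Euler–Lagrange equation, paired with `Δ̄τ`. -/
lemma inner_roughLaplacian_roughLaplacian_tension [T2Space M] [MeasurableSpace M] [BorelSpace M]
    {c : ℝ} (hN : HasConstantCurvature n N c) (hφ : IsIsometricImmersion m n φ)
    (htri : IsTriharmonic m n φ) (q : M) :
    inner ℝ (roughLaplacian m n φ (roughLaplacian m n φ (tension m n φ)) q)
        (roughLaplacian m n φ (tension m n φ) q)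
      = c * ∑ i, (‖roughLaplacian m n φ (tension m n φ) q‖ ^ 2
          - inner ℝ (roughLaplacian m n φ (tension m n φ) q)
              (mfderiv (𝓡 m) (𝓡 n) φ q (frame m q i)) ^ 2)
        + c * (‖tension m n φ q‖ ^ 2
          * inner ℝ (tension m n φ q) (roughLaplacian m n φ (tension m n φ) q)) := by
  have h1 := mem_chart_source (EuclideanSpace ℝ (Fin m)) q
  have h2 := mem_chart_source (EuclideanSpace ℝ (Fin n)) (φ q)
  have hy := mem_cdom h1 h2
  have hτ := smoothSec_tension hφ.1
  have hW := hτ.roughLaplacian hφ.1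
  have hcrep := crep_extChartAt (n := n) (φ := φ) (φ q) h1
  set W := roughLaplacian m n φ (tension m n φ) with hWdef
  have e1 : coords (φ q) (φ q) (roughLaplacian m n φ W q) = lapC (metricC q) (metricC (φ q))
      (crep q (φ q) φ) (lapC (metricC q) (metricC (φ q)) (crep q (φ q) φ)
        (tensionC (metricC q) (metricC (φ q)) (crep q (φ q) φ))) (extChartAt (𝓡 m) q q) := by
    rw [coords_roughLaplacian hφ.1 hW h1 h2]
    exact lapC_congr (srep_roughLaplacian_tension_eventuallyEq hφ.1 q (φ q) hy)
  have e2 : coords (φ q) (φ q) (W q) = lapC (metricC q) (metricC (φ q)) (crep q (φ q) φ)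
        (tensionC (metricC q) (metricC (φ q)) (crep q (φ q) φ)) (extChartAt (𝓡 m) q q) := by
    rw [← (srep_roughLaplacian_tension_eventuallyEq hφ.1 q (φ q) hy).eq_of_nhds,
      srep_extChartAt (φ q) _ h1]
  -- The Euler–Lagrange form is tested on `W` itself, in the charts centred at `q` and `φ q`.
  have hel := htri.eulerForm_eq_zero q (φ q) hy (coords (φ q) (φ q) (W q))
  rw [eulerForm_of_riem (isMetricOn_cdom hφ.1.continuous q (φ q)) (isMetricOn_metricC (φ q))
    (smooth_crep hφ.1 q (φ q)) (mapsTo_crep q (φ q) φ) (hφ.metricC_eq q (φ q)) hy (c := c)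
    (fun a b w => by rw [hcrep]; exact riem_of_hasConstantCurvature hN (φ q) a b w),
    ← e1, ← e2, ← coords_tension hφ.1 h1 h2, mtrace_metricC h1, mtrace_metricC h1, hcrep,
    ← inner_eq_metricC h2, ← inner_eq_metricC h2, ← inner_eq_metricC h2, ← inner_eq_metricC h2,
    real_inner_self_eq_norm_sq, real_inner_self_eq_norm_sq] at hel
  have e3 : ∀ i, ((metricC (φ q) (extChartAt (𝓡 n) (φ q) (φ q))).bilinearComp
      (fderiv ℝ (crep q (φ q) φ) (extChartAt (𝓡 m) q q))
      (fderiv ℝ (crep q (φ q) φ) (extChartAt (𝓡 m) q q))) (coords q q (frame m q i))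
        (coords q q (frame m q i)) = 1 := by
    intro i
    rw [ContinuousLinearMap.bilinearComp_apply, ← coords_mfderiv hφ.1 h1 h2, ← inner_eq_metricC h2,
      hφ.2, real_inner_self_eq_norm_sq, (frame m q).orthonormal.1 i, one_pow]
  have e4 : ∀ i, ((metricC (φ q) (extChartAt (𝓡 n) (φ q) (φ q))).bilinearComp
      (fderiv ℝ (crep q (φ q) φ) (extChartAt (𝓡 m) q q))
      ((metricC (φ q) (extChartAt (𝓡 n) (φ q) (φ q)) (coords (φ q) (φ q) (W q))).smulRight
          (coords (φ q) (φ q) (W q)) ∘L fderiv ℝ (crep q (φ q) φ) (extChartAt (𝓡 m) q q)))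
        (coords q q (frame m q i)) (coords q q (frame m q i))
      = inner ℝ (W q) (mfderiv (𝓡 m) (𝓡 n) φ q (frame m q i)) ^ 2 := by
    intro i
    rw [ContinuousLinearMap.bilinearComp_apply, ContinuousLinearMap.comp_apply,
      ContinuousLinearMap.smulRight_apply, ← coords_mfderiv hφ.1 h1 h2, map_smul,
      ← inner_eq_metricC h2, ← inner_eq_metricC h2, real_inner_comm (W q), smul_eq_mul, sq]
  simp only [e3, e4] at hel
  rw [Finset.sum_sub_distrib, Finset.sum_const, nsmul_eq_mul, real_inner_comm (W q) (tension m n φ q)]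
  rw [Finset.sum_const, nsmul_eq_mul, mul_one] at hel
  linarith

end ConstantCurvature

/-! ### The Riemannian distance in charts -/

section Distance

variable {m : ℕ} {M : Type*} [EMetricSpace M] [ChartedSpace (EuclideanSpace ℝ (Fin m)) M]
  [IsManifold (𝓡 m) ∞ M]

lemma mfderiv_extChartAt_symm {x₀ : M} {w : Eucl m} (hw : w ∈ (extChartAt (𝓡 m) x₀).target)
    (v : Eucl m) :
    mfderiv 𝓘(ℝ, Eucl m) (𝓡 m) (extChartAt (𝓡 m) x₀).symm w v
      = constField x₀ v ((extChartAt (𝓡 m) x₀).symm w) := by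
  have hq := mem_chart_of_mem_target hw
  apply coords_injective hq
  rw [coords_constField hq]
  have e1 : ∀ u : TangentSpace (𝓡 m) ((extChartAt (𝓡 m) x₀).symm w),
      coords x₀ ((extChartAt (𝓡 m) x₀).symm w) u
        = mfderiv (𝓡 m) 𝓘(ℝ, Eucl m) (extChartAt (𝓡 m) x₀) ((extChartAt (𝓡 m) x₀).symm w) u :=
    fun u => congrArg (fun L => L u)
      (TangentBundle.continuousLinearMapAt_trivializationAt (I := 𝓡 m) hq)
  have d1 : MDifferentiableAt (𝓡 m) 𝓘(ℝ, Eucl m) (extChartAt (𝓡 m) x₀)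
      ((extChartAt (𝓡 m) x₀).symm w) :=
    ((contMDiffOn_extChartAt (n := ∞) (x := x₀)).contMDiffAt
      ((chartAt (EuclideanSpace ℝ (Fin m)) x₀).open_source.mem_nhds hq)).mdifferentiableAt (by simp)
  have d2 : MDifferentiableAt 𝓘(ℝ, Eucl m) (𝓡 m) (extChartAt (𝓡 m) x₀).symm w :=
    ((contMDiffOn_extChartAt_symm (n := ∞) x₀).contMDiffAt
      ((isOpen_extChartAt_target x₀).mem_nhds hw)).mdifferentiableAt (by simp)
  have e2 := mfderiv_comp_apply w d1 d2 v
  have e3 : (fun z => extChartAt (𝓡 m) x₀ ((extChartAt (𝓡 m) x₀).symm z)) =ᶠ[𝓝 w] id := by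
    filter_upwards [(isOpen_extChartAt_target (I := 𝓡 m) x₀).mem_nhds hw] with z hz
    exact (extChartAt (𝓡 m) x₀).right_inv hz
  have e4 : (mfderiv 𝓘(ℝ, Eucl m) 𝓘(ℝ, Eucl m)
      (extChartAt (𝓡 m) x₀ ∘ (extChartAt (𝓡 m) x₀).symm) w : Eucl m →L[ℝ] Eucl m)
      = ContinuousLinearMap.id ℝ (Eucl m) := by
    rw [mfderiv_eq_fderiv]
    exact e3.fderiv_eq.trans fderiv_id
  rw [e1]
  exact e2.symm.trans (congrArg (fun L : Eucl m →L[ℝ] Eucl m => L v) e4)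

variable [RiemannianBundle (fun x : M => TangentSpace (𝓡 m) x)]
  [IsRiemannianManifold (𝓡 m) M]

/-- A segment in a chart bounds the Riemannian distance of its end points. -/
lemma edist_extChartAt_symm_le {x₀ : M} {y v : Eucl m} {A : ℝ} (hA0 : 0 ≤ A)
    (hseg : ∀ s ∈ Set.Icc (0 : ℝ) 1, y + s • v ∈ (extChartAt (𝓡 m) x₀).target)
    (hA : ∀ s ∈ Set.Icc (0 : ℝ) 1, metricC x₀ (y + s • v) v v ≤ A ^ 2) :
    edist ((extChartAt (𝓡 m) x₀).symm y) ((extChartAt (𝓡 m) x₀).symm (y + v))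
      ≤ ENNReal.ofReal A := by
  set γ : ℝ → M := fun s => (extChartAt (𝓡 m) x₀).symm (y + s • v) with hγ
  have hη : ContDiff ℝ ∞ (fun s : ℝ => y + s • v) :=
    contDiff_const.add (contDiff_id.smul contDiff_const)
  have hγs : ContMDiffOn 𝓘(ℝ, ℝ) (𝓡 m) 1 γ (Set.Icc 0 1) :=
    ((contMDiffOn_extChartAt_symm (n := ∞) x₀).comp hη.contMDiff.contMDiffOn hseg).of_le
      (by norm_cast)
  rw [IsRiemannianManifold.out (I := 𝓡 m)]
  refine (Manifold.riemannianEDist_le_pathELength hγs (by simp [hγ]) (by simp [hγ]) zero_le_one).trans ?_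
  rw [Manifold.pathELength_eq_lintegral_mfderiv_Ioo]
  have hle : ∀ s ∈ Set.Ioo (0 : ℝ) 1, ‖mfderiv 𝓘(ℝ, ℝ) (𝓡 m) γ s 1‖ₑ ≤ ENNReal.ofReal A := by
    intro s hs
    have hs' := Set.Ioo_subset_Icc_self hs
    have d2 : MDifferentiableAt 𝓘(ℝ, Eucl m) (𝓡 m) (extChartAt (𝓡 m) x₀).symm (y + s • v) :=
      ((contMDiffOn_extChartAt_symm (n := ∞) x₀).contMDiffAt
        ((isOpen_extChartAt_target x₀).mem_nhds (hseg s hs'))).mdifferentiableAt (by simp)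
    have d1 : HasDerivAt (fun s : ℝ => y + s • v) v s := by
      simpa using ((hasDerivAt_id s).smul_const v).const_add y
    have e1 : mfderiv 𝓘(ℝ, ℝ) (𝓡 m) γ s 1 = constField x₀ v (γ s) := by
      rw [hγ, ← mfderiv_extChartAt_symm (hseg s hs')]
      refine (mfderiv_comp_apply s d2 d1.differentiableAt.mdifferentiableAt (1 : ℝ)).trans ?_
      congr 1
      rw [mfderiv_eq_fderiv]
      exact d1.deriv
    rw [e1, ← ofReal_norm]
    refine ENNReal.ofReal_le_ofReal (abs_le_of_sq_le_sq' ?_ hA0).2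
    rw [← real_inner_self_eq_norm_sq]
    exact hA s hs'
  calc ∫⁻ t in Set.Ioo (0 : ℝ) 1, ‖mfderiv 𝓘(ℝ, ℝ) (𝓡 m) γ t 1‖ₑ
      ≤ ∫⁻ t in Set.Ioo (0 : ℝ) 1, ENNReal.ofReal A := setLIntegral_mono' measurableSet_Ioo hle
    _ = ENNReal.ofReal A := by simp

variable [IsContMDiffRiemannianBundle (𝓡 m) ∞ (EuclideanSpace ℝ (Fin m))
      (fun x : M => TangentSpace (𝓡 m) x)]

/-- A chart is bi-Lipschitz near each point; we only need one of the two estimates. -/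
lemma exists_ball_lipschitzOn {x₀ : M} {y₀ : Eucl m} {O : Set (Eucl m)} (hO : O ∈ 𝓝 y₀)
    (hOt : O ⊆ (extChartAt (𝓡 m) x₀).target) :
    ∃ r > 0, ∃ C : NNReal, Metric.ball y₀ r ⊆ O ∧
      LipschitzOnWith C (extChartAt (𝓡 m) x₀).symm (Metric.ball y₀ r) := by
  have hc : ContinuousAt (metricC x₀) y₀ :=
    (isMetricOn_metricC x₀).smooth.continuousOn.continuousAt (Filter.mem_of_superset hO hOt)
  have hb : ∀ᶠ w in 𝓝 y₀, ‖metricC x₀ w‖ < ‖metricC x₀ y₀‖ + 1 :=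
    hc.norm.eventually_lt continuousAt_const (by simp)
  obtain ⟨r, hr, hball⟩ := Metric.mem_nhds_iff.1 (Filter.inter_mem hO hb)
  -- `B` bounds the norm of the metric on the ball, so a segment in the ball has length at most `√B`
  -- times its Euclidean length.
  set B := ‖metricC x₀ y₀‖ + 1 with hB
  have hB0 : 0 ≤ B := by positivity
  refine ⟨r, hr, Real.toNNReal √B, fun y hy => (hball hy).1, fun y hy z hz => ?_⟩
  have hseg : ∀ s ∈ Set.Icc (0 : ℝ) 1, y + s • (z - y) ∈ Metric.ball y₀ r := by
    intro s hs
    have := (convex_ball y₀ r).add_smul_sub_mem hy hz hs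
    simpa using this
  have h := edist_extChartAt_symm_le (x₀ := x₀) (y := y) (v := z - y) (A := √B * ‖z - y‖)
    (by positivity) (fun s hs => hOt (hball (hseg s hs)).1) (fun s hs => by
      have h1 := (hball (hseg s hs)).2
      calc metricC x₀ (y + s • (z - y)) (z - y) (z - y)
          ≤ ‖metricC x₀ (y + s • (z - y))‖ * ‖z - y‖ * ‖z - y‖ :=
            (Real.le_norm_self _).trans (ContinuousLinearMap.le_opNorm₂ _ _ _)
        _ ≤ B * ‖z - y‖ * ‖z - y‖ := by
            gcongr
            exact h1.le
        _ = (√B * ‖z - y‖) ^ 2 := by rw [mul_pow, Real.sq_sqrt hB0]; ring)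
  rw [add_sub_cancel, ENNReal.ofReal_mul (Real.sqrt_nonneg _)] at h
  rwa [edist_comm y z, edist_dist z y, dist_eq_norm]

/-- The derivative, in a chart, of a function with a given local Lipschitz bound. -/
lemma abs_fderiv_le_of_edist_le {x₀ : M} {ζ σ : M → ℝ} (hσ : Continuous σ) (hσ0 : ∀ x, 0 ≤ σ x)
    (hζ : ∀ x y, edist (ζ x) (ζ y) ≤ ENNReal.ofReal (σ x + σ y) * edist x y)
    {y : Eucl m} (hy : y ∈ (extChartAt (𝓡 m) x₀).target) {e : Eucl m → ℝ}
    (he : e =ᶠ[𝓝 y] fun z => ζ ((extChartAt (𝓡 m) x₀).symm z)) (hd : DifferentiableAt ℝ e y)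
    (v : Eucl m) :
    |fderiv ℝ e y v| ≤ 2 * σ ((extChartAt (𝓡 m) x₀).symm y) * √(metricC x₀ y v v) := by
  set s := √(metricC x₀ y v v) with hs
  have hT := (isOpen_extChartAt_target (I := 𝓡 m) x₀).mem_nhds hy
  -- The metric near `y` agrees with its value at `y` only up to an error, which `ε` absorbs;
  -- difference quotients along short segments then give the bound, and `ε → 0` at the end.
  have key : ∀ ε > 0, |fderiv ℝ e y v| ≤ 2 * σ ((extChartAt (𝓡 m) x₀).symm y) * (s + ε) := by
    intro ε hε
    have hg : ∀ᶠ w in 𝓝 y, metricC x₀ w v v < (s + ε) ^ 2 := by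
      have hc : ContinuousAt (fun w => metricC x₀ w v v) y :=
        (((isMetricOn_metricC x₀).smooth.continuousOn.continuousAt hT).clm_apply
          continuousAt_const).clm_apply continuousAt_const
      refine hc.eventually_lt continuousAt_const ?_
      have h0 : 0 ≤ metricC x₀ y v v := by
        rw [metricC_apply]; exact real_inner_self_nonneg
      nlinarith [Real.sq_sqrt h0, Real.sqrt_nonneg (metricC x₀ y v v)]
    obtain ⟨r, hr, hball⟩ := Metric.mem_nhds_iff.1 (Filter.inter_mem (Filter.inter_mem hT hg) he)
    have hline : Filter.Tendsto (fun t : ℝ => y + t • v) (𝓝[>] 0) (𝓝 y) := by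
      have : Continuous fun t : ℝ => y + t • v := by fun_prop
      have h1 := this.tendsto 0
      simp only [zero_smul, add_zero] at h1
      exact h1.mono_left nhdsWithin_le_nhds
    have hlim : Filter.Tendsto (fun t : ℝ => |t⁻¹ * (e (y + t • v) - e y)|) (𝓝[>] 0)
        (𝓝 |fderiv ℝ e y v|) := by
      have h1 := (hd.hasFDerivAt.hasLineDerivAt v).tendsto_slope_zero_right
      simpa only [smul_eq_mul] using h1.abs
    have hlim' : Filter.Tendsto (fun t : ℝ => (σ ((extChartAt (𝓡 m) x₀).symm y)
        + σ ((extChartAt (𝓡 m) x₀).symm (y + t • v))) * (s + ε)) (𝓝[>] 0)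
        (𝓝 ((σ ((extChartAt (𝓡 m) x₀).symm y) + σ ((extChartAt (𝓡 m) x₀).symm y)) * (s + ε))) := by
      have h1 : ContinuousAt (fun w => σ ((extChartAt (𝓡 m) x₀).symm w)) y :=
        hσ.continuousAt.comp ((continuousOn_extChartAt_symm x₀).continuousAt hT)
      exact (tendsto_const_nhds.add (h1.tendsto.comp hline)).mul_const _
    rw [two_mul]
    refine le_of_tendsto_of_tendsto hlim hlim' ?_
    filter_upwards [hline (Metric.ball_mem_nhds y hr), self_mem_nhdsWithin] with t ht ht0
    have ht0' : 0 < t := ht0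
    have hseg : ∀ a ∈ Set.Icc (0 : ℝ) 1, y + a • t • v ∈ Metric.ball y r := by
      intro a ha
      have := (convex_ball y r).add_smul_sub_mem (Metric.mem_ball_self hr) ht ha
      simpa using this
    have hE := edist_extChartAt_symm_le (x₀ := x₀) (y := y) (v := t • v) (A := t * (s + ε))
      (by positivity) (fun a ha => (hball (hseg a ha)).1.1) (fun a ha => by
        have h1 : metricC x₀ (y + a • t • v) v v < (s + ε) ^ 2 := (hball (hseg a ha)).1.2
        simp only [map_smul, smul_apply, smul_eq_mul]
        nlinarith [mul_pos ht0' ht0'])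
    have h2 := (hζ ((extChartAt (𝓡 m) x₀).symm y) ((extChartAt (𝓡 m) x₀).symm (y + t • v))).trans
      (mul_le_mul_right hE _)
    have e1 : e y = ζ ((extChartAt (𝓡 m) x₀).symm y) := he.eq_of_nhds
    have e2 : e (y + t • v) = ζ ((extChartAt (𝓡 m) x₀).symm (y + t • v)) := (hball ht).2
    have hσ2 := add_nonneg (hσ0 ((extChartAt (𝓡 m) x₀).symm y))
      (hσ0 ((extChartAt (𝓡 m) x₀).symm (y + t • v)))
    rw [← e1, ← e2, edist_comm, edist_dist, Real.dist_eq, ← ENNReal.ofReal_mul hσ2,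
      ENNReal.ofReal_le_ofReal_iff (by positivity)] at h2
    rw [abs_mul, abs_of_pos (inv_pos.2 ht0')]
    rw [inv_mul_le_iff₀ ht0']
    linarith
  have hlim : Filter.Tendsto (fun ε : ℝ => 2 * σ ((extChartAt (𝓡 m) x₀).symm y) * (s + ε)) (𝓝[>] 0)
      (𝓝 (2 * σ ((extChartAt (𝓡 m) x₀).symm y) * (s + 0))) := by
    have : Continuous fun ε : ℝ => 2 * σ ((extChartAt (𝓡 m) x₀).symm y) * (s + ε) := by fun_prop
    exact (this.tendsto 0).mono_left nhdsWithin_le_nhds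
  rw [add_zero] at hlim
  exact ge_of_tendsto hlim (by filter_upwards [self_mem_nhdsWithin] with ε hε using key ε hε)

end Distance

/-! ### Compactness of balls and cutoff functions -/

section HopfRinow

variable {M : Type*} [EMetricSpace M]

/-- A Riemannian manifold is a length space. -/
lemma exists_edist_le_edist_lt (m : ℕ) [ChartedSpace (EuclideanSpace ℝ (Fin m)) M]
    [RiemannianBundle (fun x : M => TangentSpace (𝓡 m) x)] [IsRiemannianManifold (𝓡 m) M]
    {x y : M} {r s : ℝ≥0∞} (hs : 0 < s) (h : edist x y < r + s) :
    ∃ z, edist x z ≤ r ∧ edist z y < s := by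
  rcases le_or_gt (edist x y) r with hr | hr
  · exact ⟨y, hr, by rwa [edist_self]⟩
  rw [IsRiemannianManifold.out (I := 𝓡 m)] at h
  obtain ⟨γ, h0, h1, hγ, hlen⟩ := Manifold.exists_lt_of_riemannianEDist_lt h
  -- Along a path of length below `r + s` the distance from `x` takes the value `r`; the part of the
  -- path beyond that point is shorter than `s`.
  have hc : ContinuousOn (fun t => edist x (γ t)) (Set.Icc 0 1) :=
    continuous_const.edist continuous_id |>.comp_continuousOn hγ.continuousOn
  obtain ⟨t, ht, htr⟩ := intermediate_value_Icc zero_le_one hc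
    (show r ∈ Set.Icc (edist x (γ 0)) (edist x (γ 1)) by
      rw [h0, h1, edist_self]; exact ⟨zero_le, hr.le⟩)
  replace htr : edist x (γ t) = r := htr
  refine ⟨γ t, htr.le, ?_⟩
  have e1 : r ≤ Manifold.pathELength (𝓡 m) γ 0 t := by
    rw [← htr, IsRiemannianManifold.out (I := 𝓡 m)]
    exact Manifold.riemannianEDist_le_pathELength (hγ.mono (Set.Icc_subset_Icc_right ht.2)) h0 rfl
      ht.1
  have e2 : edist (γ t) y ≤ Manifold.pathELength (𝓡 m) γ t 1 := by
    rw [IsRiemannianManifold.out (I := 𝓡 m)]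
    exact Manifold.riemannianEDist_le_pathELength (hγ.mono (Set.Icc_subset_Icc_left ht.1)) rfl h1
      ht.2
  rw [← Manifold.pathELength_add ht.1 ht.2] at hlen
  exact lt_of_add_lt_add_left ((add_le_add e1 e2).trans_lt hlen)

lemma isClosed_edist_le (x₀ : M) (r : ℝ≥0∞) : IsClosed {x | edist x₀ x ≤ r} :=
  isClosed_le (continuous_const.edist continuous_id) continuous_const

/-- In a complete Riemannian manifold the closed balls are compact. -/
theorem isCompact_edist_le (m : ℕ) [ChartedSpace (EuclideanSpace ℝ (Fin m)) M]
    [RiemannianBundle (fun x : M => TangentSpace (𝓡 m) x)] [IsRiemannianManifold (𝓡 m) M]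
    [CompleteSpace M] (x₀ : M) (r : NNReal) :
    IsCompact {x | edist x₀ x ≤ r} := by
  have : LocallyCompactSpace M := ChartedSpace.locallyCompactSpace (EuclideanSpace ℝ (Fin m)) M
  set S : Set NNReal := {r | IsCompact {x : M | edist x₀ x ≤ r}} with hS
  have hdown : ∀ r ∈ S, ∀ r' ≤ r, r' ∈ S := by
    intro r hr r' hr'
    refine IsCompact.of_isClosed_subset hr (isClosed_edist_le x₀ r') fun x hx => ?_
    exact (show edist x₀ x ≤ r' from hx).trans (by exact_mod_cast hr')
  -- A compact ball lies in the interior of a compact set together with a `δ`-thickening, and the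
  -- length property puts the slightly larger ball inside that thickening.
  have hopen : IsOpen S := by
    rw [isOpen_iff_mem_nhds]
    intro r hr
    obtain ⟨K', hK', hKK'⟩ := exists_compact_superset (show IsCompact {x : M | edist x₀ x ≤ r} from hr)
    obtain ⟨δ, hδ, hthick⟩ := (show IsCompact {x : M | edist x₀ x ≤ r} from
      hr).exists_thickening_subset_open isOpen_interior hKK'
    have hmem : r + (δ / 2).toNNReal ∈ S := by
      refine IsCompact.of_isClosed_subset hK' (isClosed_edist_le x₀ _) fun x hx => ?_
      refine interior_subset (hthick ?_)
      rw [Metric.mem_thickening_iff_exists_edist_lt]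
      have hlt : edist x₀ x < r + ENNReal.ofReal δ := by
        refine lt_of_le_of_lt hx ?_
        rw [ENNReal.coe_add]
        refine ENNReal.add_lt_add_left ENNReal.coe_ne_top ?_
        exact (ENNReal.ofReal_lt_ofReal_iff hδ).2 (by linarith)
      obtain ⟨z, hz, hz'⟩ := exists_edist_le_edist_lt m (ENNReal.ofReal_pos.2 hδ) hlt
      exact ⟨z, hz, by rwa [edist_comm]⟩
    refine Filter.mem_of_superset (Iio_mem_nhds (show r < r + (δ / 2).toNNReal from ?_))
      fun r' hr' => hdown _ hmem r' (le_of_lt hr')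
    exact lt_add_of_pos_right _ (Real.toNNReal_pos.2 (by linarith))
  -- By the length property a finite net of a slightly smaller compact ball is a net of the larger
  -- one. Total boundedness and completeness then give compactness, and the connectedness of the
  -- half-line finishes.
  have hclosed : IsClosed S := by
    rw [← closure_subset_iff_isClosed]
    intro r hr
    refine isCompact_iff_totallyBounded_isComplete.2 ⟨?_, (isClosed_edist_le x₀ r).isComplete⟩
    rw [EMetric.totallyBounded_iff]
    intro ε hε
    obtain ⟨δ, hδ, hδε⟩ : ∃ δ : NNReal, 0 < δ ∧ (δ : ℝ≥0∞) < ε / 2 := by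
      obtain ⟨δ, h1, h2⟩ := ENNReal.lt_iff_exists_nnreal_btwn.1 (ENNReal.half_pos hε.ne')
      exact ⟨δ, by exact_mod_cast h1, h2⟩
    obtain ⟨r', hr', hd⟩ := Metric.mem_closure_iff.1 hr δ hδ
    have hlt : r < r' + δ := by
      rw [NNReal.dist_eq, abs_lt] at hd
      have := hd.2
      rw [← NNReal.coe_lt_coe]
      push_cast
      linarith
    obtain ⟨t, ht, hcov⟩ := EMetric.totallyBounded_iff.1
      (show IsCompact {x : M | edist x₀ x ≤ r'} from hr').totallyBounded (ε / 2)
      (ENNReal.half_pos hε.ne')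
    refine ⟨t, ht, fun x hx => ?_⟩
    obtain ⟨z, hz, hz'⟩ := exists_edist_le_edist_lt m (x := x₀) (y := x) (r := r') (s := δ)
      (by exact_mod_cast hδ) (lt_of_le_of_lt hx (by exact_mod_cast hlt))
    obtain ⟨w, hw, hzw⟩ := Set.mem_iUnion₂.1 (hcov hz)
    refine Set.mem_iUnion₂.2 ⟨w, hw, ?_⟩
    calc edist x w ≤ edist z x + edist z w := by
          rw [edist_comm z x]; exact edist_triangle _ _ _
      _ < ε / 2 + ε / 2 := ENNReal.add_lt_add (hz'.trans hδε) hzw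
      _ = ε := ENNReal.add_halves ε
  have h0 : (0 : NNReal) ∈ S := by
    have : {x : M | edist x₀ x ≤ ((0 : NNReal) : ℝ≥0∞)} = {x₀} := by
      ext x
      simp [eq_comm]
    simp only [hS, Set.mem_ofPred_eq, this]
    exact isCompact_singleton
  have huniv : S = Set.univ := IsClopen.eq_univ ⟨hclosed, hopen⟩ ⟨0, h0⟩
  have hr : r ∈ S := by rw [huniv]; exact Set.mem_univ r
  exact hr

/-- The cutoff function at distance `R` from `x₀`. -/
def cutoff (x₀ : M) {R : ℝ} (hR : 0 < R) (x : M) : ℝ := thickenedIndicator hR {x₀} x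

variable (x₀ : M) {R : ℝ} (hR : 0 < R)

lemma cutoff_nonneg (x : M) : 0 ≤ cutoff x₀ hR x := NNReal.coe_nonneg _

lemma cutoff_le_one (x : M) : cutoff x₀ hR x ≤ 1 := by
  exact_mod_cast thickenedIndicator_le_one hR {x₀} x

lemma lipschitzWith_cutoff : LipschitzWith R.toNNReal⁻¹ (cutoff x₀ hR) :=
  fun x y => lipschitzWith_thickenedIndicator hR {x₀} x y

lemma cutoff_eq_zero {x : M} (hx : ENNReal.ofReal R ≤ edist x₀ x) : cutoff x₀ hR x = 0 := by
  have : thickenedIndicator hR {x₀} x = 0 := by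
    refine thickenedIndicator_zero hR _ ?_
    rw [Metric.mem_thickening_iff_exists_edist_lt]
    rintro ⟨z, rfl, hz⟩
    rw [edist_comm] at hz
    exact absurd hz (not_lt.2 hx)
  rw [cutoff, this, NNReal.coe_zero]

/-- Completeness of `M` enters the integral estimates through this property. -/
lemma hasCompactSupport_cutoff (m : ℕ) [ChartedSpace (EuclideanSpace ℝ (Fin m)) M]
    [RiemannianBundle (fun x : M => TangentSpace (𝓡 m) x)] [IsRiemannianManifold (𝓡 m) M]
    [CompleteSpace M] : HasCompactSupport (cutoff x₀ hR) :=
  HasCompactSupport.intro (isCompact_edist_le m x₀ R.toNNReal) fun _ hx =>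
    cutoff_eq_zero x₀ hR (not_le.1 hx).le

lemma cutoff_self : cutoff x₀ hR x₀ = 1 := by
  have : thickenedIndicator hR {x₀} x₀ = 1 := thickenedIndicator_one hR _ (Set.mem_singleton x₀)
  rw [cutoff, this, NNReal.coe_one]

/-- The cutoff has value 1 at `x₀` and Lipschitz constant `1 / (k + 1)`, so it is at least `1 -
d(x₀, x) / (k + 1)`. -/
lemma tendsto_cutoff {x : M} (hx : edist x₀ x ≠ ⊤) :
    Filter.Tendsto (fun k : ℕ => cutoff x₀ (R := (k : ℝ) + 1) (by positivity) x) Filter.atTop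
      (𝓝 1) := by
  have hlow : ∀ k : ℕ, 1 - (edist x₀ x).toReal * (1 / ((k : ℝ) + 1))
      ≤ cutoff x₀ (R := (k : ℝ) + 1) (by positivity) x := by
    intro k
    have hk : (0 : ℝ) < (k : ℝ) + 1 := by positivity
    have h := lipschitzWith_cutoff x₀ hk x₀ x
    rw [cutoff_self, edist_dist, Real.dist_eq, ← ENNReal.ofReal_toReal hx,
      ← ENNReal.ofReal_coe_nnreal, ← ENNReal.ofReal_mul (NNReal.coe_nonneg _),
      ENNReal.ofReal_le_ofReal_iff (by positivity), NNReal.coe_inv, Real.coe_toNNReal _ hk.le] at h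
    have := (abs_le.1 h).2
    rw [one_div, mul_comm]
    linarith
  have hlim : Filter.Tendsto (fun k : ℕ => 1 - (edist x₀ x).toReal * (1 / ((k : ℝ) + 1)))
      Filter.atTop (𝓝 1) := by
    simpa using (tendsto_one_div_add_atTop_nhds_zero_nat.const_mul (edist x₀ x).toReal).const_sub 1
  exact tendsto_of_tendsto_of_tendsto_of_le_of_le hlim tendsto_const_nhds hlow
    fun k => cutoff_le_one x₀ _ x

end HopfRinow

/-! ### Leibniz rules -/

section Leibniz

variable {m n : ℕ}
  {M : Type*} [TopologicalSpace M] [ChartedSpace (EuclideanSpace ℝ (Fin m)) M]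
  {N : Type*} [TopologicalSpace N] [ChartedSpace (EuclideanSpace ℝ (Fin n)) N]

variable (m) in
/-- A function is smooth if all its representatives are. -/
def SmoothFn (ρ : M → ℝ) : Prop :=
  ∀ x₀ : M, ContDiffOn ℝ ∞ (fun y => ρ ((extChartAt (𝓡 m) x₀).symm y)) (extChartAt (𝓡 m) x₀).target

lemma SmoothFn.contDiffAt {ρ : M → ℝ} (hρ : SmoothFn m ρ) {x₀ q : M}
    (hq : q ∈ (chartAt (EuclideanSpace ℝ (Fin m)) x₀).source) :
    ContDiffAt ℝ ∞ (fun y => ρ ((extChartAt (𝓡 m) x₀).symm y)) (extChartAt (𝓡 m) x₀ q) :=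
  (hρ x₀).contDiffAt ((isOpen_extChartAt_target x₀).mem_nhds (extChartAt_mem_target hq))

lemma SmoothFn.continuous {ρ : M → ℝ} (hρ : SmoothFn m ρ) : Continuous ρ := by
  rw [continuous_iff_continuousAt]
  intro q
  have hq := mem_chart_source (EuclideanSpace ℝ (Fin m)) q
  have h := (hρ.contDiffAt hq).continuousAt.comp (continuousAt_extChartAt (I := 𝓡 m) q)
  refine h.congr ?_
  filter_upwards [(chartAt (EuclideanSpace ℝ (Fin m)) q).open_source.mem_nhds hq] with z hz
  exact congrArg ρ (extChartAt_symm_apply hz)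

variable [IsManifold (𝓡 m) ∞ M] [IsManifold (𝓡 n) ∞ N]

lemma smoothFn_of_contMDiff {ρ : M → ℝ} (hρ : ContMDiff (𝓡 m) 𝓘(ℝ, ℝ) ∞ ρ) : SmoothFn m ρ := by
  intro x₀
  rw [← contMDiffOn_iff_contDiffOn]
  exact hρ.comp_contMDiffOn (contMDiffOn_extChartAt_symm x₀)

variable {φ : M → N} {V Z : ∀ x : M, TangentSpace (𝓡 n) (φ x)} {ρ : M → ℝ}

lemma srep_smul (x₀ : M) (p₀ : N) (ρ : M → ℝ) (V : ∀ x : M, TangentSpace (𝓡 n) (φ x)) :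
    srep x₀ p₀ φ (fun q => ρ q • V q)
      = fun y => ρ ((extChartAt (𝓡 m) x₀).symm y) • srep x₀ p₀ φ V y := by
  ext1 y
  simp only [srep, map_smul]

lemma SmoothSec.smul (hV : SmoothSec m n φ V) (hρ : SmoothFn m ρ) :
    SmoothSec m n φ (fun q => ρ q • V q) := by
  intro x₀ p₀
  rw [srep_smul]
  exact ((hρ x₀).mono Set.inter_subset_left).smul (hV x₀ p₀)

variable (m) in
/-- The differential of a function. -/
def dfn (ρ : M → ℝ) (q : M) (u : TangentSpace (𝓡 m) q) : ℝ :=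
  fderiv ℝ (fun y => ρ ((extChartAt (𝓡 m) q).symm y)) (extChartAt (𝓡 m) q q) (coords q q u)

lemma sum_dfn_eq_zero {ι : Type*} {s : Finset ι} {ρ : ι → M → ℝ} (hρ : ∀ i, SmoothFn m (ρ i)) {q : M}
    (hsum : ∀ᶠ z in 𝓝 q, ∑ i ∈ s, ρ i z = 1) (u : TangentSpace (𝓡 m) q) :
    ∑ i ∈ s, dfn m (ρ i) q u = 0 := by
  have hq := mem_chart_source (EuclideanSpace ℝ (Fin m)) q
  have h1 : (fun y => ∑ i ∈ s, ρ i ((extChartAt (𝓡 m) q).symm y))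
      =ᶠ[𝓝 (extChartAt (𝓡 m) q q)] fun _ => (1 : ℝ) := by
    have hc : ContinuousAt (extChartAt (𝓡 m) q).symm (extChartAt (𝓡 m) q q) :=
      continuousAt_extChartAt_symm q
    have h2 := hc.tendsto
    rw [extChartAt_symm_apply hq] at h2
    exact h2 hsum
  have h2 := fderiv_fun_sum (𝕜 := ℝ) (u := s) (x := extChartAt (𝓡 m) q q)
    (A := fun i y => ρ i ((extChartAt (𝓡 m) q).symm y))
    (fun i _ => ((hρ i).contDiffAt hq).differentiableAt (by simp))
  rw [h1.fderiv_eq, fderiv_fun_const] at h2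
  have h3 := congrArg (fun L => L (coords q q u)) h2
  simp only [Pi.zero_apply, zero_apply, sum_apply] at h3
  exact h3.symm

variable [RiemannianBundle (fun p : N => TangentSpace (𝓡 n) p)]
  [IsContMDiffRiemannianBundle (𝓡 n) ∞ (EuclideanSpace ℝ (Fin n))
      (fun p : N => TangentSpace (𝓡 n) p)]

lemma SmoothSec.smoothFn_inner (hφ : ContMDiff (𝓡 m) (𝓡 n) ∞ φ) (hV : SmoothSec m n φ V)
    (hZ : SmoothSec m n φ Z) : SmoothFn m (fun q => inner ℝ (V q) (Z q)) := by
  intro x₀ y hy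
  set p₀ := φ ((extChartAt (𝓡 m) x₀).symm y) with hp₀
  have hmem : y ∈ cdom (m := m) (n := n) x₀ p₀ φ := ⟨hy, mem_chart_source _ p₀⟩
  have hs : ContDiffOn ℝ ∞ (fun y => metricC p₀ (crep x₀ p₀ φ y) (srep x₀ p₀ φ V y)
      (srep x₀ p₀ φ Z y)) (cdom (m := m) (n := n) x₀ p₀ φ) :=
    (((isMetricOn_metricC p₀).smooth.comp (smooth_crep hφ x₀ p₀) (mapsTo_crep x₀ p₀ φ)).clm_apply
      (hV x₀ p₀)).clm_apply (hZ x₀ p₀)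
  have hnhds := (isOpen_cdom (n := n) hφ.continuous x₀ p₀).mem_nhds hmem
  refine ((hs.contDiffAt hnhds).congr_of_eventuallyEq ?_).contDiffWithinAt
  filter_upwards [hnhds] with z hz
  obtain ⟨q, h1, h2, rfl⟩ := exists_of_mem_cdom hz
  rw [← inner_eq_srep h1 h2, extChartAt_symm_apply h1]

lemma SmoothSec.continuous_norm (hφ : ContMDiff (𝓡 m) (𝓡 n) ∞ φ) (hV : SmoothSec m n φ V) :
    Continuous fun q => ‖V q‖ := by
  have h := (hV.smoothFn_inner hφ hV).continuous.sqrt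
  refine h.congr fun q => ?_
  rw [real_inner_self_eq_norm_sq, Real.sqrt_sq (norm_nonneg _)]

lemma covDeriv_smul (hφ : ContMDiff (𝓡 m) (𝓡 n) ∞ φ) (hV : SmoothSec m n φ V) (hρ : SmoothFn m ρ)
    (q : M) (u : TangentSpace (𝓡 m) q) :
    covDeriv m n φ (fun q => ρ q • V q) q u = dfn m ρ q u • V q + ρ q • covDeriv m n φ V q u := by
  have h1 := mem_chart_source (EuclideanSpace ℝ (Fin m)) q
  have h2 := mem_chart_source (EuclideanSpace ℝ (Fin n)) (φ q)
  have hVd := (hV.contDiffAt hφ h1 h2).differentiableAt (by simp)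
  have hρd := (hρ.contDiffAt h1).differentiableAt (by simp)
  apply coords_injective h2
  rw [coords_covDeriv hφ h1 h2 (((hV.smul hρ).contDiffAt hφ h1 h2).differentiableAt (by simp)),
    map_add, map_smul, map_smul, coords_covDeriv hφ h1 h2 hVd, cov_apply, cov_apply, srep_smul,
    fderiv_fun_smul hρd hVd, ← srep_extChartAt (φ q) V h1]
  simp only [add_apply, smul_apply, ContinuousLinearMap.smulRight_apply, map_smul, smul_add,
    extChartAt_symm_apply h1, dfn]
  abel

lemma dfn_inner (hφ : ContMDiff (𝓡 m) (𝓡 n) ∞ φ) (hV : SmoothSec m n φ V) (hZ : SmoothSec m n φ Z)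
    (q : M) (u : TangentSpace (𝓡 m) q) :
    dfn m (fun q => inner ℝ (V q) (Z q)) q u
      = inner ℝ (covDeriv m n φ V q u) (Z q) + inner ℝ (V q) (covDeriv m n φ Z q u) := by
  have h1 := mem_chart_source (EuclideanSpace ℝ (Fin m)) q
  have h2 := mem_chart_source (EuclideanSpace ℝ (Fin n)) (φ q)
  have hVd := (hV.contDiffAt hφ h1 h2).differentiableAt (by simp)
  have hZd := (hZ.contDiffAt hφ h1 h2).differentiableAt (by simp)
  have hnhds := (isOpen_cdom (n := n) hφ.continuous q (φ q)).mem_nhds (mem_cdom h1 h2)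
  have he : (fun y => inner ℝ (V ((extChartAt (𝓡 m) q).symm y)) (Z ((extChartAt (𝓡 m) q).symm y)))
      =ᶠ[𝓝 (extChartAt (𝓡 m) q q)] fun y => metricC (φ q) (crep q (φ q) φ y)
        (srep q (φ q) φ V y) (srep q (φ q) φ Z y) := by
    filter_upwards [hnhds] with z hz
    obtain ⟨q', h1', h2', rfl⟩ := exists_of_mem_cdom hz
    rw [← inner_eq_srep h1' h2', extChartAt_symm_apply h1']
  have hmaps : crep q (φ q) φ (extChartAt (𝓡 m) q q) ∈ (extChartAt (𝓡 n) (φ q)).target :=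
    mapsTo_crep q (φ q) φ (mem_cdom h1 h2)
  rw [dfn, he.fderiv_eq, (isMetricOn_metricC (φ q)).fderiv_inner hmaps
    ((contDiffAt_crep hφ h1 h2).differentiableAt (by simp)) hVd hZd,
    inner_eq_metricC h2, inner_eq_metricC h2, coords_covDeriv hφ h1 h2 hVd,
    coords_covDeriv hφ h1 h2 hZd, crep_extChartAt (φ q) h1, srep_extChartAt (φ q) V h1,
    srep_extChartAt (φ q) Z h1]

lemma covDeriv_eq_zero {q : M} (hV : ∀ᶠ z in 𝓝 q, V z = 0) (u : TangentSpace (𝓡 m) q) :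
    covDeriv m n φ V q u = 0 := by
  have hq := mem_chart_source (EuclideanSpace ℝ (Fin m)) q
  have h1 : (fun y => coords (φ q) (φ ((extChartAt (𝓡 m) q).symm y))
      (V ((extChartAt (𝓡 m) q).symm y))) =ᶠ[𝓝 (extChartAt (𝓡 m) q q)] fun _ => 0 := by
    have h2 := (continuousAt_extChartAt_symm (I := 𝓡 m) q).tendsto
    rw [extChartAt_symm_apply hq] at h2
    filter_upwards [h2 hV] with y hy
    have hy' : V ((extChartAt (𝓡 m) q).symm y) = 0 := hy
    rw [hy', map_zero]
  rw [covDeriv, h1.fderiv_eq, christoffel_eq, hV.self_of_nhds]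
  simp [constField]

variable [RiemannianBundle (fun x : M => TangentSpace (𝓡 m) x)]

lemma gradInner_smul (hφ : ContMDiff (𝓡 m) (𝓡 n) ∞ φ) (V : ∀ x : M, TangentSpace (𝓡 n) (φ x))
    (hZ : SmoothSec m n φ Z) (hρ : SmoothFn m ρ) (q : M) :
    gradInner m n φ V (fun q => ρ q • Z q) q = ρ q * gradInner m n φ V Z q
      + ∑ i, dfn m ρ q (frame m q i) * inner ℝ (covDeriv m n φ V q (frame m q i)) (Z q) := by
  rw [gradInner, gradInner, Finset.mul_sum, ← Finset.sum_add_distrib]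
  refine Finset.sum_congr rfl fun i _ => ?_
  rw [covDeriv_smul hφ hZ hρ, inner_add_right, real_inner_smul_right, real_inner_smul_right]
  ring

lemma gradInner_eq_zero {q : M} (hZ : ∀ᶠ z in 𝓝 q, Z z = 0) : gradInner m n φ V Z q = 0 := by
  rw [gradInner]
  exact Finset.sum_eq_zero fun i _ => by rw [covDeriv_eq_zero hZ, inner_zero_right]

lemma sum_inner_covDeriv_sq_le (φ : M → N) (V Z : ∀ x : M, TangentSpace (𝓡 n) (φ x)) (q : M) :
    ∑ i, inner ℝ (covDeriv m n φ V q (frame m q i)) (Z q) ^ 2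
      ≤ normSqCovDeriv m n φ V q * ‖Z q‖ ^ 2 := by
  rw [normSqCovDeriv, Finset.sum_mul]
  refine Finset.sum_le_sum fun i _ => ?_
  rw [← mul_pow, ← sq_abs]
  gcongr
  exact abs_real_inner_le_norm _ _

end Leibniz

/-! ### Integration by parts with a Lipschitz cutoff function -/

/-- The squared length of a covector as a trace, which can then be evaluated in an orthonormal
frame. -/
lemma IsMetricOn.metric_sharp_self {m : ℕ} {g : Eucl m → Eucl m →L[ℝ] Eucl m →L[ℝ] ℝ}
    {Ω : Set (Eucl m)} (hg : IsMetricOn g Ω) {y : Eucl m} (hy : y ∈ Ω) (θ : Eucl m →L[ℝ] ℝ) :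
    g y (sharp g y θ) (sharp g y θ) = mtrace g y (θ.smulRight θ) := by
  rw [hg.apply_sharp hy, mtrace]
  conv_lhs => rw [← sum_proj_smul_single (sharp g y θ), map_sum]
  refine Finset.sum_congr rfl fun j _ => ?_
  rw [map_smul, ContinuousLinearMap.smulRight_apply, smul_apply, dualVec, hg.sharp_symm hy]
  simp [mul_comm]

section IntegrationByParts

variable {m n : ℕ}
  {M : Type*} [EMetricSpace M] [MeasurableSpace M] [BorelSpace M]
  [ChartedSpace (EuclideanSpace ℝ (Fin m)) M] [IsManifold (𝓡 m) ∞ M]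
  [RiemannianBundle (fun x : M => TangentSpace (𝓡 m) x)]
  [IsContMDiffRiemannianBundle (𝓡 m) ∞ (EuclideanSpace ℝ (Fin m))
      (fun x : M => TangentSpace (𝓡 m) x)]
  [IsRiemannianManifold (𝓡 m) M]
  {N : Type*} [TopologicalSpace N] [ChartedSpace (EuclideanSpace ℝ (Fin n)) N]
  [IsManifold (𝓡 n) ∞ N]
  [RiemannianBundle (fun p : N => TangentSpace (𝓡 n) p)]
  [IsContMDiffRiemannianBundle (𝓡 n) ∞ (EuclideanSpace ℝ (Fin n))
      (fun p : N => TangentSpace (𝓡 n) p)]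
  {φ : M → N} {V Y Z : ∀ x : M, TangentSpace (𝓡 n) (φ x)}

variable (m n) in
/-- The divergence of the one-form `⟨∇̄V, Z⟩`. -/
def divPair (φ : M → N) (V Z : ∀ x : M, TangentSpace (𝓡 n) (φ x)) (q : M) : ℝ :=
  -inner ℝ (roughLaplacian m n φ V q) (Z q) + gradInner m n φ V Z q

lemma continuous_divPair (hφ : ContMDiff (𝓡 m) (𝓡 n) ∞ φ) (hV : SmoothSec m n φ V)
    (hZ : SmoothSec m n φ Z) : Continuous (divPair m n φ V Z) :=
  ((hV.roughLaplacian hφ).smoothFn_inner hφ hZ).continuous.neg.add (continuous_gradInner hφ hV hZ)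

lemma continuous_normSqCovDeriv (hφ : ContMDiff (𝓡 m) (𝓡 n) ∞ φ) (hV : SmoothSec m n φ V) :
    Continuous (normSqCovDeriv m n φ V) :=
  (continuous_gradInner hφ hV hV).congr fun q => gradInner_self φ V q

lemma normSqCovDeriv_nonneg (φ : M → N) (V : ∀ x : M, TangentSpace (𝓡 n) (φ x)) (q : M) :
    0 ≤ normSqCovDeriv m n φ V q := Finset.sum_nonneg fun _ _ => sq_nonneg _

/-- Integration by parts for a section supported in one chart. The global constant `C'` only makes
`ζ` Lipschitz, while `σ` records its local slope and is what enters the estimate: two nearby values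
of `σ` add up to `|dζ| ≤ 2σ`. -/
lemma abs_integral_divPair_le_of_chart (hφ : ContMDiff (𝓡 m) (𝓡 n) ∞ φ) (hV : SmoothSec m n φ V)
    (hY : SmoothSec m n φ Y) {x₀ : M} {p₀ : N} {y₀ : Eucl m} {r : ℝ} {C : NNReal}
    (hball : Metric.ball y₀ r ⊆ cdom (m := m) (n := n) x₀ p₀ φ)
    (hLip : LipschitzOnWith C (extChartAt (𝓡 m) x₀).symm (Metric.ball y₀ r))
    {K : Set (Eucl m)} (hK : IsCompact K) (hKb : K ⊆ Metric.ball y₀ r)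
    (hY0 : ∀ q ∉ (extChartAt (𝓡 m) x₀).symm '' K, Y q = 0)
    {ζ σ : M → ℝ} {C' : NNReal} (hζL : LipschitzWith C' ζ) (hσ : Continuous σ)
    (hσ0 : ∀ x, 0 ≤ σ x)
    (hζ : ∀ x y, edist (ζ x) (ζ y) ≤ ENNReal.ofReal (σ x + σ y) * edist x y) :
    |∫ q, ζ q * divPair m n φ V Y q ∂(riemannianVolume m M)|
      ≤ ∫ q, 2 * σ q * (√(normSqCovDeriv m n φ V q) * ‖Y q‖) ∂(riemannianVolume m M) := by
  set U := cdom (m := m) (n := n) x₀ p₀ φ with hU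
  set f := crep (m := m) (n := n) x₀ p₀ φ with hf
  set s := srep (m := m) (n := n) x₀ p₀ φ V with hs
  set t := srep (m := m) (n := n) x₀ p₀ φ Y with ht
  set g := metricC (n := m) x₀ with hgdef
  set h := metricC (n := n) p₀ with hhdef
  have hKU : K ⊆ U := hKb.trans hball
  have hg : IsMetricOn g U := isMetricOn_cdom hφ.continuous x₀ p₀
  have hh : IsMetricOn h (extChartAt (𝓡 n) p₀).target := isMetricOn_metricC p₀
  have hfs : ContDiffOn ℝ ∞ f U := smooth_crep hφ x₀ p₀
  have hfU : Set.MapsTo f U (extChartAt (𝓡 n) p₀).target := mapsTo_crep x₀ p₀ φ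
  have hT := (isOpen_extChartAt_target (I := 𝓡 m) x₀)
  have hKimg : IsClosed ((extChartAt (𝓡 m) x₀).symm '' K) :=
    (hK.image_of_continuousOn ((continuousOn_extChartAt_symm x₀).mono
      (hKU.trans Set.inter_subset_left))).isClosed
  have hnotin : ∀ y ∈ (extChartAt (𝓡 m) x₀).target, y ∉ K →
      (extChartAt (𝓡 m) x₀).symm y ∉ (extChartAt (𝓡 m) x₀).symm '' K := by
    rintro y hy hyK ⟨z, hz, hzy⟩
    exact hyK ((extChartAt (𝓡 m) x₀).symm.injOn (hKU hz).1 hy hzy ▸ hz)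
  set P := pairForm h f (cov (chris h) f s) t with hP
  have hPs : ContDiffOn ℝ ∞ P U :=
    smooth_pairForm hh hfs hfU (smooth_cov_srep hφ hV x₀ p₀) (hY x₀ p₀)
  -- The representatives have no meaning outside `U`. Since `Y` vanishes off the image of `K`,
  -- cutting `P` off by an indicator does not change it on `U`, so `θ` is smooth there and has
  -- support in `K`.
  set θ := K.indicator P with hθ
  have hθP : ∀ y ∈ U, θ y = P y := by
    intro y hy
    by_cases hyK : y ∈ K
    · exact Set.indicator_of_mem hyK _
    · rw [hθ, Set.indicator_of_notMem hyK]
      have : t y = 0 := by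
        rw [ht, srep, hY0 _ (hnotin y hy.1 hyK), map_zero]
      ext a
      rw [hP, pairForm_apply, this, map_zero, zero_apply]
  have hθs : ContDiffOn ℝ ∞ θ U := hPs.congr hθP
  have hθt : tsupport θ ⊆ K := closure_minimal Set.support_indicator_subset hK.isClosed
  have hθc : HasCompactSupport θ := hK.of_isClosed_subset (isClosed_tsupport _) hθt
  -- The representative of `ζ` is Lipschitz only on the ball; it is extended to a Lipschitz function
  -- on the whole model space.
  obtain ⟨e, heL, heq⟩ := (hζL.comp_lipschitzOnWith hLip).extend_real
  have hparts := hg.integral_lipschitz_mul_div hθs hθc (hθt.trans hKU) heL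
  have hdiv0 : ∀ q ∉ (extChartAt (𝓡 m) x₀).symm '' K, divPair m n φ V Y q = 0 := by
    intro q hq
    have h0 : ∀ᶠ z in 𝓝 q, Y z = 0 := by
      filter_upwards [hKimg.isOpen_compl.mem_nhds hq] with z hz using hY0 z hz
    rw [divPair, gradInner_eq_zero h0, h0.self_of_nhds, inner_zero_right, neg_zero, add_zero]
  have hsrc : ∀ q ∉ (chartAt (EuclideanSpace ℝ (Fin m)) x₀).source,
      q ∉ (extChartAt (𝓡 m) x₀).symm '' K := by
    rintro q hq ⟨y, hy, rfl⟩
    exact hq (mem_chart_of_mem_target (hKU hy).1)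
  have hL : ∫ q, ζ q * divPair m n φ V Y q ∂(riemannianVolume m M)
      = ∫ y, e y * (density g y * mtrace g y (covOne (chris g) θ y)) := by
    rw [integral_chart (u := fun q => ζ q * divPair m n φ V Y q) x₀ (hζL.continuous.mul (continuous_divPair hφ hV hY)).measurable
      (fun q hq => by rw [hdiv0 q (hsrc q hq), mul_zero]), ← integral_indicator hT.measurableSet]
    refine integral_congr_ae (Filter.Eventually.of_forall fun y => ?_)
    by_cases hyK : y ∈ K
    · have hyU := hKU hyK
      have hθe : θ =ᶠ[𝓝 y] P := by
        filter_upwards [hg.isOpen.mem_nhds hyU] with z hz using hθP z hz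
      have hc : covOne (chris g) θ y = covOne (chris g) P y := by
        rw [covOne, covOne, hθe.eq_of_nhds, hθe.fderiv_eq]
      have hm := mtrace_covOne_pairForm_cov hg hh hfs hfU (hV x₀ p₀) (hY x₀ p₀) hyU
      have hey : e y = ζ ((extChartAt (𝓡 m) x₀).symm y) := (heq (hKb hyK)).symm
      simp only [Set.indicator_of_mem hyU.1]
      rw [hc, hP, hm, hey]
      obtain ⟨q, h1, h2, rfl⟩ := exists_of_mem_cdom hyU
      rw [extChartAt_symm_apply h1, divPair, gradInner_eq hφ hV hY h1 h2,
        inner_eq_srep (V := roughLaplacian m n φ V) (Z := Y) h1 h2,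
        srep_extChartAt p₀ (roughLaplacian m n φ V) h1, coords_roughLaplacian hφ hV h1 h2]
      ring
    · have hθ0 : θ =ᶠ[𝓝 y] fun _ => 0 := by
        filter_upwards [hK.isClosed.isOpen_compl.mem_nhds hyK] with z hz
        exact Set.indicator_of_notMem hz _
      have hc : covOne (chris g) θ y = 0 := by
        rw [covOne, hθ0.eq_of_nhds, hθ0.fderiv_eq, fderiv_fun_const]
        simp
      have hm : mtrace g y (0 : Eucl m →L[ℝ] Eucl m →L[ℝ] ℝ) = 0 := by simp [mtrace]
      beta_reduce
      rw [hc, hm, mul_zero, mul_zero]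
      by_cases hyT : y ∈ (extChartAt (𝓡 m) x₀).target
      · simp only [Set.indicator_of_mem hyT]
        rw [hdiv0 _ (hnotin y hyT hyK), mul_zero, mul_zero]
      · rw [Set.indicator_of_notMem hyT]
  set G : M → ℝ := fun q => 2 * σ q * (√(normSqCovDeriv m n φ V q) * ‖Y q‖) with hG
  have hGc : Continuous G := (continuous_const.mul hσ).mul
    ((continuous_normSqCovDeriv hφ hV).sqrt.mul (hY.continuous_norm hφ))
  have hG0 : ∀ q ∉ (extChartAt (𝓡 m) x₀).symm '' K, G q = 0 := by
    intro q hq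
    simp only [hG]
    rw [hY0 q hq, norm_zero, mul_zero, mul_zero]
  have hGnn : ∀ q, 0 ≤ G q := fun q =>
    mul_nonneg (mul_nonneg zero_le_two (hσ0 q)) (mul_nonneg (Real.sqrt_nonneg _) (norm_nonneg _))
  have hR : ∫ q, G q ∂(riemannianVolume m M)
      = ∫ y, K.indicator (fun y => density g y * G ((extChartAt (𝓡 m) x₀).symm y)) y := by
    rw [integral_chart x₀ hGc.measurable (fun q hq => hG0 q (hsrc q hq)),
      ← integral_indicator hT.measurableSet]
    refine integral_congr_ae (Filter.Eventually.of_forall fun y => ?_)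
    by_cases hyK : y ∈ K
    · simp only [Set.indicator_of_mem hyK, Set.indicator_of_mem (hKU hyK).1, hgdef]
    · rw [Set.indicator_of_notMem hyK]
      by_cases hyT : y ∈ (extChartAt (𝓡 m) x₀).target
      · simp only [Set.indicator_of_mem hyT]
        rw [hG0 _ (hnotin y hyT hyK), mul_zero]
      · rw [Set.indicator_of_notMem hyT]
  rw [hL, hparts, abs_neg, hR, ← Real.norm_eq_abs]
  refine norm_integral_le_of_norm_le ?_ (Filter.Eventually.of_forall fun y => ?_)
  · rw [integrable_indicator_iff hK.measurableSet]
    refine ContinuousOn.integrableOn_compact hK ?_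
    exact (hg.smooth_density.continuousOn.mono hKU).mul (hGc.comp_continuousOn
      ((continuousOn_extChartAt_symm x₀).mono (hKU.trans Set.inter_subset_left)))
  by_cases hyK : y ∈ K
  · have hyU := hKU hyK
    rw [Set.indicator_of_mem hyK, norm_mul, Real.norm_of_nonneg (hg.density_pos hyU).le]
    refine mul_le_mul_of_nonneg_left ?_ (hg.density_pos hyU).le
    rw [Real.norm_eq_abs]
    -- Where `e` is not differentiable, `fderiv` is zero by convention and the bound is trivial.
    by_cases hd : DifferentiableAt ℝ e y
    swap
    · rw [fderiv_zero_of_not_differentiableAt hd, zero_apply, abs_zero]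
      exact hGnn _
    have hev : e =ᶠ[𝓝 y] fun z => ζ ((extChartAt (𝓡 m) x₀).symm z) := by
      filter_upwards [Metric.isOpen_ball.mem_nhds (hKb hyK)] with z hz using (heq hz).symm
    refine (abs_fderiv_le_of_edist_le hσ hσ0 hζ hyU.1 hev hd _).trans ?_
    rw [hθP y hyU]
    refine mul_le_mul_of_nonneg_left ?_ (mul_nonneg zero_le_two (hσ0 _))
    obtain ⟨q, h1, h2, hqy⟩ := exists_of_mem_cdom hyU
    subst hqy
    rw [extChartAt_symm_apply h1, hg.metric_sharp_self hyU, mtrace_metricC h1,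
      ← Real.sqrt_sq (norm_nonneg (Y q)), ← Real.sqrt_mul (normSqCovDeriv_nonneg φ V q)]
    refine Real.sqrt_le_sqrt ((Finset.sum_le_sum fun i _ => le_of_eq ?_).trans
      (sum_inner_covDeriv_sq_le φ V Y q))
    rw [ContinuousLinearMap.smulRight_apply, smul_apply, smul_eq_mul, ← sq, hP, pairForm_apply,
      inner_eq_metricC h2, coords_covDeriv hφ h1 h2 ((hV.contDiffAt hφ h1 h2).differentiableAt
        (by simp)), ← srep_extChartAt p₀ Y h1, ← crep_extChartAt p₀ h1]
  · rw [hθ, Set.indicator_of_notMem hyK, Set.indicator_of_notMem hyK]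
    simp

end IntegrationByParts

/-! ### Globalization by a partition of unity. -/

section GlobalIntegrationByParts

variable {m n : ℕ}
  {M : Type*} [EMetricSpace M] [SecondCountableTopology M] [MeasurableSpace M] [BorelSpace M]
  [ChartedSpace (EuclideanSpace ℝ (Fin m)) M] [IsManifold (𝓡 m) ∞ M]
  [RiemannianBundle (fun x : M => TangentSpace (𝓡 m) x)]
  [IsContMDiffRiemannianBundle (𝓡 m) ∞ (EuclideanSpace ℝ (Fin m))
      (fun x : M => TangentSpace (𝓡 m) x)]
  [IsRiemannianManifold (𝓡 m) M]
  {N : Type*} [TopologicalSpace N] [ChartedSpace (EuclideanSpace ℝ (Fin n)) N]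
  [IsManifold (𝓡 n) ∞ N]
  [RiemannianBundle (fun p : N => TangentSpace (𝓡 n) p)]
  [IsContMDiffRiemannianBundle (𝓡 n) ∞ (EuclideanSpace ℝ (Fin n))
      (fun p : N => TangentSpace (𝓡 n) p)]
  {φ : M → N} {V Z : ∀ x : M, TangentSpace (𝓡 n) (φ x)}

/-- The extra terms of the Leibniz rule contain the differentials of the `ρ i`, whose sum is the
differential of a locally constant function. -/
lemma sum_divPair_smul (hφ : ContMDiff (𝓡 m) (𝓡 n) ∞ φ) (V : ∀ x : M, TangentSpace (𝓡 n) (φ x))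
    (hZ : SmoothSec m n φ Z) {ι : Type*} {s : Finset ι} {ρ : ι → M → ℝ}
    (hρ : ∀ i, SmoothFn m (ρ i)) {q : M} (hsum : ∀ᶠ z in 𝓝 q, ∑ i ∈ s, ρ i z = 1) :
    ∑ i ∈ s, divPair m n φ V (fun q => ρ i q • Z q) q = divPair m n φ V Z q := by
  simp only [divPair]
  have h1 : ∀ i, -inner ℝ (roughLaplacian m n φ V q) (ρ i q • Z q)
      + gradInner m n φ V (fun q => ρ i q • Z q) q
      = ρ i q * (-inner ℝ (roughLaplacian m n φ V q) (Z q) + gradInner m n φ V Z q)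
      + ∑ j, dfn m (ρ i) q (frame m q j)
          * inner ℝ (covDeriv m n φ V q (frame m q j)) (Z q) := by
    intro i
    rw [gradInner_smul hφ V hZ (hρ i), real_inner_smul_right]
    ring
  rw [Finset.sum_congr rfl fun i _ => h1 i, Finset.sum_add_distrib, ← Finset.sum_mul,
    hsum.self_of_nhds, one_mul, Finset.sum_comm]
  simp only [← Finset.sum_mul, sum_dfn_eq_zero hρ hsum, zero_mul, Finset.sum_const_zero, add_zero]

/-- Factoring the difference of squares keeps a factor `η` in the slope of `η²`; this factor is what
later permits absorption by Young's inequality. -/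
lemma edist_sq_le {η : M → ℝ} {L : NNReal} (hη : LipschitzWith L η) (h0 : ∀ x, 0 ≤ η x) (x y : M) :
    edist (η x ^ 2) (η y ^ 2) ≤ ENNReal.ofReal (L * η x + L * η y) * edist x y := by
  have h1 : edist (η x ^ 2) (η y ^ 2) = ENNReal.ofReal (η x + η y) * edist (η x) (η y) := by
    rw [edist_dist, edist_dist, ← ENNReal.ofReal_mul (add_nonneg (h0 x) (h0 y)), Real.dist_eq,
      Real.dist_eq, sq_sub_sq, abs_mul, abs_of_nonneg (add_nonneg (h0 x) (h0 y))]
  rw [h1, ← mul_add, mul_comm (L : ℝ), ENNReal.ofReal_mul (add_nonneg (h0 x) (h0 y)),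
    ENNReal.ofReal_coe_nnreal, mul_assoc]
  gcongr
  exact hη x y

lemma lipschitzWith_sq {η : M → ℝ} {L : NNReal} (hη : LipschitzWith L η) (h0 : ∀ x, 0 ≤ η x)
    (h1 : ∀ x, η x ≤ 1) : LipschitzWith (2 * L) fun q => η q ^ 2 := by
  intro x y
  refine (edist_sq_le hη h0 x y).trans ?_
  gcongr
  rw [← ENNReal.ofReal_coe_nnreal]
  refine ENNReal.ofReal_le_ofReal ?_
  push_cast
  nlinarith [h1 x, h1 y, L.coe_nonneg]

lemma integrable_mul_of_hasCompactSupport {η D : M → ℝ} (hη : Continuous η)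
    (hc : HasCompactSupport η) (hD : Continuous D) :
    Integrable (fun q => η q * D q) (riemannianVolume m M) :=
  (hη.mul hD).integrable_of_hasCompactSupport hc.mul_right

/-- Integration by parts against the square of a compactly supported Lipschitz function. -/
theorem abs_integral_sq_mul_divPair_le (hφ : ContMDiff (𝓡 m) (𝓡 n) ∞ φ)
    (hV : SmoothSec m n φ V) (hZ : SmoothSec m n φ Z) {η : M → ℝ} {L : NNReal}
    (hη : LipschitzWith L η) (h0 : ∀ x, 0 ≤ η x) (h1 : ∀ x, η x ≤ 1) (hc : HasCompactSupport η) :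
    |∫ q, η q ^ 2 * divPair m n φ V Z q ∂(riemannianVolume m M)|
      ≤ ∫ q, 2 * (L * η q) * (√(normSqCovDeriv m n φ V q) * ‖Z q‖) ∂(riemannianVolume m M) := by
  have : LocallyCompactSpace M := ChartedSpace.locallyCompactSpace (EuclideanSpace ℝ (Fin m)) M
  have hball : ∀ x : M, ∃ r > 0, ∃ C : NNReal,
      Metric.ball (extChartAt (𝓡 m) x x) r ⊆ cdom (m := m) (n := n) x (φ x) φ ∧
      LipschitzOnWith C (extChartAt (𝓡 m) x).symm (Metric.ball (extChartAt (𝓡 m) x x) r) :=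
    fun x => exists_ball_lipschitzOn
      ((isOpen_cdom (m := m) (n := n) hφ.continuous x (φ x)).mem_nhds
        (mem_cdom (mem_chart_source _ x) (mem_chart_source _ (φ x)))) Set.inter_subset_left
  choose r hr C hrb hrL using hball
  -- Half the radius is taken so that the corresponding closed ball is a compact subset of the ball
  -- on which the inverse chart is Lipschitz.
  set U : M → Set M := fun x => (chartAt (EuclideanSpace ℝ (Fin m)) x).source ∩
    extChartAt (𝓡 m) x ⁻¹' Metric.ball (extChartAt (𝓡 m) x x) (r x / 2) with hU
  have hUo : ∀ x, IsOpen (U x) := fun x => by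
    simp only [hU]
    rw [← extChartAt_source (𝓡 m) x]
    exact (continuousOn_extChartAt x).isOpen_inter_preimage (isOpen_extChartAt_source x)
      Metric.isOpen_ball
  have hUx : ∀ x, x ∈ U x := fun x =>
    ⟨mem_chart_source _ x, Metric.mem_ball_self (half_pos (hr x))⟩
  obtain ⟨t, -, htc⟩ := hc.isCompact.elim_nhds_subcover U fun x _ => (hUo x).mem_nhds (hUx x)
  obtain ⟨f, hf⟩ := SmoothPartitionOfUnity.exists_isSubordinate (𝓡 m) hc.isCompact.isClosed
    (fun i : t => U i) (fun i => hUo i) (by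
      intro x hx
      obtain ⟨i, hi, hxi⟩ := Set.mem_iUnion₂.1 (htc hx)
      exact Set.mem_iUnion.2 ⟨⟨i, hi⟩, hxi⟩)
  have hfs : ∀ i, SmoothFn m (f i) := fun i => smoothFn_of_contMDiff (f i).contMDiff
  have hYs : ∀ i, SmoothSec m n φ (fun q => f i q • Z q) := fun i => hZ.smul (hfs i)
  have hsum : ∀ z ∈ tsupport η, ∑ i, f i z = 1 := by
    intro z hz
    rw [← finsum_eq_sum_of_fintype]
    exact f.sum_eq_one hz
  have hle : ∀ z, ∑ i, f i z ≤ 1 := by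
    intro z
    rw [← finsum_eq_sum_of_fintype]
    exact f.sum_le_one z
  have hsplit : ∀ q, η q ^ 2 * divPair m n φ V Z q
      = ∑ i, η q ^ 2 * divPair m n φ V (fun q => f i q • Z q) q := by
    intro q
    rw [← Finset.mul_sum]
    by_cases hq : η q = 0
    · rw [hq, zero_pow two_ne_zero, zero_mul, zero_mul]
    · have hev : ∀ᶠ z in 𝓝 q, ∑ i, f i z = 1 := by
        filter_upwards [(hη.continuous.isOpen_support).mem_nhds hq] with z hz
        exact hsum z (subset_tsupport η hz)
      rw [sum_divPair_smul hφ V hZ hfs hev]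
  have hc2 : ∀ D : M → ℝ, Continuous D → Integrable (fun q => η q ^ 2 * D q)
      (riemannianVolume m M) := by
    intro D hD
    have h := integrable_mul_of_hasCompactSupport (m := m) hη.continuous hc (hη.continuous.mul hD)
    refine h.congr (Filter.Eventually.of_forall fun q => ?_)
    simp only [Pi.mul_apply]
    ring
  have hc1 : ∀ D : M → ℝ, Continuous D → Integrable (fun q => 2 * (L * η q) * D q)
      (riemannianVolume m M) := by
    intro D hD
    have h := (integrable_mul_of_hasCompactSupport (m := m) hη.continuous hc hD).const_mul (2 * L)
    refine h.congr (Filter.Eventually.of_forall fun q => ?_)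
    ring
  have hζL := lipschitzWith_sq hη h0 h1
  have hloc : ∀ i, |∫ q, η q ^ 2 * divPair m n φ V (fun q => f i q • Z q) q
        ∂(riemannianVolume m M)|
      ≤ ∫ q, 2 * (L * η q) * (√(normSqCovDeriv m n φ V q) * ‖f i q • Z q‖)
        ∂(riemannianVolume m M) := by
    intro i
    refine abs_integral_divPair_le_of_chart hφ hV (hYs i) (hrb i) (hrL i)
      (isCompact_closedBall (extChartAt (𝓡 m) (i : M) i) (r i / 2))
      (Metric.closedBall_subset_ball (half_lt_self (hr i))) ?_ hζL
      (continuous_const.mul hη.continuous) (fun x => mul_nonneg L.coe_nonneg (h0 x))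
      (edist_sq_le hη h0)
    intro q hq
    have : f i q = 0 := by
      by_contra hne
      have hmem : q ∈ U i := hf i (subset_tsupport _ hne)
      exact hq ⟨extChartAt (𝓡 m) (i : M) q, Metric.ball_subset_closedBall hmem.2,
        extChartAt_symm_apply hmem.1⟩
    rw [this, zero_smul]
  have hcont : Continuous fun q => √(normSqCovDeriv m n φ V q) * ‖Z q‖ :=
    (continuous_normSqCovDeriv hφ hV).sqrt.mul (hZ.continuous_norm hφ)
  have hcontY : ∀ i, Continuous fun q => √(normSqCovDeriv m n φ V q) * ‖f i q • Z q‖ := fun i =>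
    (continuous_normSqCovDeriv hφ hV).sqrt.mul ((hYs i).continuous_norm hφ)
  calc |∫ q, η q ^ 2 * divPair m n φ V Z q ∂(riemannianVolume m M)|
      = |∑ i, ∫ q, η q ^ 2 * divPair m n φ V (fun q => f i q • Z q) q
          ∂(riemannianVolume m M)| := by
        rw [← integral_finsetSum _ fun i _ => hc2 _ (continuous_divPair hφ hV (hYs i))]
        simp only [hsplit]
    _ ≤ ∑ i, ∫ q, 2 * (L * η q) * (√(normSqCovDeriv m n φ V q) * ‖f i q • Z q‖)
          ∂(riemannianVolume m M) :=
        (Finset.abs_sum_le_sum_abs _ _).trans (Finset.sum_le_sum fun i _ => hloc i)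
    _ = ∫ q, ∑ i, 2 * (L * η q) * (√(normSqCovDeriv m n φ V q) * ‖f i q • Z q‖)
          ∂(riemannianVolume m M) :=
        (integral_finsetSum _ fun i _ => hc1 _ (hcontY i)).symm
    _ ≤ _ := by
        -- The partition functions are nonnegative with sum at most 1, so summing the local bounds
        -- costs no constant.
        refine integral_mono (integrable_finsetSum _ fun i _ => hc1 _ (hcontY i))
          (hc1 _ hcont) fun q => ?_
        have he : ∑ i, 2 * (L * η q) * (√(normSqCovDeriv m n φ V q) * ‖f i q • Z q‖)
            = (∑ i, f i q) * (2 * (L * η q) * (√(normSqCovDeriv m n φ V q) * ‖Z q‖)) := by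
          rw [Finset.sum_mul]
          refine Finset.sum_congr rfl fun i _ => ?_
          rw [norm_smul, Real.norm_of_nonneg (f.nonneg i q)]
          ring
        beta_reduce
        rw [he]
        refine mul_le_of_le_one_left ?_ (hle q)
        have := h0 q
        positivity

end GlobalIntegrationByParts

/-! ### The vanishing argument with cutoff functions -/

section Vanishing

variable {m : ℕ}
  {M : Type*} [EMetricSpace M] [SecondCountableTopology M] [MeasurableSpace M] [BorelSpace M]
  [ChartedSpace (EuclideanSpace ℝ (Fin m)) M] [IsManifold (𝓡 m) ∞ M]
  [RiemannianBundle (fun x : M => TangentSpace (𝓡 m) x)]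
  [IsContMDiffRiemannianBundle (𝓡 m) ∞ (EuclideanSpace ℝ (Fin m))
      (fun x : M => TangentSpace (𝓡 m) x)]
  [IsRiemannianManifold (𝓡 m) M]

/-- The points at finite distance from `x₀`. -/
def finiteDist (x₀ : M) : Set M := {x | edist x₀ x < ⊤}

/-- `M` is not assumed connected, so `edist` may be infinite and cutoffs around `x₀` vanish beyond
finite distance. The argument is therefore run on these open sets, one for each point. -/
lemma isOpen_finiteDist (x₀ : M) : IsOpen (finiteDist x₀) :=
  isOpen_lt (continuous_const.edist continuous_id) continuous_const

lemma mem_finiteDist_self (x₀ : M) : x₀ ∈ finiteDist x₀ := by simp [finiteDist]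

lemma cutoff_eq_zero_of_notMem (x₀ : M) {R : ℝ} (hR : 0 < R) {x : M} (hx : x ∉ finiteDist x₀) :
    cutoff x₀ hR x = 0 :=
  cutoff_eq_zero x₀ hR (by
    have : edist x₀ x = ⊤ := not_lt_top_iff.1 hx
    rw [this]
    exact le_top)

/-- Young's inequality, weighted so that the term in `P` has coefficient `1 / 2` and can be
absorbed. -/
lemma two_mul_mul_le {a L P S G : ℝ} (hP : 0 ≤ P) (hS : 0 ≤ S) (hG : G ^ 2 ≤ P * S) :
    2 * (L * a) * G ≤ 1 / 2 * (a ^ 2 * P) + 2 * L ^ 2 * S := by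
  refine le_of_sq_le_sq (b := 1 / 2 * (a ^ 2 * P) + 2 * L ^ 2 * S) ?_ (by positivity)
  nlinarith [sq_nonneg (1 / 2 * (a ^ 2 * P) - 2 * L ^ 2 * S),
    mul_le_mul_of_nonneg_left hG (by positivity : 0 ≤ 4 * L ^ 2 * a ^ 2)]

variable (m) in
/-- The integral of `T` against squares of cutoff functions is controlled by `G`. -/
def ControlledBy (T G : M → ℝ) : Prop :=
  ∀ (η : M → ℝ) (L : NNReal), LipschitzWith L η → (∀ x, 0 ≤ η x) → (∀ x, η x ≤ 1) →
    HasCompactSupport η →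
    |∫ q, η q ^ 2 * T q ∂(riemannianVolume m M)|
      ≤ ∫ q, 2 * (L * η q) * G q ∂(riemannianVolume m M)

/-- A Caccioppoli inequality: the error `2 R⁻¹ η G` is at most `½ η² P + 2 R⁻² S`. Half of the left
side is absorbed, and doubling gives the constants 2 and 4. -/
lemma integral_cutoff_sq_le [CompleteSpace M] {T P Q S G : M → ℝ} (hT : Continuous T)
    (hP : Continuous P) (hQ : Continuous Q) (hG : Continuous G)
    (hP0 : ∀ x, 0 ≤ P x) (hS0 : ∀ x, 0 ≤ S x)
    (hPT : ∀ x, P x ≤ T x + Q x) (hGS : ∀ x, G x ^ 2 ≤ P x * S x)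
    (hTG : ControlledBy m T G) (x₀ : M)
    (hSi : IntegrableOn S (finiteDist x₀) (riemannianVolume m M)) {R : ℝ} (hR : 0 < R) :
    ∫ q, cutoff x₀ hR q ^ 2 * P q ∂(riemannianVolume m M)
      ≤ 2 * ∫ q, cutoff x₀ hR q ^ 2 * Q q ∂(riemannianVolume m M)
        + 4 * R⁻¹ ^ 2 * ∫ q in finiteDist x₀, S q ∂(riemannianVolume m M) := by
  set η := cutoff x₀ hR with hη
  have hηL : LipschitzWith R.toNNReal⁻¹ η := lipschitzWith_cutoff x₀ hR
  have hηc : HasCompactSupport η := hasCompactSupport_cutoff x₀ hR m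
  have hLR : ((R.toNNReal⁻¹ : NNReal) : ℝ) = R⁻¹ := by
    rw [NNReal.coe_inv, Real.coe_toNNReal _ hR.le]
  have hi2 : ∀ D : M → ℝ, Continuous D →
      Integrable (fun q => η q ^ 2 * D q) (riemannianVolume m M) := by
    intro D hD
    have h := integrable_mul_of_hasCompactSupport (m := m) hηL.continuous hηc
      (hηL.continuous.mul hD)
    refine h.congr (Filter.Eventually.of_forall fun q => ?_)
    simp only [Pi.mul_apply]
    ring
  have hiG : Integrable (fun q => 2 * (R⁻¹ * η q) * G q) (riemannianVolume m M) := by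
    have h := (integrable_mul_of_hasCompactSupport (m := m) hηL.continuous hηc hG).const_mul
      (2 * R⁻¹)
    refine h.congr (Filter.Eventually.of_forall fun q => ?_)
    ring
  have hSind : Integrable ((finiteDist x₀).indicator S) (riemannianVolume m M) :=
    (integrable_indicator_iff (isOpen_finiteDist x₀).measurableSet).2 hSi
  have h1 : ∫ q, η q ^ 2 * P q ∂(riemannianVolume m M)
      ≤ ∫ q, η q ^ 2 * T q ∂(riemannianVolume m M)
        + ∫ q, η q ^ 2 * Q q ∂(riemannianVolume m M) := by
    rw [← integral_add (hi2 T hT) (hi2 Q hQ)]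
    refine integral_mono (hi2 P hP) ((hi2 T hT).add (hi2 Q hQ)) fun q => ?_
    have := mul_le_mul_of_nonneg_left (hPT q) (sq_nonneg (η q))
    linarith
  have h2 := (le_abs_self _).trans (hTG η _ hηL (cutoff_nonneg x₀ hR) (cutoff_le_one x₀ hR) hηc)
  rw [hLR] at h2
  have h3 : ∫ q, 2 * (R⁻¹ * η q) * G q ∂(riemannianVolume m M)
      ≤ 1 / 2 * ∫ q, η q ^ 2 * P q ∂(riemannianVolume m M)
        + 2 * R⁻¹ ^ 2 * ∫ q in finiteDist x₀, S q ∂(riemannianVolume m M) := by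
    rw [← integral_indicator (isOpen_finiteDist x₀).measurableSet, ← integral_const_mul,
      ← integral_const_mul, ← integral_add ((hi2 P hP).const_mul _) (hSind.const_mul _)]
    refine integral_mono hiG (((hi2 P hP).const_mul _).add (hSind.const_mul _)) fun q => ?_
    beta_reduce
    by_cases hq : q ∈ finiteDist x₀
    · rw [Set.indicator_of_mem hq]
      exact two_mul_mul_le (hP0 q) (hS0 q) (hGS q)
    · rw [Set.indicator_of_notMem hq, hη, cutoff_eq_zero_of_notMem x₀ hR hq]
      simp
  linarith

/-- `R → ∞` in `integral_cutoff_sq_le`: the term in `S` disappears like `R⁻²`, and Fatou's lemma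
passes to the limit on the left without assuming `P` integrable. -/
theorem lintegral_le_of_controlledBy [CompleteSpace M] {T P Q S G : M → ℝ} (hT : Continuous T)
    (hP : Continuous P) (hQ : Continuous Q) (hS : Continuous S) (hG : Continuous G)
    (hP0 : ∀ x, 0 ≤ P x) (hQ0 : ∀ x, 0 ≤ Q x) (hS0 : ∀ x, 0 ≤ S x)
    (hPT : ∀ x, P x ≤ T x + Q x) (hGS : ∀ x, G x ^ 2 ≤ P x * S x)
    (hTG : ControlledBy m T G) (x₀ : M)
    (hSi : ∫⁻ q in finiteDist x₀, ENNReal.ofReal (S q) ∂(riemannianVolume m M) < ⊤) :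
    ∫⁻ q in finiteDist x₀, ENNReal.ofReal (P q) ∂(riemannianVolume m M)
      ≤ 2 * ∫⁻ q in finiteDist x₀, ENNReal.ofReal (Q q) ∂(riemannianVolume m M) := by
  set μ := (riemannianVolume m M).restrict (finiteDist x₀) with hμ
  have hintegrable : ∀ {D : M → ℝ}, Continuous D → (∀ x, 0 ≤ D x) →
      ∫⁻ q, ENNReal.ofReal (D q) ∂μ < ⊤ → Integrable D μ := by
    intro D hD hD0 hlt
    refine ⟨hD.aestronglyMeasurable, ?_⟩
    rw [hasFiniteIntegral_iff_ofReal (Filter.Eventually.of_forall hD0)]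
    exact hlt
  -- If the integral of `Q` is infinite there is nothing to prove; otherwise Bochner integrals are
  -- available.
  by_cases hQt : ∫⁻ q, ENNReal.ofReal (Q q) ∂μ = ⊤
  · rw [hQt, ENNReal.mul_top two_ne_zero]
    exact le_top
  have hSI : Integrable S μ := hintegrable hS hS0 hSi
  have hQI : Integrable Q μ := hintegrable hQ hQ0 (lt_top_iff_ne_top.2 hQt)
  set η : ℕ → M → ℝ := fun k => cutoff x₀ (R := (k : ℝ) + 1) (by positivity) with hη
  have hηc : ∀ k, Continuous (η k) := fun k => (lipschitzWith_cutoff x₀ _).continuous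
  have hset : ∀ (k : ℕ) (D : M → ℝ), ∫ q, η k q ^ 2 * D q ∂μ
      = ∫ q, η k q ^ 2 * D q ∂(riemannianVolume m M) := by
    intro k D
    refine setIntegral_eq_integral_of_forall_compl_eq_zero fun q hq => ?_
    simp only [hη]
    rw [cutoff_eq_zero_of_notMem x₀ _ hq]
    simp
  have hle1 : ∀ k q, η k q ^ 2 ≤ 1 := fun k q =>
    pow_le_one₀ (cutoff_nonneg x₀ _ q) (cutoff_le_one x₀ _ q)
  have hPint : ∀ k, Integrable (fun q => η k q ^ 2 * P q) μ := by
    intro k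
    have h := integrable_mul_of_hasCompactSupport (m := m) (hηc k)
      (hasCompactSupport_cutoff x₀ _ m) ((hηc k).mul hP)
    refine (h.congr (Filter.Eventually.of_forall fun q => ?_)).restrict
    simp only [Pi.mul_apply]
    ring
  have hk : ∀ k : ℕ, ∫⁻ q, ENNReal.ofReal (η k q ^ 2 * P q) ∂μ
      ≤ 2 * ∫⁻ q, ENNReal.ofReal (Q q) ∂μ
        + ENNReal.ofReal (4 * ((k : ℝ) + 1)⁻¹ ^ 2 * ∫ q, S q ∂μ) := by
    intro k
    have hR : (0 : ℝ) < (k : ℝ) + 1 := by positivity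
    have h := integral_cutoff_sq_le hT hP hQ hG hP0 hS0 hPT hGS hTG x₀ hSI hR
    have hQle : ∫ q, η k q ^ 2 * Q q ∂μ ≤ ∫ q, Q q ∂μ := by
      refine integral_mono_of_nonneg (Filter.Eventually.of_forall fun q => ?_) hQI
        (Filter.Eventually.of_forall fun q => ?_)
      · exact mul_nonneg (sq_nonneg _) (hQ0 q)
      · exact mul_le_of_le_one_left (hQ0 q) (hle1 k q)
    have hSn : 0 ≤ ∫ q, S q ∂μ := integral_nonneg hS0
    rw [← ofReal_integral_eq_lintegral_ofReal (hPint k)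
        (Filter.Eventually.of_forall fun q => mul_nonneg (sq_nonneg _) (hP0 q)),
      ← ofReal_integral_eq_lintegral_ofReal hQI (Filter.Eventually.of_forall hQ0),
      ← ENNReal.ofReal_ofNat 2, ← ENNReal.ofReal_mul zero_le_two,
      ← ENNReal.ofReal_add (mul_nonneg zero_le_two (integral_nonneg hQ0)) (by positivity)]
    refine ENNReal.ofReal_le_ofReal ?_
    have e1 := hset k P
    have e2 := hset k Q
    simp only [hη] at e1 e2 hQle ⊢
    rw [e1]
    rw [e2] at hQle
    linarith
  have hlim : Filter.Tendsto (fun k : ℕ => 2 * ∫⁻ q, ENNReal.ofReal (Q q) ∂μ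
      + ENNReal.ofReal (4 * ((k : ℝ) + 1)⁻¹ ^ 2 * ∫ q, S q ∂μ)) Filter.atTop
      (𝓝 (2 * ∫⁻ q, ENNReal.ofReal (Q q) ∂μ)) := by
    have h1 : Filter.Tendsto (fun k : ℕ => 4 * ((k : ℝ) + 1)⁻¹ ^ 2 * ∫ q, S q ∂μ) Filter.atTop
        (𝓝 (4 * 0 ^ 2 * ∫ q, S q ∂μ)) := by
      have h0 := tendsto_one_div_add_atTop_nhds_zero_nat (𝕜 := ℝ)
      simp only [one_div] at h0
      exact ((h0.pow 2).const_mul 4).mul_const _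
    have h2 := (ENNReal.tendsto_ofReal h1).const_add (2 * ∫⁻ q, ENNReal.ofReal (Q q) ∂μ)
    simpa using h2
  have hmeas : ∀ k, Measurable fun q => ENNReal.ofReal (η k q ^ 2 * P q) := fun k =>
    ENNReal.measurable_ofReal.comp (((hηc k).pow 2).mul hP).measurable
  calc ∫⁻ q, ENNReal.ofReal (P q) ∂μ
      = ∫⁻ q, Filter.liminf (fun k => ENNReal.ofReal (η k q ^ 2 * P q)) Filter.atTop ∂μ := by
        refine setLIntegral_congr_fun (isOpen_finiteDist x₀).measurableSet fun q hq => ?_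
        have h1 := ((tendsto_cutoff x₀ (ne_of_lt hq)).pow 2).mul_const (P q)
        have h2 := (ENNReal.tendsto_ofReal h1).liminf_eq
        simp only [one_pow, one_mul] at h2
        exact h2.symm
    _ ≤ Filter.liminf (fun k => ∫⁻ q, ENNReal.ofReal (η k q ^ 2 * P q) ∂μ) Filter.atTop :=
        lintegral_liminf_le hmeas
    _ ≤ Filter.liminf (fun k : ℕ => 2 * ∫⁻ q, ENNReal.ofReal (Q q) ∂μ
          + ENNReal.ofReal (4 * ((k : ℝ) + 1)⁻¹ ^ 2 * ∫ q, S q ∂μ)) Filter.atTop :=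
        Filter.liminf_le_liminf (Filter.Eventually.of_forall hk)
    _ = 2 * ∫⁻ q, ENNReal.ofReal (Q q) ∂μ := hlim.liminf_eq

/-- The case `Q = 0`: the integral of `P` is zero, and continuity makes `P` vanish at every point at
finite distance. -/
theorem eq_zero_of_controlledBy [CompleteSpace M] {T P S G : M → ℝ} (hT : Continuous T)
    (hP : Continuous P) (hS : Continuous S) (hG : Continuous G)
    (hP0 : ∀ x, 0 ≤ P x) (hS0 : ∀ x, 0 ≤ S x)
    (hPT : ∀ x, P x ≤ T x) (hGS : ∀ x, G x ^ 2 ≤ P x * S x)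
    (hTG : ControlledBy m T G) {x₀ : M}
    (hSi : ∫⁻ q in finiteDist x₀, ENNReal.ofReal (S q) ∂(riemannianVolume m M) < ⊤) {x : M}
    (hx : x ∈ finiteDist x₀) :
    P x = 0 := by
  have h := lintegral_le_of_controlledBy (Q := fun _ => 0) hT hP continuous_const hS hG hP0
    (fun _ => le_rfl) hS0 (fun x => by simpa using hPT x) hGS hTG x₀ hSi
  simp only [ENNReal.ofReal_zero, lintegral_zero, mul_zero, nonpos_iff_eq_zero] at h
  rw [lintegral_eq_zero_iff (hP.measurable.ennreal_ofReal)] at h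
  have hae : P =ᵐ[(riemannianVolume m M).restrict (finiteDist x₀)] fun _ => 0 := by
    filter_upwards [h] with q hq
    exact le_antisymm (ENNReal.ofReal_eq_zero.1 hq) (hP0 q)
  exact Measure.eqOn_open_of_ae_eq hae (isOpen_finiteDist x₀) hP.continuousOn
    continuousOn_const hx

end Vanishing

/-! ### Vanishing of the tension field -/

section Main

variable {m n : ℕ}
  {M : Type*} [EMetricSpace M] [SecondCountableTopology M] [MeasurableSpace M] [BorelSpace M]
  [ChartedSpace (EuclideanSpace ℝ (Fin m)) M] [IsManifold (𝓡 m) ∞ M]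
  [RiemannianBundle (fun x : M => TangentSpace (𝓡 m) x)]
  [IsContMDiffRiemannianBundle (𝓡 m) ∞ (EuclideanSpace ℝ (Fin m))
      (fun x : M => TangentSpace (𝓡 m) x)]
  [IsRiemannianManifold (𝓡 m) M]
  {N : Type*} [TopologicalSpace N] [ChartedSpace (EuclideanSpace ℝ (Fin n)) N]
  [IsManifold (𝓡 n) ∞ N]
  [RiemannianBundle (fun p : N => TangentSpace (𝓡 n) p)]
  [IsContMDiffRiemannianBundle (𝓡 n) ∞ (EuclideanSpace ℝ (Fin n))
      (fun p : N => TangentSpace (𝓡 n) p)]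
  {φ : M → N} {V Z : ∀ x : M, TangentSpace (𝓡 n) (φ x)}

lemma controlledBy_divPair (hφ : ContMDiff (𝓡 m) (𝓡 n) ∞ φ) (hV : SmoothSec m n φ V)
    (hZ : SmoothSec m n φ Z) :
    ControlledBy m (divPair m n φ V Z) fun q => √(normSqCovDeriv m n φ V q) * ‖Z q‖ :=
  fun _ _ h1 h2 h3 h4 => abs_integral_sq_mul_divPair_le hφ hV hZ h1 h2 h3 h4

lemma ControlledBy.neg {T G : M → ℝ} (h : ControlledBy m T G) :
    ControlledBy m (fun q => -T q) G := by
  intro η L h1 h2 h3 h4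
  simp only [mul_neg, integral_neg, abs_neg]
  exact h η L h1 h2 h3 h4

lemma ControlledBy.add_const_mul {T T' G G' : M → ℝ} (h : ControlledBy m T G)
    (h' : ControlledBy m T' G') (hT : Continuous T) (hT' : Continuous T') (hG : Continuous G)
    (hG' : Continuous G') {k : ℝ} (hk : 0 ≤ k) :
    ControlledBy m (fun q => T q + k * T' q) fun q => G q + k * G' q := by
  intro η L h1 h2 h3 h4
  have hi2 : ∀ D : M → ℝ, Continuous D →
      Integrable (fun q => η q ^ 2 * D q) (riemannianVolume m M) := by
    intro D hD
    have h := integrable_mul_of_hasCompactSupport (m := m) h1.continuous h4 (h1.continuous.mul hD)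
    refine h.congr (Filter.Eventually.of_forall fun q => ?_)
    simp only [Pi.mul_apply]
    ring
  have hi1 : ∀ D : M → ℝ, Continuous D →
      Integrable (fun q => 2 * (L * η q) * D q) (riemannianVolume m M) := by
    intro D hD
    have h := (integrable_mul_of_hasCompactSupport (m := m) h1.continuous h4 hD).const_mul (2 * L)
    refine h.congr (Filter.Eventually.of_forall fun q => ?_)
    ring
  have e1 : ∫ q, η q ^ 2 * (T q + k * T' q) ∂(riemannianVolume m M)
      = ∫ q, η q ^ 2 * T q ∂(riemannianVolume m M)
        + k * ∫ q, η q ^ 2 * T' q ∂(riemannianVolume m M) := by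
    rw [← integral_const_mul, ← integral_add (hi2 T hT) ((hi2 T' hT').const_mul k)]
    congr 1
    ext q
    ring
  have e2 : ∫ q, 2 * (L * η q) * (G q + k * G' q) ∂(riemannianVolume m M)
      = ∫ q, 2 * (L * η q) * G q ∂(riemannianVolume m M)
        + k * ∫ q, 2 * (L * η q) * G' q ∂(riemannianVolume m M) := by
    rw [← integral_const_mul, ← integral_add (hi1 G hG) ((hi1 G' hG').const_mul k)]
    congr 1
    ext q
    ring
  rw [e1, e2]
  refine (abs_add_le _ _).trans (add_le_add (h η L h1 h2 h3 h4) ?_)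
  rw [abs_mul, abs_of_nonneg hk]
  exact mul_le_mul_of_nonneg_left (h' η L h1 h2 h3 h4) hk

lemma covDeriv_frame_eq_zero {q : M} (h : normSqCovDeriv m n φ V q = 0)
    (i : Fin (Module.finrank ℝ (TangentSpace (𝓡 m) q))) :
    covDeriv m n φ V q (frame m q i) = 0 := by
  have := (Finset.sum_eq_zero_iff_of_nonneg fun i _ => sq_nonneg _).1 h i (Finset.mem_univ i)
  exact norm_eq_zero.1 (pow_eq_zero_iff two_ne_zero |>.1 this)

lemma IsIsometricImmersion.tension_eq_zero (hφ : IsIsometricImmersion m n φ) {q : M}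
    (h : normSqCovDeriv m n φ (tension m n φ) q = 0) : tension m n φ q = 0 := by
  have h1 := hφ.sum_covDeriv_tension q
  rw [Finset.sum_eq_zero fun i _ => by rw [covDeriv_frame_eq_zero h i, inner_zero_left]] at h1
  exact norm_eq_zero.1 (pow_eq_zero_iff two_ne_zero |>.1 (neg_eq_zero.1 h1.symm))

/-- Differentiating `|V|² V` also produces the term `2 ∑ᵢ ⟨∇̄_eᵢ V, V⟩²`, which is nonnegative and
dropped. -/
lemma norm_sq_mul_normSqCovDeriv_le (hφ : ContMDiff (𝓡 m) (𝓡 n) ∞ φ) (hV : SmoothSec m n φ V)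
    (q : M) :
    ‖V q‖ ^ 2 * normSqCovDeriv m n φ V q
      ≤ gradInner m n φ V (fun q => inner ℝ (V q) (V q) • V q) q := by
  rw [gradInner_smul hφ V hV (hV.smoothFn_inner hφ hV), gradInner_self, real_inner_self_eq_norm_sq]
  refine le_add_of_nonneg_right (Finset.sum_nonneg fun i _ => ?_)
  rw [dfn_inner hφ hV hV, real_inner_comm (covDeriv m n φ V q (frame m q i)) (V q)]
  nlinarith [sq_nonneg (inner ℝ (covDeriv m n φ V q (frame m q i)) (V q))]

/-- Each `dφ eᵢ` is a unit vector, so Cauchy–Schwarz applies term by term. This fixes the sign of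
the curvature term when `c ≤ 0`. -/
lemma IsIsometricImmersion.sum_norm_sq_sub_inner_sq_nonneg (hφ : IsIsometricImmersion m n φ) (q : M)
    (w : TangentSpace (𝓡 n) (φ q)) :
    0 ≤ ∑ i, (‖w‖ ^ 2 - inner ℝ w (mfderiv (𝓡 m) (𝓡 n) φ q (frame m q i)) ^ 2) := by
  refine Finset.sum_nonneg fun i _ => sub_nonneg.2 ?_
  have h1 : ‖mfderiv (𝓡 m) (𝓡 n) φ q (frame m q i)‖ = 1 := by
    have h := hφ.2 q (frame m q i) (frame m q i)
    rw [real_inner_self_eq_norm_sq, real_inner_self_eq_norm_sq, (frame m q).norm_eq_one] at h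
    exact (pow_eq_one_iff_of_nonneg (norm_nonneg _) two_ne_zero).1 (h.trans (one_pow 2))
  have h2 := abs_real_inner_le_norm w (mfderiv (𝓡 m) (𝓡 n) φ q (frame m q i))
  rw [h1, mul_one] at h2
  rw [← sq_abs]
  gcongr

/-- Cauchy–Schwarz with weights 1 and `k`; the defect is `k (a t - b s)²`. -/
lemma sq_add_const_mul_le {k a b s t : ℝ} (hk : 0 ≤ k) :
    (a * b + k * (s * t)) ^ 2 ≤ (a ^ 2 + k * s ^ 2) * (b ^ 2 + k * t ^ 2) := by
  nlinarith [mul_nonneg hk (sq_nonneg (a * t - b * s))]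

/-- The fundamental vanishing: `|∇̄Δ̄τ|² + |c| |τ|² |∇̄τ|² = 0`. -/
theorem normSqCovDeriv_roughLaplacian_add_eq_zero [CompleteSpace M] {c : ℝ} (hc : c ≤ 0)
    (hN : HasConstantCurvature n N c) (hφ : IsIsometricImmersion m n φ)
    (htri : IsTriharmonic m n φ)
    (hE4 : ∫⁻ q, ENNReal.ofReal (‖roughLaplacian m n φ (tension m n φ) q‖ ^ 2)
      ∂(riemannianVolume m M) < ⊤)
    (hL4 : ∫⁻ q, ENNReal.ofReal (‖tension m n φ q‖ ^ 4) ∂(riemannianVolume m M) < ⊤) (q : M) :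
    normSqCovDeriv m n φ (roughLaplacian m n φ (tension m n φ)) q
      + -c * (‖tension m n φ q‖ ^ 2 * normSqCovDeriv m n φ (tension m n φ) q) = 0 := by
  set τ := tension m n φ with hτdef
  set W := roughLaplacian m n φ τ with hWdef
  have hk : 0 ≤ -c := neg_nonneg.2 hc
  have hτ : SmoothSec m n φ τ := smoothSec_tension hφ.1
  have hW : SmoothSec m n φ W := hτ.roughLaplacian hφ.1
  have hU : SmoothSec m n φ (fun q => inner ℝ (τ q) (τ q) • τ q) :=
    hτ.smul (hτ.smoothFn_inner hφ.1 hτ)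
  have cτ := hτ.continuous_norm hφ.1
  have cW := hW.continuous_norm hφ.1
  have cU := hU.continuous_norm hφ.1
  have dτ := continuous_normSqCovDeriv hφ.1 hτ
  have dW := continuous_normSqCovDeriv hφ.1 hW
  have cT1 := continuous_divPair hφ.1 hW hW
  have cT2 := continuous_divPair hφ.1 hτ hU
  have hctrl := (controlledBy_divPair hφ.1 hW hW).add_const_mul (controlledBy_divPair hφ.1 hτ hU)
    cT1 cT2 (dW.sqrt.mul cW) (dτ.sqrt.mul cU) hk
  -- The divergence of `⟨∇̄τ, |τ|²τ⟩`, weighted by `-c`, is added to cancel the indefinite term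
  -- `|τ|² ⟨τ, W⟩` of the Euler–Lagrange equation.
  refine eq_zero_of_controlledBy
    (T := fun q => divPair m n φ W W q
      + -c * divPair m n φ τ (fun q => inner ℝ (τ q) (τ q) • τ q) q)
    (G := fun q => √(normSqCovDeriv m n φ W q) * ‖W q‖
      + -c * (√(normSqCovDeriv m n φ τ q) * ‖inner ℝ (τ q) (τ q) • τ q‖))
    (P := fun q => normSqCovDeriv m n φ W q
      + -c * (‖τ q‖ ^ 2 * normSqCovDeriv m n φ τ q))
    (S := fun q => ‖W q‖ ^ 2 + -c * ‖τ q‖ ^ 4) (x₀ := q) (cT1.add (continuous_const.mul cT2))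
    (dW.add (continuous_const.mul ((cτ.pow 2).mul dτ)))
    ((cW.pow 2).add (continuous_const.mul (cτ.pow 4)))
    ((dW.sqrt.mul cW).add (continuous_const.mul (dτ.sqrt.mul cU))) ?_ ?_ ?_ ?_ hctrl ?_
    (mem_finiteDist_self q)
  · intro x
    have h1 := normSqCovDeriv_nonneg (m := m) φ W x
    have h2 := normSqCovDeriv_nonneg (m := m) φ τ x
    positivity
  · intro x
    positivity
  · intro x
    have h1 := inner_roughLaplacian_roughLaplacian_tension hN hφ htri x
    have h2 := mul_nonneg hk (hφ.sum_norm_sq_sub_inner_sq_nonneg x (W x))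
    have h3 := mul_le_mul_of_nonneg_left (norm_sq_mul_normSqCovDeriv_le hφ.1 hτ x) hk
    simp only [divPair, gradInner_self]
    rw [← hτdef, ← hWdef] at h1
    rw [h1, ← hWdef, real_inner_smul_right, real_inner_self_eq_norm_sq, real_inner_comm (τ x) (W x)]
    linarith
  · intro x
    have h1 := normSqCovDeriv_nonneg (m := m) φ W x
    have h2 := normSqCovDeriv_nonneg (m := m) φ τ x
    -- The error `|∇̄τ| |τ|³` is split as `(|τ| |∇̄τ|) · |τ|²`: the first factor belongs to `P`, the
    -- second to `S`.
    have h := sq_add_const_mul_le (a := √(normSqCovDeriv m n φ W x)) (b := ‖W x‖)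
      (s := ‖τ x‖ * √(normSqCovDeriv m n φ τ x)) (t := ‖τ x‖ ^ 2) hk
    rw [mul_pow, Real.sq_sqrt h1, Real.sq_sqrt h2, ← pow_mul] at h
    refine le_trans (le_of_eq ?_) h
    rw [norm_smul, real_inner_self_eq_norm_sq, Real.norm_of_nonneg (sq_nonneg _)]
    ring
  · refine (setLIntegral_le_lintegral _ _).trans_lt ?_
    have he : ∀ x, ENNReal.ofReal (‖W x‖ ^ 2 + -c * ‖τ x‖ ^ 4)
        = ENNReal.ofReal (‖W x‖ ^ 2) + ENNReal.ofReal (-c) * ENNReal.ofReal (‖τ x‖ ^ 4) := fun x => by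
      rw [ENNReal.ofReal_add (by positivity) (by positivity), ENNReal.ofReal_mul hk]
    simp only [he]
    rw [lintegral_add_left (f := fun q => ENNReal.ofReal (‖W q‖ ^ 2))
        (cW.pow 2).measurable.ennreal_ofReal,
      lintegral_const_mul (f := fun q => ENNReal.ofReal (‖τ q‖ ^ 4)) _ (cτ.pow 4).measurable.ennreal_ofReal]
    exact ENNReal.add_lt_top.2 ⟨hE4, ENNReal.mul_lt_top ENNReal.ofReal_lt_top hL4⟩

/-- If a section and its rough Laplacian are square integrable, then so is its derivative. -/
lemma lintegral_normSqCovDeriv_lt_top [CompleteSpace M] (hφ : ContMDiff (𝓡 m) (𝓡 n) ∞ φ)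
    (hV : SmoothSec m n φ V) (x₀ : M)
    (hV2 : ∫⁻ q, ENNReal.ofReal (‖V q‖ ^ 2) ∂(riemannianVolume m M) < ⊤)
    (hW2 : ∫⁻ q, ENNReal.ofReal (‖roughLaplacian m n φ V q‖ ^ 2) ∂(riemannianVolume m M) < ⊤) :
    ∫⁻ q in finiteDist x₀, ENNReal.ofReal (normSqCovDeriv m n φ V q)
      ∂(riemannianVolume m M) < ⊤ := by
  have hW := hV.roughLaplacian hφ
  have cV := hV.continuous_norm hφ
  have cW := hW.continuous_norm hφ
  have dV := continuous_normSqCovDeriv hφ hV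
  refine (lintegral_le_of_controlledBy
    (G := fun q => √(normSqCovDeriv m n φ V q) * ‖V q‖) (Q := fun q => ‖roughLaplacian m n φ V q‖ * ‖V q‖)
    (S := fun q => ‖V q‖ ^ 2) (continuous_divPair hφ hV hV) dV (cW.mul cV) (cV.pow 2)
    (dV.sqrt.mul cV) (normSqCovDeriv_nonneg φ V) (fun _ => by positivity) (fun _ => by positivity)
    (fun x => ?_) (fun x => ?_) (controlledBy_divPair hφ hV hV) x₀
    ((setLIntegral_le_lintegral _ _).trans_lt hV2)).trans_lt ?_
  -- Here `|∇̄V|² = div ⟨∇̄V, V⟩ + ⟨Δ̄V, V⟩`, and the last term is bounded by `Q = |Δ̄V| |V|`, which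
  -- is integrable.
  · rw [divPair, gradInner_self]
    linarith [real_inner_le_norm (roughLaplacian m n φ V x) (V x)]
  · rw [mul_pow, Real.sq_sqrt (normSqCovDeriv_nonneg φ V x)]
  · refine ENNReal.mul_lt_top ENNReal.ofNat_lt_top
      ((setLIntegral_le_lintegral _ _).trans_lt ?_)
    refine (lintegral_mono (g := fun q => ENNReal.ofReal (‖roughLaplacian m n φ V q‖ ^ 2)
      + ENNReal.ofReal (‖V q‖ ^ 2)) fun q => ?_).trans_lt ?_
    · beta_reduce
      rw [← ENNReal.ofReal_add (by positivity) (by positivity)]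
      refine ENNReal.ofReal_le_ofReal ?_
      nlinarith [sq_nonneg (‖roughLaplacian m n φ V q‖ - ‖V q‖), norm_nonneg (V q),
        norm_nonneg (roughLaplacian m n φ V q)]
    · rw [lintegral_add_left (f := fun q => ENNReal.ofReal (‖roughLaplacian m n φ V q‖ ^ 2))
        (cW.pow 2).measurable.ennreal_ofReal]
      exact ENNReal.add_lt_top.2 ⟨hW2, hV2⟩

/-- A section that, with its derivative, is square integrable, and whose rough Laplacian is
parallel, is parallel. -/
lemma normSqCovDeriv_eq_zero_of_parallel [CompleteSpace M] (hφ : ContMDiff (𝓡 m) (𝓡 n) ∞ φ)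
    (hV : SmoothSec m n φ V)
    (hpar : ∀ q, normSqCovDeriv m n φ (roughLaplacian m n φ V) q = 0)
    (hV2 : ∫⁻ q, ENNReal.ofReal (‖V q‖ ^ 2) ∂(riemannianVolume m M) < ⊤)
    (hdV : ∀ x₀ : M, ∫⁻ q in finiteDist x₀, ENNReal.ofReal (normSqCovDeriv m n φ V q)
      ∂(riemannianVolume m M) < ⊤) (q : M) :
    normSqCovDeriv m n φ V q = 0 := by
  have hW := hV.roughLaplacian hφ
  have cV := hV.continuous_norm hφ
  have cW := hW.continuous_norm hφ
  have dV := continuous_normSqCovDeriv hφ hV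
  have hW0 : ∀ q, roughLaplacian m n φ V q = 0 := by
    intro q
    -- With `Δ̄V` parallel, `div ⟨∇̄V, Δ̄V⟩ = -|Δ̄V|²`; the error term is controlled by the
    -- integrability of `|∇̄V|²`.
    have h := eq_zero_of_controlledBy
      (T := fun q => -divPair m n φ V (roughLaplacian m n φ V) q)
      (G := fun q => √(normSqCovDeriv m n φ V q) * ‖roughLaplacian m n φ V q‖)
      (P := fun q => ‖roughLaplacian m n φ V q‖ ^ 2)
      (S := normSqCovDeriv m n φ V) (continuous_divPair hφ hV hW).neg (cW.pow 2) dV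
      (dV.sqrt.mul cW) (fun _ => by positivity) (normSqCovDeriv_nonneg φ V) (fun x => ?_)
      (fun x => ?_) (controlledBy_divPair hφ hV hW).neg (hdV q) (mem_finiteDist_self q)
    · exact norm_eq_zero.1 (pow_eq_zero_iff two_ne_zero |>.1 h)
    · have h0 : gradInner m n φ V (roughLaplacian m n φ V) x = 0 :=
        Finset.sum_eq_zero fun i _ => by rw [covDeriv_frame_eq_zero (hpar x) i, inner_zero_right]
      rw [divPair, h0, real_inner_self_eq_norm_sq, add_zero, neg_neg]
    · rw [mul_pow, Real.sq_sqrt (normSqCovDeriv_nonneg φ V x), mul_comm]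
  -- Now `Δ̄V = 0`, hence `div ⟨∇̄V, V⟩ = |∇̄V|²`, and the integrability of `|V|²` controls the
  -- error.
  refine eq_zero_of_controlledBy
    (G := fun q => √(normSqCovDeriv m n φ V q) * ‖V q‖) (P := normSqCovDeriv m n φ V) (S := fun q => ‖V q‖ ^ 2)
    (continuous_divPair hφ hV hV) dV (cV.pow 2) (dV.sqrt.mul cV) (normSqCovDeriv_nonneg φ V)
    (fun _ => by positivity) (fun x => ?_) (fun x => ?_) (controlledBy_divPair hφ hV hV)
    ((setLIntegral_le_lintegral _ _).trans_lt hV2) (mem_finiteDist_self q)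
  · rw [divPair, hW0, inner_zero_left, neg_zero, zero_add, gradInner_self]
  · rw [mul_pow, Real.sq_sqrt (normSqCovDeriv_nonneg φ V x)]

/-- Pointwise `t² ≤ 1 + t⁴`, and constants are integrable when the volume is finite. -/
lemma lintegral_norm_sq_lt_top (hφ : ContMDiff (𝓡 m) (𝓡 n) ∞ φ) (hV : SmoothSec m n φ V)
    (hvol : riemannianVolume m M Set.univ < ⊤)
    (hV4 : ∫⁻ q, ENNReal.ofReal (‖V q‖ ^ 4) ∂(riemannianVolume m M) < ⊤) :
    ∫⁻ q, ENNReal.ofReal (‖V q‖ ^ 2) ∂(riemannianVolume m M) < ⊤ := by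
  have cV := hV.continuous_norm hφ
  refine (lintegral_mono (g := fun q => 1 + ENNReal.ofReal (‖V q‖ ^ 4)) fun q => ?_).trans_lt ?_
  · beta_reduce
    rw [← ENNReal.ofReal_one, ← ENNReal.ofReal_add zero_le_one (by positivity)]
    refine ENNReal.ofReal_le_ofReal ?_
    nlinarith [sq_nonneg (‖V q‖ ^ 2 - 1)]
  · rw [lintegral_add_left measurable_const, lintegral_one]
    exact ENNReal.add_lt_top.2 ⟨hvol, hV4⟩

lemma lt_top_of_half_mul_lt_top {a : ℝ≥0∞} (h : 1 / 2 * a < ⊤) : a < ⊤ := by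
  rw [lt_top_iff_ne_top] at h ⊢
  rintro rfl
  exact h (ENNReal.mul_top (by simp))

end Main

end Triharmonic

end

theorem theorem2p4 {m n : ℕ}
    {M : Type*} [EMetricSpace M] [SecondCountableTopology M] [MeasurableSpace M] [BorelSpace M]
    [ChartedSpace (EuclideanSpace ℝ (Fin m)) M] [IsManifold (𝓡 m) ∞ M]
    [RiemannianBundle (fun x : M => TangentSpace (𝓡 m) x)]
    [IsContMDiffRiemannianBundle (𝓡 m) ∞ (EuclideanSpace ℝ (Fin m))
      (fun x : M => TangentSpace (𝓡 m) x)]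
    [IsRiemannianManifold (𝓡 m) M] [CompleteSpace M]
    {N : Type*} [TopologicalSpace N] [T2Space N]
    [ChartedSpace (EuclideanSpace ℝ (Fin n)) N] [IsManifold (𝓡 n) ∞ N]
    [RiemannianBundle (fun p : N => TangentSpace (𝓡 n) p)]
    [IsContMDiffRiemannianBundle (𝓡 n) ∞ (EuclideanSpace ℝ (Fin n))
      (fun p : N => TangentSpace (𝓡 n) p)]
    (c : ℝ) (hN : Triharmonic.HasConstantCurvature n N c)
    (φ : M → N) (hφ : Triharmonic.IsIsometricImmersion m n φ)
    (htri : Triharmonic.IsTriharmonic m n φ)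
    (hE4 : Triharmonic.extendedFourEnergy m n φ < ⊤)
    (hL4 : Triharmonic.tensionL4 m n φ < ⊤) :
    (c < 0 → Triharmonic.IsHarmonic m n φ) ∧
    (c = 0 → Triharmonic.riemannianVolume m M Set.univ = ⊤ →
      Triharmonic.bienergy m n φ < ⊤ →
      Triharmonic.IsHarmonic m n φ) ∧
    (c = 0 → Triharmonic.riemannianVolume m M Set.univ < ⊤ →
      Triharmonic.trienergy m n φ < ⊤ →
      Triharmonic.IsHarmonic m n φ) := by
  have hφs := hφ.1
  have hτ := Triharmonic.smoothSec_tension hφs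
  have hE4' := Triharmonic.lt_top_of_half_mul_lt_top hE4
  refine ⟨fun hc q => ?_, fun hc _ hE2 q => ?_, fun hc hvol hE3 q => ?_⟩
  · have h := Triharmonic.normSqCovDeriv_roughLaplacian_add_eq_zero hc.le hN hφ htri hE4' hL4 q
    have h1 := Triharmonic.normSqCovDeriv_nonneg (m := m) φ
      (Triharmonic.roughLaplacian m n φ (Triharmonic.tension m n φ)) q
    have h2 := Triharmonic.normSqCovDeriv_nonneg (m := m) φ (Triharmonic.tension m n φ) q
    have h3 : 0 ≤ ‖Triharmonic.tension m n φ q‖ ^ 2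
        * Triharmonic.normSqCovDeriv m n φ (Triharmonic.tension m n φ) q := by positivity
    have h4 : ‖Triharmonic.tension m n φ q‖ ^ 2
        * Triharmonic.normSqCovDeriv m n φ (Triharmonic.tension m n φ) q = 0 := by nlinarith
    -- The alternative is settled point by point: vanishing of `∇̄τ` at the single point `q` already
    -- forces `τ` to vanish there.
    rcases mul_eq_zero.1 h4 with h5 | h5
    · exact norm_eq_zero.1 (pow_eq_zero_iff two_ne_zero |>.1 h5)
    · exact hφ.tension_eq_zero h5
  · subst hc
    have hpar : ∀ x, Triharmonic.normSqCovDeriv m n φ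
        (Triharmonic.roughLaplacian m n φ (Triharmonic.tension m n φ)) x = 0 := fun x => by
      simpa using Triharmonic.normSqCovDeriv_roughLaplacian_add_eq_zero le_rfl hN hφ htri hE4' hL4 x
    have hE2' := Triharmonic.lt_top_of_half_mul_lt_top hE2
    -- For `c = 0` the section `Δ̄τ` is parallel; square integrability of `∇̄τ` comes from that of
    -- `τ` and `Δ̄τ`.
    exact hφ.tension_eq_zero (Triharmonic.normSqCovDeriv_eq_zero_of_parallel hφs hτ hpar hE2'
      (fun x₀ => Triharmonic.lintegral_normSqCovDeriv_lt_top hφs hτ x₀ hE2' hE4') q)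
  · subst hc
    have hpar : ∀ x, Triharmonic.normSqCovDeriv m n φ
        (Triharmonic.roughLaplacian m n φ (Triharmonic.tension m n φ)) x = 0 := fun x => by
      simpa using Triharmonic.normSqCovDeriv_roughLaplacian_add_eq_zero le_rfl hN hφ htri hE4' hL4 x
    have hE3' := Triharmonic.lt_top_of_half_mul_lt_top hE3
    rw [Measure.restrict_univ] at hE3'
    -- Here square integrability of `τ` comes from the `L⁴` bound and the finite volume, and that of
    -- `∇̄τ` from the finite 3-energy.
    exact hφ.tension_eq_zero (Triharmonic.normSqCovDeriv_eq_zero_of_parallel hφs hτ hpar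
      (Triharmonic.lintegral_norm_sq_lt_top hφs hτ hvol hL4)
      (fun x₀ => (setLIntegral_le_lintegral _ _).trans_lt hE3') q)
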